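/- \textbf{Conventions.} $\log$ is the logarithm with base $2$. A CNF $F$ over $n$ variables is a list of clauses; $\mathrm{size}(F)$ is $n$ plus the number of clauses plus the number of occurrences of literals, and $s=s(F)$ is the number of assignments in $\{0,1\}^n$ that satisfy $F$. $O^*(2^{cn})$ means $2^{cn}$ times a polynomial in $\mathrm{size}(F)$. Algorithms are programs of a standard sequential model (while-programs on binary trees, with unit-cost construction and selection; up to factors polynomial in the logarithm of the running time this is a random access machine with logarithmic cost). Randomized algorithms may also flip fair coins, and a running time bounds every computation path. \textbf{1. (Complexity of approximate counting)} Let $c>0$ and assume that there is a deterministic algorithm that decides satisfiability of CNFs over $n$ variables in time $O^*(2^{cn})$. Then there is a function $\alpha:(0,\infty)\to(0,\infty)$ with $\alpha(\delta)=\Omega\big(\delta^2/\log(1/\delta)\big)$ as $\delta\to0$ such that for every $\delta>0$ and every $d\in\mathbb{N}$ there is a randomized algorithm with running time $O^*(2^{(c+\delta)n})$ which, on every input CNF over $n$ variables, with probability at least $1-n^{-d}$ outputs $\tilde s$ with $$(1-2^{-\alpha(\delta) n})\,s\le\tilde s\le(1+2^{-\alpha(\delta) n})\,s .$$ \textbf{2.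 (Algorithm analysis)} For an integer $k$, algorithm ACOUNT works as follows on a CNF $F$ over $n$ variables. Put $p=\frac{k+1}{2n}$. For $l=1,\dots,n+1$, make $8\lceil\log n\rceil$ repetitions of the following: choose independent random sets $S_1,\dots,S_l\subseteq\{1,\dots,n\}$, each containing every element independently with probability $p$, and a uniform $b\in\{0,1\}^l$; if $|S_i|>k$ for some $i$, end this repetition without recording anything; otherwise let $G$ be the $k$-CNF encoding, on the same $n$ variables, of the system $\bigoplus_{j\in S_i}x_j=b_i$ $(1\le i\le l)$ and record whether $F\wedge G$ is satisfiable, by a query to a SAT oracle. If unsatisfiability was recorded more than $4\lceil\log n\rceil$ times for this $l$, output $2^{l-1}$ and halt. If this happens for no $l\le n+1$, output $0$. Algorithm ACOUNT-CONSTANT is the same, except that each $S_i$ is a uniformly random $k$-element subset of $\{1,\dots,n\}$. (a) There are a program, independent of $n$, $k$ and $F$, and an absolute constant $C$ such that, for $4\log(16n)\le k+1\le n$, the program implements ACOUNT (its output has the same distribution) in time at most $$C\cdot n\cdot\log(n)\cdot\big(n^2+2^k\cdot k\cdot n+\mathrm{size}(F)\big).$$ Here the flip of a fair coin or of a coin with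 bias $p$ takes one unit of time, and an oracle query takes one unit plus the number of clauses and of occurrences of literals of the queried CNF. (b) Let $4\log(16n)\le k+1\le n$, let $\kappa>0$ be such that $k+1=\kappa\,\log(512\kappa)\,4\log(16n)$, and let $F$ be satisfiable. With probability at least $1/4$, the output $\tilde s$ of ACOUNT satisfies $$\tfrac14\,2^{-n/\kappa}\,s\le\tilde s\le4\,s .$$ (c) For every constant $k\ge5$ and all sufficiently large $n$ (depending on $k$), if $F$ is satisfiable, then with probability at least $1/4$ the output $\tilde s$ of ACOUNT-CONSTANT satisfies $$\tfrac14\,2^{-n+\frac{\log n}{k}\,n^{1-4/k}}\,s\le\tilde s\le4\,s .$$ -/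

import Mathlib

open scoped ENNReal NNReal

/-! ## CNF formulas -/

/-- A CNF formula over the variables `0, …, n-1`: a list of clauses, each a list of literals.
The literal `(j, v)` is true under an assignment `x` iff `x j = v`. -/
abbrev CNF (n : ℕ) : Type := List (List (Fin n × Bool))

namespace CNF

/-- The truth value of a formula under an assignment. -/
def eval {n : ℕ} (F : CNF n) (x : Fin n → Bool) : Bool :=
  F.all fun C => C.any fun l => x l.1 == l.2

/-- Satisfiability. -/
def isSat {n : ℕ} (F : CNF n) : Bool := decide (∃ x, F.eval x = true)

/-- The number of satisfying assignments. -/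
def numSols {n : ℕ} (F : CNF n) : ℕ :=
  (Finset.univ.filter fun x : Fin n → Bool => F.eval x = true).card

/-- The size of a formula: number of variables, plus number of clauses, plus number of
occurrences of literals. -/
def size {n : ℕ} (F : CNF n) : ℕ := n + F.length + (F.map List.length).sum

/-- The CNF encoding of the parity constraint `⨁_{j ∈ S} x_j = b`, on the same variables: for every
`T ⊆ S` whose indicator vector violates the constraint, a clause (of width `|S|`) that excludes
the assignments agreeing on `S` with the indicator vector of `T`. -/
noncomputable def parity {n : ℕ} (S : Finset (Fin n)) (b : Bool) : CNF n :=
  (S.powerset.filter fun T => decide (T.card % 2 = 1) ≠ b).toList.map fun T =>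
    S.toList.map fun j => (j, decide (j ∉ T))

/-- The CNF encoding of `h(x) = b`, where the linear map `h` and the right-hand side `b` are
given by the list of rows `(S_i, b_i)`, each standing for `⨁_{j ∈ S_i} x_j = b_i`. -/
noncomputable def hashCNF {n : ℕ} (rows : List (Finset (Fin n) × Bool)) : CNF n :=
  rows.flatMap fun r => parity r.1 r.2

end CNF

/-! ## Sequential programs with a step count

Values are finite binary trees. A program manipulates finitely many variables by the
constant-time operations of a pointer machine (`nil`, `cons`, `hd`, `tl`), by tests against `nil`,
by loops, and by primitive operations `prim` that are random functions of one value with a cost.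
The type `P` of primitives is empty for deterministic programs. Up to factors polynomial in
`log T`, time `T` on this model is time `T` on a random access machine with logarithmic cost. -/

/-- Finite binary trees. -/
inductive Val : Type
  | nil : Val
  | node : Val → Val → Val

namespace Val

/-- Left subtree (`nil` for the empty tree). -/
def hd : Val → Val
  | nil => nil
  | node a _ => a

/-- Right subtree (`nil` for the empty tree). -/
def tl : Val → Val
  | nil => nil
  | node _ b => b

/-- Truth values: `false` is the empty tree, `true` is the one-node tree. -/
def ofBool : Bool → Val
  | false => nil
  | true => node nil nil

/-- Everything but the empty tree counts as true. -/
def toBool : Val → Bool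
  | nil => false
  | node _ _ => true

/-- Lists as right-nested trees. -/
def ofList : List Val → Val
  | [] => nil
  | a :: l => node a (ofList l)

/-- The entries of a list. -/
def toList : Val → List Val
  | nil => []
  | node a b => a :: toList b

/-- Unary numerals (lists of length `m`). -/
def ofNat (m : ℕ) : Val := ofList (List.replicate m nil)

/-- The number written in binary, least significant bit first. -/
def binToNat : Val → ℕ
  | nil => 0
  | node a b => (if a.toBool then 1 else 0) + 2 * binToNat b

/-- A literal: its sign and the index of its variable. -/
def ofLit {n : ℕ} (l : Fin n × Bool) : Val := node (ofBool l.2) (ofNat l.1)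

/-- A formula: its number of variables and the list of its clauses. -/
def ofCNF {n : ℕ} (F : CNF n) : Val :=
  node (ofNat n) (ofList (F.map fun C => ofList (C.map ofLit)))

end Val

/-- Programs over the primitives `P`. Variables are numbered by `ℕ`. -/
inductive Cmd (P : Type) : Type
  /-- `x := nil` -/
  | nil (x : ℕ) : Cmd P
  /-- `x := y` -/
  | copy (x y : ℕ) : Cmd P
  /-- `x := cons y z` -/
  | cons (x y z : ℕ) : Cmd P
  /-- `x := hd y` -/
  | hd (x y : ℕ) : Cmd P
  /-- `x := tl y` -/
  | tl (x y : ℕ) : Cmd P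
  /-- `x := q(y)` -/
  | prim (q : P) (x y : ℕ) : Cmd P
  /-- `c; d` -/
  | seq (c d : Cmd P) : Cmd P
  /-- `if x ≠ nil then c else d` -/
  | ite (x : ℕ) (c d : Cmd P) : Cmd P
  /-- `while x ≠ nil do c` -/
  | loop (x : ℕ) (c : Cmd P) : Cmd P

/-- A configuration: the commands still to be executed, the contents of the variables, and
the time that has been spent. -/
structure Config (P : Type) : Type where
  stack : List (Cmd P)
  store : ℕ → Val
  clock : ℕ

/-- The primitives: `I q v` is the law of the pair (result, additional cost) of `q` applied
to `v`. -/
abbrev Interp (P : Type) : Type := P → Val → PMF (Val × ℕ)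

namespace Config

/-- One step. A configuration with empty stack has halted. Every step takes one unit of time, and
a primitive takes its additional cost as well. -/
noncomputable def step {P : Type} (I : Interp P) : Config P → PMF (Config P)
  | ⟨[], σ, t⟩ => PMF.pure ⟨[], σ, t⟩
  | ⟨.nil x :: K, σ, t⟩ => PMF.pure ⟨K, Function.update σ x .nil, t + 1⟩
  | ⟨.copy x y :: K, σ, t⟩ => PMF.pure ⟨K, Function.update σ x (σ y), t + 1⟩
  | ⟨.cons x y z :: K, σ, t⟩ => PMF.pure ⟨K, Function.update σ x (.node (σ y) (σ z)), t + 1⟩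
  | ⟨.hd x y :: K, σ, t⟩ => PMF.pure ⟨K, Function.update σ x (σ y).hd, t + 1⟩
  | ⟨.tl x y :: K, σ, t⟩ => PMF.pure ⟨K, Function.update σ x (σ y).tl, t + 1⟩
  | ⟨.prim q x y :: K, σ, t⟩ =>
      (I q (σ y)).map fun r => ⟨K, Function.update σ x r.1, t + 1 + r.2⟩
  | ⟨.seq c d :: K, σ, t⟩ => PMF.pure ⟨c :: d :: K, σ, t + 1⟩
  | ⟨.ite x c d :: K, σ, t⟩ =>
      PMF.pure ⟨(if (σ x).toBool then c else d) :: K, σ, t + 1⟩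
  | ⟨.loop x c :: K, σ, t⟩ =>
      PMF.pure ⟨if (σ x).toBool then c :: .loop x c :: K else K, σ, t + 1⟩

/-- The law of the configuration after `N` steps. -/
noncomputable def run {P : Type} (I : Interp P) : ℕ → Config P → PMF (Config P)
  | 0, s => PMF.pure s
  | N + 1, s => (step I s).bind (run I N)

/-- The initial configuration: the input is in variable `0`, all other variables are `nil`. -/
def init {P : Type} (c : Cmd P) (input : Val) : Config P :=
  ⟨[c], Function.update (fun _ => Val.nil) 0 input, 0⟩

end Config

/-- On the given input, every computation of the program `c` halts within time `T` (whatever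
the outcomes of the random choices), and `μ` is the law of the output, which is the final
content of variable `0`. -/
def Cmd.Computes {P : Type} (I : Interp P) (c : Cmd P) (input : Val) (T : ℝ) (μ : PMF Val) : Prop :=
  ∃ N : ℕ,
    (∀ s ∈ (Config.run I N (Config.init c input)).support, s.stack = [] ∧ (s.clock : ℝ) ≤ T) ∧
    (Config.run I N (Config.init c input)).map (fun s => s.store 0) = μ

/-- Deterministic programs have no primitives. -/
def detInterp : Interp Empty := fun q => q.elim

/-- Randomized programs have one primitive, the flip of a fair coin. -/
noncomputable def coinInterp : Interp Unit := fun _ _ =>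
  (PMF.uniformOfFintype Bool).map fun b => (Val.ofBool b, 0)

/-- There is a deterministic algorithm that decides the satisfiability of a CNF over `n` variables
in time `O*(2^(c n))`, i.e. `2^(c n)` times a polynomial in the size of the CNF. -/
def SATInTime (c : ℝ) : Prop :=
  ∃ (prog : Cmd Empty) (C e : ℕ), ∀ (n : ℕ) (F : CNF n), ∃ v : Val,
    prog.Computes detInterp (Val.ofCNF F)
      ((C : ℝ) * ((F.size : ℝ) + 1) ^ e * (2 : ℝ) ^ (c * (n : ℝ))) (PMF.pure v) ∧
    v.toBool = F.isSat

/-- The probability of an event. -/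
noncomputable def PMF.pr {α : Type} (μ : PMF α) (E : α → Prop) : ℝ :=
  (μ.toOuterMeasure {a | E a}).toReal

/-! ## The algorithms ACOUNT and ACOUNT-CONSTANT -/

/-- The law of a list of `l` independent samples from `μ`. -/
noncomputable def iid {α : Type} (μ : PMF α) : ℕ → PMF (List α)
  | 0 => PMF.pure []
  | l + 1 => μ.bind fun a => (iid μ l).map fun as => a :: as

/-- The distribution `μ_p` on the subsets of `{0, …, n-1}`: every element is chosen independently with
probability `p`. -/
noncomputable def bernoulliSubset (n : ℕ) (p : ℝ≥0) (hp : p ≤ 1) : PMF (Finset (Fin n)) :=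
  PMF.ofFintype (fun S => (p : ℝ≥0∞) ^ S.card * ((1 - p : ℝ≥0) : ℝ≥0∞) ^ (n - S.card)) (by
    have h := Fintype.sum_pow_mul_eq_add_pow (Fin n) (p : ℝ≥0∞) ((1 - p : ℝ≥0) : ℝ≥0∞)
    simp only [Fintype.card_fin] at h
    rw [h, ← ENNReal.coe_add, add_tsub_cancel_of_le hp]
    simp)

/-- The uniform distribution on the `k`-element subsets of `{0, …, n-1}`. -/
noncomputable def uniformSubset (n k : ℕ) (h : k ≤ n) : PMF (Finset (Fin n)) :=
  PMF.uniformOfFinset (Finset.powersetCard k Finset.univ)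
    (Finset.powersetCard_nonempty.2 (by simpa using h))

/-- One repetition of the inner loop, for the row distribution `D`: choose the sets `S_1, …, S_l`
independently from `D` and `b_1, …, b_l` uniformly. If some `|S_i| > k`, nothing is recorded.
Otherwise it is recorded whether `F ∧ G` is satisfiable, where `G` is the `k`-CNF encoding of
`h(x) = b`. The result is `true` iff unsatisfiability is recorded. -/
noncomputable def acountTrial {n : ℕ} (D : PMF (Finset (Fin n))) (k : ℕ) (F : CNF n) (l : ℕ) :
    PMF Bool :=
  (iid (D.bind fun S => (PMF.uniformOfFintype Bool).map fun b => (S, b)) l).map fun rows =>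
    if ∀ r ∈ rows, r.1.card ≤ k then !CNF.isSat (F ++ CNF.hashCNF rows) else false

/-- The outer loop, from `l` on, with at most `fuel` iterations left. In each of them,
`8 ⌈log₂ n⌉` repetitions of the inner loop are made; if unsatisfiability was recorded more than
`4 ⌈log₂ n⌉` times, the output is `2^(l-1)`. After the last iteration, the output is `0`. -/
noncomputable def acountLoop {n : ℕ} (D : PMF (Finset (Fin n))) (k : ℕ) (F : CNF n) :
    (fuel l : ℕ) → PMF ℕ
  | 0, _ => PMF.pure 0
  | fuel + 1, l => (iid (acountTrial D k F l) (8 * Nat.clog 2 n)).bind fun recorded =>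
      if 4 * Nat.clog 2 n < recorded.count true then PMF.pure (2 ^ (l - 1))
      else acountLoop D k F fuel (l + 1)

/-- A coin that shows `true` with probability `p`. -/
noncomputable def biasedCoin (p : ℝ≥0) (hp : p ≤ 1) : PMF Bool :=
  PMF.ofFintype (fun b => if b then (p : ℝ≥0∞) else ((1 - p : ℝ≥0) : ℝ≥0∞)) (by
    simp only [Fintype.sum_bool, if_true, Bool.false_eq_true, if_false]
    rw [← ENNReal.coe_add, add_tsub_cancel_of_le hp, ENNReal.coe_one])

/-- The bias `p = (k+1)/(2n)`. -/
noncomputable def acountBias (n k : ℕ) : ℝ≥0 := ((k : ℝ≥0) + 1) / (2 * (n : ℝ≥0))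

theorem acountBias_le_one {n k : ℕ} (h : k + 1 ≤ n) : acountBias n k ≤ 1 := by
  have h' : ((k : ℝ≥0) + 1) ≤ n := by exact_mod_cast h
  refine div_le_one_of_le₀ (h'.trans ?_) (by positivity)
  exact le_mul_of_one_le_left (by positivity) (by norm_num)

/-- The law of the output of ACOUNT on input `F` with parameter `k`. -/
noncomputable def acount {n : ℕ} (k : ℕ) (h : k + 1 ≤ n) (F : CNF n) : PMF ℕ :=
  acountLoop (bernoulliSubset n (acountBias n k) (acountBias_le_one h)) k F (n + 1) 1

/-- The law of the output of ACOUNT-CONSTANT on input `F` with parameter `k`. -/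
noncomputable def acountConstant {n : ℕ} (k : ℕ) (h : k ≤ n) (F : CNF n) : PMF ℕ :=
  acountLoop (uniformSubset n k h) k F (n + 1) 1

/-- The primitives of a program for ACOUNT: the flip of a fair coin, the flip of a coin with
bias `p`, and a query to the SAT-oracle. -/
inductive AcountPrim : Type
  | fair
  | biased
  | sat

/-- The answer of the SAT-oracle: is the value the encoding of a satisfiable CNF? -/
noncomputable def satOracle (v : Val) : Bool :=
  open scoped Classical in
  decide (∃ (n : ℕ) (F : CNF n), Val.ofCNF F = v ∧ F.isSat = true)

/-- The length of a query to the SAT-oracle. For the encoding of a CNF, this is its number of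
clauses plus its number of occurrences of literals. -/
def queryLength (v : Val) : ℕ :=
  v.tl.toList.length + (v.tl.toList.map fun C => C.toList.length).sum

/-- The primitives of a program for ACOUNT. Coins take one unit of time; a query to the
SAT-oracle takes its length in addition. -/
noncomputable def acountInterp (p : ℝ≥0) (hp : p ≤ 1) : Interp AcountPrim
  | .fair, _ => (PMF.uniformOfFintype Bool).map fun b => (Val.ofBool b, 0)
  | .biased, _ => (biasedCoin p hp).map fun b => (Val.ofBool b, 0)
  | .sat, v => PMF.pure (Val.ofBool (satOracle v), queryLength v)

/-! ## Termination of stacks of commands -/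

/-! All three guarantees rest on hashing with sparse random parities. A row is a random set `S`
together with an independent fair bit, so every assignment satisfies it with probability exactly
1/2, and two assignments `x`, `y` both satisfy it with probability `(1 + β) / 4`, where `β` is the
expected sign of the parity of `x ⊕ y` on `S`. If `β ≤ γ` for all but `B` differences, the number of
the `s` solutions that survive `l` rows has mean `s / 2 ^ l` and relative variance at most `(1 + γ)
^ l - 1 + 2 ^ l * B / s`. Chebyshev's inequality for this count is `pr_survivors_deviation_le`; the
algorithms differ in how `γ` and `B` are obtained.

ACOUNT: for Bernoulli sets the expected sign is `(1 - (k + 1) / n) ^ weight`, so the exceptional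
differences form a Hamming ball. ACOUNT-CONSTANT: the expected sign is a normalised elementary
symmetric function of signs, bounded through Newton's identities (`abs_symSum_le`), and the
exceptional differences are the unbalanced vectors, which are few by a Chernoff bound. In both cases
a repetition records unsatisfiability with probability at most 1/15 while `2 ^ l` is far below `s`,
and with probability at least 1/2 at the last level that the analysis needs; the majority votes turn
this into overall success probability 1/4 (`quarter_le_pr_acountLoop`). The delicate level is `l = n
+ 1`, where the first moment alone gives only 1/2 and oversized Bernoulli sets lose something; there
`pr_survivors_overdetermined` exploits that a singular system has no solution or at least two.

Approximate counting: the variables are cut into `w` blocks of length `2 ^ b`, and a row takes at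
most one random variable from each. Rows have width at most `w`, so their CNF encoding is only
exponential in `w`, while the expected sign is nonnegative and at most `exp (-weight / 2 ^ b)`
(`exists_bias`). Rows are added until at most `M = 2 ^ (w + m₀)` solutions are left, and these are
enumerated exactly by self-reduction with the SAT algorithm. Since `M` is exponentially large, the
count is concentrated up to an exponentially small relative error at every level where the program
can stop. With `2 ^ b` of order `1 / δ` the overhead is `2 ^ (δ n)` up to a constant, and the error
exponent is of order `1 / (2 ^ (2 b) * b)`, which is `δ ^ 2 / log (1 / δ)`.

Running times: programs are written as expressions of a small language and compiled. `Sem` bounds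
the time of the compiled code and describes the law of its value; there is one rule per construct,
so a concrete program is verified by chaining rules and adding up costs. -/

theorem PMF.bind_congr_support {α β : Type*} (p : PMF α) {f g : α → PMF β}
    (h : ∀ a ∈ p.support, f a = g a) : p.bind f = p.bind g := by
  ext b
  simp only [PMF.bind_apply]
  refine tsum_congr fun a => ?_
  by_cases ha : p a = 0
  · simp [ha]
  · rw [h a ((p.mem_support_iff a).2 ha)]

namespace Config

variable {P : Type} (I : Interp P)

theorem run_halted (N : ℕ) (σ : ℕ → Val) (t : ℕ) :
    run I N ⟨[], σ, t⟩ = PMF.pure ⟨[], σ, t⟩ := by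
  induction N with
  | zero => rfl
  | succ N ih => simp [run, step, ih]

theorem run_add (N M : ℕ) (s : Config P) : run I (N + M) s = (run I N s).bind (run I M) := by
  induction N generalizing s with
  | zero => simp [run]
  | succ N ih =>
    rw [Nat.succ_add]
    simp only [run, PMF.bind_bind]
    exact congrArg _ (funext ih)

/-- Halted configurations are fixed points of the step, so computations of different lengths can be
padded to a common number of steps. -/
theorem run_eq_of_halted {N M : ℕ} (h : N ≤ M) {s : Config P}
    (hs : ∀ s' ∈ (run I N s).support, s'.stack = []) : run I M s = run I N s := by
  obtain ⟨d, rfl⟩ := Nat.exists_eq_add_of_le h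
  rw [run_add]
  conv_rhs => rw [← PMF.bind_pure (run I N s)]
  refine PMF.bind_congr_support _ fun s' hs' => ?_
  obtain ⟨K, σ, t⟩ := s'
  obtain rfl : K = [] := hs _ hs'
  exact run_halted I d σ t

end Config

/-- Started with the commands `K` and the store `σ`, every computation halts after at most `B`
further units of time, and `μ` is the law of the final content of variable `0`. -/
def HaltsWith {P : Type} (I : Interp P) (K : List (Cmd P)) (σ : ℕ → Val) (B : ℕ) (μ : PMF Val) :
    Prop :=
  -- Quantifying over the initial clock turns `B` into a bound on elapsed time, so that the bounds
  -- of consecutive commands add up.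
  ∃ N, ∀ t, (∀ s ∈ (Config.run I N ⟨K, σ, t⟩).support, s.stack = [] ∧ s.clock ≤ t + B) ∧
    (Config.run I N ⟨K, σ, t⟩).map (fun s => s.store 0) = μ

namespace HaltsWith

variable {P : Type} {I : Interp P} {K : List (Cmd P)} {σ : ℕ → Val} {B : ℕ} {μ : PMF Val}

theorem empty (σ : ℕ → Val) : HaltsWith I [] σ 0 (PMF.pure (σ 0)) :=
  ⟨0, fun t => by simp [Config.run, PMF.pure_map]⟩

theorem mono {B' : ℕ} (h : HaltsWith I K σ B μ) (hB : B ≤ B') : HaltsWith I K σ B' μ := by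
  obtain ⟨N, hN⟩ := h
  exact ⟨N, fun t => ⟨fun s hs => ⟨((hN t).1 s hs).1, ((hN t).1 s hs).2.trans (by omega)⟩,
    (hN t).2⟩⟩

theorem of_step {c : Cmd P} {K' : List (Cmd P)} {σ' : ℕ → Val}
    (hstep : ∀ t, Config.step I ⟨c :: K, σ, t⟩ = PMF.pure ⟨K', σ', t + 1⟩)
    (h : HaltsWith I K' σ' B μ) : HaltsWith I (c :: K) σ (1 + B) μ := by
  obtain ⟨N, hN⟩ := h
  refine ⟨N + 1, fun t => ?_⟩
  have : Config.run I (N + 1) ⟨c :: K, σ, t⟩ = Config.run I N ⟨K', σ', t + 1⟩ := by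
    simp [Config.run, hstep]
  rw [this]
  refine ⟨fun s hs => ⟨((hN _).1 s hs).1, ?_⟩, (hN _).2⟩
  have := ((hN _).1 s hs).2
  omega

theorem nil {x : ℕ} (h : HaltsWith I K (Function.update σ x .nil) B μ) :
    HaltsWith I (.nil x :: K) σ (1 + B) μ := of_step (fun _ => rfl) h

theorem copy {x y : ℕ} (h : HaltsWith I K (Function.update σ x (σ y)) B μ) :
    HaltsWith I (.copy x y :: K) σ (1 + B) μ := of_step (fun _ => rfl) h

theorem cons {x y z : ℕ} (h : HaltsWith I K (Function.update σ x (.node (σ y) (σ z))) B μ) :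
    HaltsWith I (.cons x y z :: K) σ (1 + B) μ := of_step (fun _ => rfl) h

theorem hd {x y : ℕ} (h : HaltsWith I K (Function.update σ x (σ y).hd) B μ) :
    HaltsWith I (.hd x y :: K) σ (1 + B) μ := of_step (fun _ => rfl) h

theorem tl {x y : ℕ} (h : HaltsWith I K (Function.update σ x (σ y).tl) B μ) :
    HaltsWith I (.tl x y :: K) σ (1 + B) μ := of_step (fun _ => rfl) h

theorem seq {c d : Cmd P} (h : HaltsWith I (c :: d :: K) σ B μ) :
    HaltsWith I (.seq c d :: K) σ (1 + B) μ := of_step (fun _ => rfl) h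

theorem ite {x : ℕ} {c d : Cmd P} (h : HaltsWith I ((if (σ x).toBool then c else d) :: K) σ B μ) :
    HaltsWith I (.ite x c d :: K) σ (1 + B) μ := of_step (fun _ => rfl) h

theorem loop {x : ℕ} {c : Cmd P}
    (h : HaltsWith I (if (σ x).toBool then c :: .loop x c :: K else K) σ B μ) :
    HaltsWith I (.loop x c :: K) σ (1 + B) μ := of_step (fun _ => rfl) h

/-- The number of remaining steps may depend on the outcome. Finite support provides a common bound,
and the branches that halt sooner idle. -/
theorem prim {β : Type} {q : P} {x y : ℕ} {κ : ℕ} {m : PMF β} {f : β → Val × ℕ}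
    {μ : β → PMF Val} (hI : I q (σ y) = m.map f) (hfin : m.support.Finite)
    (hκ : ∀ r ∈ m.support, (f r).2 ≤ κ)
    (h : ∀ r ∈ m.support, HaltsWith I K (Function.update σ x (f r).1) B (μ r)) :
    HaltsWith I (.prim q x y :: K) σ (1 + κ + B) (m.bind μ) := by
  choose! N hN using h
  obtain ⟨M, hM⟩ : ∃ M, ∀ r ∈ m.support, N r ≤ M := by
    obtain ⟨M, hM⟩ := (hfin.image N).bddAbove
    exact ⟨M, fun r hr => hM ⟨r, hr, rfl⟩⟩
  refine ⟨M + 1, fun t => ?_⟩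
  have hrun : Config.run I (M + 1) ⟨.prim q x y :: K, σ, t⟩ = m.bind fun r =>
      Config.run I (N r) ⟨K, Function.update σ x (f r).1, t + 1 + (f r).2⟩ := by
    simp only [Config.run, Config.step, hI, PMF.map_comp, PMF.bind_map]
    refine PMF.bind_congr_support _ fun r hr => ?_
    exact Config.run_eq_of_halted I (hM r hr) fun s hs => ((hN r hr _).1 s hs).1
  rw [hrun]
  constructor
  · intro s hs
    obtain ⟨r, hr, hs⟩ := (PMF.mem_support_bind_iff _ _ _).1 hs
    have h1 := (hN r hr _).1 s hs
    have h2 := hκ r hr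
    exact ⟨h1.1, by omega⟩
  · rw [PMF.map_bind]
    exact PMF.bind_congr_support _ fun r hr => (hN r hr _).2

end HaltsWith

/-! ## Calling a deterministic program as a subroutine -/

namespace Cmd

variable {P : Type}

/-- All variables of the command are at most `m`. -/
def VarsLE (m : ℕ) : Cmd P → Prop
  | .nil x => x ≤ m
  | .copy x y => x ≤ m ∧ y ≤ m
  | .cons x y z => x ≤ m ∧ y ≤ m ∧ z ≤ m
  | .hd x y => x ≤ m ∧ y ≤ m
  | .tl x y => x ≤ m ∧ y ≤ m
  | .prim _ x y => x ≤ m ∧ y ≤ m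
  | .seq c d => c.VarsLE m ∧ d.VarsLE m
  | .ite x c d => x ≤ m ∧ c.VarsLE m ∧ d.VarsLE m
  | .loop x c => x ≤ m ∧ c.VarsLE m

/-- An upper bound for the variables of the command. -/
def maxVar : Cmd P → ℕ
  | .nil x => x
  | .copy x y => x + y
  | .cons x y z => x + y + z
  | .hd x y => x + y
  | .tl x y => x + y
  | .prim _ x y => x + y
  | .seq c d => c.maxVar + d.maxVar
  | .ite x c d => x + c.maxVar + d.maxVar
  | .loop x c => x + c.maxVar

theorem VarsLE.mono {m m' : ℕ} (h : m ≤ m') {c : Cmd P} (hc : c.VarsLE m) : c.VarsLE m' := by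
  induction c <;> simp only [VarsLE] at hc ⊢ <;> grind

theorem varsLE_maxVar (c : Cmd P) : c.VarsLE c.maxVar := by
  induction c with
  | seq c d hc hd =>
    exact ⟨hc.mono (by simp [maxVar]), hd.mono (by simp [maxVar])⟩
  | ite x c d hc hd =>
    exact ⟨by simp [maxVar]; omega, hc.mono (by simp [maxVar]; omega), hd.mono (by simp [maxVar])⟩
  | loop x c hc =>
    exact ⟨by simp [maxVar], hc.mono (by simp [maxVar])⟩
  | _ => simp only [VarsLE, maxVar]; omega

/-- The deterministic program `c` with its variables shifted by `t`. -/
def shift (P : Type) (t : ℕ) : Cmd Empty → Cmd P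
  | .nil x => .nil (t + x)
  | .copy x y => .copy (t + x) (t + y)
  | .cons x y z => .cons (t + x) (t + y) (t + z)
  | .hd x y => .hd (t + x) (t + y)
  | .tl x y => .tl (t + x) (t + y)
  | .prim q _ _ => q.elim
  | .seq c d => .seq (shift P t c) (shift P t d)
  | .ite x c d => .ite (t + x) (shift P t c) (shift P t d)
  | .loop x c => .loop (t + x) (shift P t c)

/-- Set the variables `t + 1, …, t + m` to `nil`. -/
def clear (P : Type) (t : ℕ) : ℕ → Cmd P
  -- There is no skip command; copying a variable to itself takes its place.
  | 0 => .copy t t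
  | m + 1 => .seq (.nil (t + m + 1)) (clear P t m)

end Cmd

theorem HaltsWith.clear {P : Type} {I : Interp P} {K : List (Cmd P)} {B : ℕ} {μ : PMF Val} {t : ℕ}
    (m : ℕ) {σ : ℕ → Val}
    (h : ∀ σ', (∀ x, x ≤ t ∨ t + m < x → σ' x = σ x) → (∀ x, t < x → x ≤ t + m → σ' x = .nil) →
      HaltsWith I K σ' B μ) :
    HaltsWith I (Cmd.clear P t m :: K) σ (2 * m + 1 + B) μ := by
  induction m generalizing σ with
  | zero =>
    refine (HaltsWith.copy (h _ (fun x hx => ?_) (fun x hx => ?_))).mono (by omega)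
    · by_cases hxt : x = t
      · subst hxt; simp
      · simp [hxt]
    · omega
  | succ m ih =>
    refine HaltsWith.mono (HaltsWith.seq (HaltsWith.nil (ih fun σ' h1 h2 => ?_)))
      (B := 1 + (1 + (2 * m + 1 + B))) (by omega)
    refine h σ' (fun x hx => ?_) (fun x hx hx' => ?_)
    · rw [h1 x (by omega), Function.update_of_ne (by omega)]
    · rcases Nat.lt_or_ge (t + m) x with hm | hm
      · obtain rfl : x = t + m + 1 := by omega
        rw [h1 _ (by omega), Function.update_self]
      · exact h2 x hx hm

/-- The embedded deterministic program behaves like the original one. -/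
theorem HaltsWith.shift {P : Type} {I : Interp P} {K : List (Cmd P)} {B : ℕ} {μ : PMF Val}
    {t m : ℕ} {w : Val} {T : ℕ} (N : ℕ) :
    ∀ (K₀ : List (Cmd Empty)) (σ₀ : ℕ → Val) (t₀ : ℕ),
    (∀ c ∈ K₀, c.VarsLE m) →
    (∀ s ∈ (Config.run detInterp N ⟨K₀, σ₀, t₀⟩).support, s.stack = [] ∧ s.clock ≤ t₀ + T) →
    (Config.run detInterp N ⟨K₀, σ₀, t₀⟩).map (fun s => s.store 0) = PMF.pure w →
    ∀ σ, (∀ x ≤ m, σ (t + x) = σ₀ x) →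
    (∀ σ', (∀ x < t, σ' x = σ x) → σ' t = w → HaltsWith I K σ' B μ) →
    HaltsWith I (K₀.map (Cmd.shift P t) ++ K) σ (T + B) μ := by
  induction N generalizing T with
  | zero =>
    intro K₀ σ₀ t₀ hm h1 h2 σ hσ hK
    have h1 := h1 ⟨K₀, σ₀, t₀⟩ (by simp [Config.run])
    obtain rfl : K₀ = [] := h1.1
    simp only [Config.run, PMF.pure_map] at h2
    have h2 : σ₀ 0 = w := by
      have : w ∈ (PMF.pure (σ₀ 0)).support := by rw [h2]; simp
      simp only [PMF.support_pure, Set.mem_singleton_iff] at this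
      exact this.symm
    exact (hK σ (fun _ _ => rfl) (by rw [← h2]; exact hσ 0 (by omega))).mono (by omega)
  | succ N ih =>
    intro K₀ σ₀ t₀ hm h1 h2 σ hσ hK
    match K₀ with
    | [] =>
      simp only [Config.run, Config.step, PMF.pure_bind] at h1 h2
      exact ih [] σ₀ t₀ hm h1 h2 σ hσ hK
    | c :: K₀ =>
      have hT : 1 ≤ T ∨ T = 0 := by omega
      -- One step of the original program, independent of the command: it uses up one of the `T`
      -- units, and the induction hypothesis covers what follows.
      have key : ∀ (K₁ : List (Cmd Empty)) (σ₁ : ℕ → Val),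
          Config.step detInterp ⟨c :: K₀, σ₀, t₀⟩ = PMF.pure ⟨K₁, σ₁, t₀ + 1⟩ →
          1 ≤ T ∧ ((∀ c ∈ K₁, c.VarsLE m) → ∀ σ', (∀ x ≤ m, σ' (t + x) = σ₁ x) →
            (∀ x < t, σ' x = σ x) →
            HaltsWith I (K₁.map (Cmd.shift P t) ++ K) σ' (T - 1 + B) μ) := by
        intro K₁ σ₁ hstep
        simp only [Config.run, hstep, PMF.pure_bind] at h1 h2
        -- The clock never decreases, so a run that still has to make a step cannot have time bound
        -- `0`. This justifies the subtraction in `T - 1`.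
        have hmono : ∀ (N : ℕ) (s : Config Empty), ∀ s' ∈ (Config.run detInterp N s).support,
            s.clock ≤ s'.clock := by
          intro N
          induction N with
          | zero => intro s s' hs'; simp [Config.run] at hs'; simp [hs']
          | succ N ihN =>
            intro s s' hs'
            simp only [Config.run, PMF.mem_support_bind_iff] at hs'
            obtain ⟨s'', hs'', hs'⟩ := hs'
            refine le_trans ?_ (ihN _ _ hs')
            obtain ⟨K, σ, t⟩ := s
            match K with
            | [] => simp [Config.step] at hs''; simp [hs'']
            | .prim q _ _ :: K => exact q.elim
            | .nil _ :: K | .copy _ _ :: K | .cons _ _ _ :: K | .hd _ _ :: K | .tl _ _ :: K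
            | .seq _ _ :: K | .ite _ _ _ :: K | .loop _ _ :: K =>
              simp [Config.step] at hs''; simp [hs'']
        have hT : 1 ≤ T := by
          obtain ⟨s, hs⟩ := (Config.run detInterp N ⟨K₁, σ₁, t₀ + 1⟩).support_nonempty
          have h3 := (h1 s hs).2
          have h4 := hmono _ _ _ hs
          simp only at h4
          omega
        refine ⟨hT, fun hm₁ σ' hσ' hx => ?_⟩
        refine ih K₁ σ₁ (t₀ + 1) hm₁ (fun s hs => ⟨(h1 s hs).1, ?_⟩) h2 σ' hσ' ?_
        · have := (h1 s hs).2; omega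
        · intro σ'' hσ'' hw
          exact hK σ'' (fun x hx' => (hσ'' x hx').trans (hx x hx')) hw
      have hm0 : ∀ c ∈ K₀, c.VarsLE m := fun d hd => hm d (List.mem_cons_of_mem _ hd)
      have hmc : c.VarsLE m := hm c List.mem_cons_self
      have hupd : ∀ (z : ℕ) (v : Val), ∀ x ≤ m,
          Function.update σ (t + z) v (t + x) = Function.update σ₀ z v x := by
        intro z v x hx
        by_cases h : x = z
        · subst h; simp
        · rw [Function.update_of_ne (by omega), Function.update_of_ne h, hσ x hx]
      have hlt : ∀ (z : ℕ) (v : Val), ∀ x < t, Function.update σ (t + z) v x = σ x := by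
        intro z v x hx
        rw [Function.update_of_ne (by omega)]
      cases c with
      | nil x =>
        obtain ⟨hT, h⟩ := key _ _ rfl
        exact (HaltsWith.nil (h hm0 _ (hupd _ _) (hlt _ _))).mono (by omega)
      | copy x y =>
        obtain ⟨hT, h⟩ := key _ _ rfl
        simp only [Cmd.VarsLE] at hmc
        rw [← hσ y hmc.2] at h
        exact (HaltsWith.copy (h hm0 _ (hupd _ _) (hlt _ _))).mono (by omega)
      | cons x y z =>
        obtain ⟨hT, h⟩ := key _ _ rfl
        simp only [Cmd.VarsLE] at hmc
        rw [← hσ y hmc.2.1, ← hσ z hmc.2.2] at h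
        exact (HaltsWith.cons (h hm0 _ (hupd _ _) (hlt _ _))).mono (by omega)
      | hd x y =>
        obtain ⟨hT, h⟩ := key _ _ rfl
        simp only [Cmd.VarsLE] at hmc
        rw [← hσ y hmc.2] at h
        exact (HaltsWith.hd (h hm0 _ (hupd _ _) (hlt _ _))).mono (by omega)
      | tl x y =>
        obtain ⟨hT, h⟩ := key _ _ rfl
        simp only [Cmd.VarsLE] at hmc
        rw [← hσ y hmc.2] at h
        exact (HaltsWith.tl (h hm0 _ (hupd _ _) (hlt _ _))).mono (by omega)
      | prim q _ _ => exact q.elim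
      | seq c d =>
        obtain ⟨hT, h⟩ := key _ _ rfl
        simp only [Cmd.VarsLE] at hmc
        refine (HaltsWith.seq (h ?_ _ hσ fun _ _ => rfl)).mono (by omega)
        simp only [List.mem_cons, forall_eq_or_imp]
        exact ⟨hmc.1, hmc.2, hm0⟩
      | ite x c d =>
        obtain ⟨hT, h⟩ := key _ _ rfl
        simp only [Cmd.VarsLE] at hmc
        rw [← hσ x hmc.1] at h
        refine (HaltsWith.ite ?_).mono (B := 1 + (T - 1 + B)) (by omega)
        have h := h (by
          simp only [List.mem_cons, forall_eq_or_imp]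
          refine ⟨?_, hm0⟩
          split_ifs
          exacts [hmc.2.1, hmc.2.2]) σ hσ fun _ _ => rfl
        split_ifs at h ⊢ <;> exact h
      | loop x c =>
        obtain ⟨hT, h⟩ := key _ _ rfl
        have hmc' := hmc
        simp only [Cmd.VarsLE] at hmc
        rw [← hσ x hmc.1] at h
        refine (HaltsWith.loop ?_).mono (B := 1 + (T - 1 + B)) (by omega)
        have h := h (by
          split_ifs
          · simp only [List.mem_cons, forall_eq_or_imp]
            exact ⟨hmc.2, hmc', hm0⟩
          · exact hm0) σ hσ fun _ _ => rfl
        split_ifs at h ⊢ <;> exact h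

/-! ## A small functional language -/

/-- Expressions. Variables refer to the positions of an environment, counted from its beginning;
`lett` and `fold` append to the environment. -/
inductive Expr (P : Type) : Type
  | var (i : ℕ) : Expr P
  | nil : Expr P
  | cons (a b : Expr P) : Expr P
  | hd (a : Expr P) : Expr P
  | tl (a : Expr P) : Expr P
  | prim (q : P) (a : Expr P) : Expr P
  | lett (a b : Expr P) : Expr P
  | ite (a b c : Expr P) : Expr P
  /-- fold over the list `l`; the body sees the accumulator and the current entry -/
  | fold (l init body : Expr P) : Expr P
  /-- evaluate `f` in the environment that consists of the listed variables -/
  | app (f : Expr P) (is : List ℕ) : Expr P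
  /-- call a deterministic program -/
  | call (c : Cmd Empty) (a : Expr P) : Expr P

namespace Expr

variable {P : Type}

/-- Code that evaluates the expression into the variable `t`, if the environment is held by the
variables `ρ`; the variables from `t` on are scratch space. -/
def compile : Expr P → List ℕ → ℕ → Cmd P
  | var i, ρ, t => .copy t (ρ.getD i 0)
  | nil, _, t => .nil t
  | cons a b, ρ, t => .seq (a.compile ρ t) (.seq (b.compile ρ (t + 1)) (.cons t t (t + 1)))
  | hd a, ρ, t => .seq (a.compile ρ t) (.hd t t)
  | tl a, ρ, t => .seq (a.compile ρ t) (.tl t t)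
  | prim q a, ρ, t => .seq (a.compile ρ t) (.prim q t t)
  | lett a b, ρ, t =>
      .seq (a.compile ρ t) (.seq (b.compile (ρ ++ [t]) (t + 1)) (.copy t (t + 1)))
  | ite a b c, ρ, t => .seq (a.compile ρ t) (.ite t (b.compile ρ t) (c.compile ρ t))
  | fold l i f, ρ, t =>
      .seq (l.compile ρ t) (.seq (i.compile ρ (t + 1)) (.seq
        (.loop t (.seq (.hd (t + 2) t) (.seq (.tl t t)
          (.seq (f.compile (ρ ++ [t + 1, t + 2]) (t + 3)) (.copy (t + 1) (t + 3))))))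
        (.copy t (t + 1))))
  | app f is, ρ, t => f.compile (is.map fun i => ρ.getD i 0) t
  | call c a, ρ, t => .seq (a.compile ρ t) (.seq (Cmd.clear P t c.maxVar) (c.shift P t))

end Expr

/-- In the environment `env`, the expression `e` takes time at most `τ`, and its value represents,
in the sense of the relation `R`, a random object with law `m`. -/
def Sem {P : Type} (I : Interp P) {β : Type} (e : Expr P) (env : List Val) (τ : ℕ) (m : PMF β)
    (R : β → Val → Prop) : Prop :=
  -- The specification is in continuation-passing form: whatever code `K` follows, it is enough that
  -- `K` behaves well from every store that is unchanged below `t` and holds a representative in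
  -- `t`. Costs then add and laws compose by `bind`, and nothing need be said about the scratch
  -- variables above `t`.
  ∀ (ρ : List ℕ) (t : ℕ), (∀ x ∈ ρ, x < t) → ∀ σ : ℕ → Val, ρ.map σ = env →
    ∀ (K : List (Cmd P)) (B : ℕ) (μ : β → PMF Val),
      (∀ b ∈ m.support, ∀ σ' : ℕ → Val, (∀ x < t, σ' x = σ x) → R b (σ' t) →
        HaltsWith I K σ' B (μ b)) →
      HaltsWith I (e.compile ρ t :: K) σ (τ + B) (m.bind μ)

/-- In the environment `env`, the expression `e` takes time at most `τ` and has value `v`. -/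
def Det {P : Type} (I : Interp P) (e : Expr P) (env : List Val) (τ : ℕ) (v : Val) : Prop :=
  Sem I e env τ (PMF.pure ()) fun _ w => w = v

/-- The law of a fold with random steps. -/
noncomputable def foldPMF {α β : Type} (f : β → α → PMF β) : List α → β → PMF β
  | [], acc => PMF.pure acc
  | a :: l, acc => (f acc a).bind (foldPMF f l)

theorem foldPMF_pure {α β : Type} (g : β → α → β) (l : List α) (acc : β) :
    foldPMF (fun x a => PMF.pure (g x a)) l acc = PMF.pure (l.foldl g acc) := by
  induction l generalizing acc with
  | nil => rfl
  | cons a l ih => rw [foldPMF, PMF.pure_bind, ih, List.foldl_cons]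

/-! ### Inference rules for time and law, one for each construct -/

section Rules

variable {P : Type} {I : Interp P} {env : List Val} {α β : Type}

theorem map_agree {ρ : List ℕ} {t : ℕ} (hρ : ∀ x ∈ ρ, x < t) {σ σ' : ℕ → Val}
    (h : ∀ x < t, σ' x = σ x) : ρ.map σ' = ρ.map σ :=
  List.map_congr_left fun x hx => h x (hρ x hx)

theorem Sem.mono {e : Expr P} {τ τ' : ℕ} {m : PMF β} {R : β → Val → Prop} (h : Sem I e env τ m R)
    (hτ : τ ≤ τ') : Sem I e env τ' m R :=
  fun ρ t hρ σ hσ K B μ hK => (h ρ t hρ σ hσ K B μ hK).mono (by omega)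

theorem Sem.map {e : Expr P} {τ : ℕ} {m : PMF α} {R : α → Val → Prop} (h : Sem I e env τ m R)
    (f : α → β) {R' : β → Val → Prop} (hR : ∀ a ∈ m.support, ∀ v, R a v → R' (f a) v) :
    Sem I e env τ (m.map f) R' := by
  intro ρ t hρ σ hσ K B μ hK
  rw [PMF.bind_map]
  exact h ρ t hρ σ hσ K B _ fun a ha σ' h' h't =>
    hK (f a) ((PMF.mem_support_map_iff _ _ _).2 ⟨a, ha, rfl⟩) σ' h' (hR a ha _ h't)

theorem Det.sem {e : Expr P} {τ : ℕ} {v : Val} (h : Det I e env τ v) (b : β) {R : β → Val → Prop}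
    (hR : R b v) : Sem I e env τ (PMF.pure b) R := by
  have := Sem.map h (fun _ => b) (R' := R) (fun _ _ w hw => hw ▸ hR)
  rwa [PMF.pure_map] at this

theorem Sem.det {e : Expr P} {τ : ℕ} {v : Val} {b : β} {R : β → Val → Prop}
    (h : Sem I e env τ (PMF.pure b) R) (hR : ∀ w, R b w → w = v) : Det I e env τ v := by
  have := Sem.map h (fun _ => ()) (R' := fun _ w => w = v) (fun a ha w hw => by
    obtain rfl : a = b := by simpa using ha
    exact hR w hw)
  rwa [PMF.pure_map] at this

theorem Det.mono {e : Expr P} {τ τ' : ℕ} {v : Val} (h : Det I e env τ v) (hτ : τ ≤ τ') :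
    Det I e env τ' v := Sem.mono h hτ

theorem Det.congr {e : Expr P} {τ : ℕ} {v v' : Val} (h : Det I e env τ v) (hv : v = v') :
    Det I e env τ v' := hv ▸ h

theorem Det.apply {e : Expr P} {τ : ℕ} {v : Val} (h : Det I e env τ v) {ρ : List ℕ} {t : ℕ}
    (hρ : ∀ x ∈ ρ, x < t) {σ : ℕ → Val} (hσ : ρ.map σ = env) {K : List (Cmd P)} {B : ℕ}
    {μ : PMF Val} (hK : ∀ σ' : ℕ → Val, (∀ x < t, σ' x = σ x) → σ' t = v → HaltsWith I K σ' B μ) :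
    HaltsWith I (e.compile ρ t :: K) σ (τ + B) μ := by
  have := h ρ t hρ σ hσ K B (fun _ => μ) fun _ _ => hK
  rwa [PMF.pure_bind] at this

theorem Det.of_apply {e : Expr P} {τ : ℕ} {v : Val}
    (h : ∀ (ρ : List ℕ) (t : ℕ), (∀ x ∈ ρ, x < t) → ∀ σ : ℕ → Val, ρ.map σ = env →
      ∀ (K : List (Cmd P)) (B : ℕ) (μ : PMF Val),
      (∀ σ' : ℕ → Val, (∀ x < t, σ' x = σ x) → σ' t = v → HaltsWith I K σ' B μ) →
      HaltsWith I (e.compile ρ t :: K) σ (τ + B) μ) : Det I e env τ v := by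
  intro ρ t hρ σ hσ K B μ hK
  rw [PMF.pure_bind]
  exact h ρ t hρ σ hσ K B _ fun σ' => hK () (by simp) σ'

theorem Det.var {i : ℕ} {v : Val} (h : env[i]? = some v) : Det I (.var i) env 1 v := by
  refine Det.of_apply fun ρ t hρ σ hσ K B μ hK => ?_
  refine HaltsWith.copy (hK _ (fun x hx => ?_) ?_)
  · rw [Function.update_of_ne (by omega)]
  · rw [Function.update_self]
    subst hσ
    rw [List.getElem?_map] at h
    obtain ⟨x, hx, rfl⟩ := Option.map_eq_some_iff.1 h
    rw [List.getD_eq_getElem?_getD, hx]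
    rfl

theorem Det.nil : Det I .nil env 1 .nil := by
  refine Det.of_apply fun ρ t hρ σ hσ K B μ hK => ?_
  refine HaltsWith.nil (hK _ (fun x hx => ?_) ?_)
  · rw [Function.update_of_ne (by omega)]
  · rw [Function.update_self]

theorem Det.cons {a b : Expr P} {τ₁ τ₂ : ℕ} {v w : Val}
    (ha : Det I a env τ₁ v) (hb : Det I b env τ₂ w) :
    Det I (.cons a b) env (τ₁ + τ₂ + 3) (.node v w) := by
  refine Det.of_apply fun ρ t hρ σ hσ K B μ hK => ?_
  refine (HaltsWith.seq (ha.apply hρ hσ fun σ₁ h1 h1t => HaltsWith.seq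
    (hb.apply (fun x hx => (hρ x hx).trans (by omega)) ((map_agree hρ h1).trans hσ)
    fun σ₂ h2 h2t => HaltsWith.cons (hK _ (fun x hx => ?_) ?_)))).mono
    (B := 1 + (τ₁ + (1 + (τ₂ + (1 + B))))) (by omega)
  · rw [Function.update_of_ne (by omega), h2 x (by omega), h1 x hx]
  · rw [Function.update_self, h2t, h2 t (by omega), h1t]

theorem Det.hd {a : Expr P} {τ : ℕ} {v : Val} (ha : Det I a env τ v) :
    Det I (.hd a) env (τ + 2) v.hd := by
  refine Det.of_apply fun ρ t hρ σ hσ K B μ hK => ?_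
  refine (HaltsWith.seq (ha.apply hρ hσ fun σ₁ h1 h1t => HaltsWith.hd
    (hK _ (fun x hx => ?_) ?_))).mono (B := 1 + (τ + (1 + B))) (by omega)
  · rw [Function.update_of_ne (by omega), h1 x hx]
  · rw [Function.update_self, h1t]

theorem Det.tl {a : Expr P} {τ : ℕ} {v : Val} (ha : Det I a env τ v) :
    Det I (.tl a) env (τ + 2) v.tl := by
  refine Det.of_apply fun ρ t hρ σ hσ K B μ hK => ?_
  refine (HaltsWith.seq (ha.apply hρ hσ fun σ₁ h1 h1t => HaltsWith.tl
    (hK _ (fun x hx => ?_) ?_))).mono (B := 1 + (τ + (1 + B))) (by omega)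
  · rw [Function.update_of_ne (by omega), h1 x hx]
  · rw [Function.update_self, h1t]

theorem Sem.prim {q : P} {a : Expr P} {τ κ : ℕ} {v : Val} {m : PMF β} {f : β → Val × ℕ}
    (ha : Det I a env τ v) (hI : I q v = m.map f) (hfin : m.support.Finite)
    (hκ : ∀ b ∈ m.support, (f b).2 ≤ κ) :
    Sem I (.prim q a) env (τ + κ + 2) m fun b w => w = (f b).1 := by
  intro ρ t hρ σ hσ K B μ hK
  refine (HaltsWith.seq (ha.apply hρ hσ fun σ₁ h1 h1t => ?_)).mono
    (B := 1 + (τ + (1 + κ + B))) (by omega)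
  subst h1t
  refine HaltsWith.prim hI hfin hκ fun b hb => hK b hb _ (fun x hx => ?_) ?_
  · rw [Function.update_of_ne (by omega), h1 x hx]
  · rw [Function.update_self]

theorem Sem.lett {a b : Expr P} {τ₁ τ₂ : ℕ} {m₁ : PMF α} {R₁ : α → Val → Prop}
    {m₂ : α → PMF β} {R₂ : β → Val → Prop} (ha : Sem I a env τ₁ m₁ R₁)
    (hb : ∀ x ∈ m₁.support, ∀ v, R₁ x v → Sem I b (env ++ [v]) τ₂ (m₂ x) R₂) :
    Sem I (.lett a b) env (τ₁ + τ₂ + 3) (m₁.bind m₂) R₂ := by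
  intro ρ t hρ σ hσ K B μ hK
  rw [PMF.bind_bind]
  refine (HaltsWith.seq (ha ρ t hρ σ hσ _ (1 + (τ₂ + (1 + B))) _ fun y hy σ₁ h1 h1t =>
    HaltsWith.seq ?_)).mono (by omega)
  refine hb y hy _ h1t (ρ ++ [t]) (t + 1) ?_ σ₁ ?_ _ _ _ fun z hz σ₂ h2 h2t => HaltsWith.copy ?_
  · intro x hx
    simp only [List.mem_append, List.mem_singleton] at hx
    rcases hx with hx | hx
    · exact (hρ x hx).trans (by omega)
    · omega
  · rw [List.map_append, map_agree hρ h1, hσ]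
    simp
  · refine hK z ((PMF.mem_support_bind_iff _ _ _).2 ⟨y, hy, hz⟩) _ (fun x hx => ?_) ?_
    · rw [Function.update_of_ne (by omega), h2 x (by omega), h1 x hx]
    · rwa [Function.update_self]

theorem Sem.lett_det {a b : Expr P} {τ₁ τ₂ : ℕ} {v : Val} {m : PMF β} {R : β → Val → Prop}
    (ha : Det I a env τ₁ v) (hb : Sem I b (env ++ [v]) τ₂ m R) :
    Sem I (.lett a b) env (τ₁ + τ₂ + 3) m R := by
  have := Sem.lett (m₂ := fun _ => m) ha (fun _ _ w hw => hw ▸ hb)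
  rwa [PMF.pure_bind] at this

theorem Det.lett {a b : Expr P} {τ₁ τ₂ : ℕ} {v w : Val}
    (ha : Det I a env τ₁ v) (hb : Det I b (env ++ [v]) τ₂ w) :
    Det I (.lett a b) env (τ₁ + τ₂ + 3) w := Sem.lett_det ha hb

theorem Sem.ite {a b c : Expr P} {τ₁ τ₂ : ℕ} {v : Val} {m : PMF β} {R : β → Val → Prop}
    (ha : Det I a env τ₁ v) (hb : v.toBool = true → Sem I b env τ₂ m R)
    (hc : v.toBool = false → Sem I c env τ₂ m R) :
    Sem I (.ite a b c) env (τ₁ + τ₂ + 2) m R := by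
  intro ρ t hρ σ hσ K B μ hK
  refine (HaltsWith.seq (ha.apply hρ hσ fun σ₁ h1 h1t => HaltsWith.ite ?_)).mono
    (B := 1 + (τ₁ + (1 + (τ₂ + B)))) (by omega)
  rw [h1t]
  have hK' : ∀ w ∈ m.support, ∀ σ' : ℕ → Val, (∀ x < t, σ' x = σ₁ x) → R w (σ' t) →
      HaltsWith I K σ' B (μ w) := fun w hw σ' h' h't =>
    hK w hw σ' (fun x hx => (h' x hx).trans (h1 x hx)) h't
  cases hvb : v.toBool with
  | true => exact hb hvb ρ t hρ σ₁ ((map_agree hρ h1).trans hσ) K B μ hK'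
  | false => exact hc hvb ρ t hρ σ₁ ((map_agree hρ h1).trans hσ) K B μ hK'

theorem Det.ite {a b c : Expr P} {τ₁ τ₂ : ℕ} {v w₁ w₂ : Val}
    (ha : Det I a env τ₁ v) (hb : Det I b env τ₂ w₁) (hc : Det I c env τ₂ w₂) :
    Det I (.ite a b c) env (τ₁ + τ₂ + 2) (if v.toBool then w₁ else w₂) :=
  Sem.ite ha (fun h => by rw [if_pos h]; exact hb) (fun h => by rw [if_neg (by simp [h])]; exact hc)

theorem Sem.app {f : Expr P} {is : List ℕ} {τ : ℕ} {m : PMF β} {R : β → Val → Prop}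
    {env' : List Val} (h : Sem I f env' τ m R)
    (his : is.map (env[·]?) = env'.map some) : Sem I (.app f is) env τ m R := by
  have his : (∀ i ∈ is, i < env.length) ∧ is.map (env.getD · .nil) = env' := by
    constructor
    · intro i hi
      have : env[i]? ∈ env'.map some := his ▸ List.mem_map_of_mem hi
      obtain ⟨v, -, hv⟩ := List.mem_map.1 this
      exact (List.getElem?_eq_some_iff.1 hv.symm).1
    · have := congrArg (List.map (Option.getD · Val.nil)) his
      simpa [Function.comp_def, List.getD_eq_getElem?_getD] using this
  intro ρ t hρ σ hσ K B μ hK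
  refine h _ t ?_ σ ?_ K B μ hK
  · intro x hx
    obtain ⟨i, hi, rfl⟩ := List.mem_map.1 hx
    have h1 : i < ρ.length := by have := his.1 i hi; rwa [← hσ, List.length_map] at this
    rw [List.getD_eq_getElem _ _ h1]
    exact hρ _ (List.getElem_mem h1)
  · rw [← his.2, List.map_map]
    refine List.map_congr_left fun i hi => ?_
    have h1 : i < env.length := his.1 i hi
    have h2 : i < ρ.length := by rwa [← hσ, List.length_map] at h1
    subst hσ
    rw [List.getD_eq_getElem _ _ h1, Function.comp_apply, List.getD_eq_getElem _ _ h2,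
      List.getElem_map]

theorem Det.app {f : Expr P} {is : List ℕ} {τ : ℕ} {v : Val} {env' : List Val}
    (h : Det I f env' τ v)
    (his : is.map (env[·]?) = env'.map some) :
    Det I (.app f is) env τ v := Sem.app h his

/-- `Inv` links the entries still to come with the accumulator; it allows a single bound `τ` for a
body whose cost depends on the accumulator. The constant 7 counts the loop test, three sequencings,
`hd`, `tl` and the final copy of each round. -/
theorem Sem.fold {l i f : Expr P} {τ₁ τ₂ τ : ℕ} {enc : α → Val} {R : β → Val → Prop}
    {L : List α} {b₀ : β} {iv : Val} {g : β → α → PMF β} (Inv : List α → β → Prop)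
    (hl : Det I l env τ₁ (Val.ofList (L.map enc))) (hi : Det I i env τ₂ iv) (hR : R b₀ iv)
    (h0 : Inv L b₀)
    (hf : ∀ a rest b v, Inv (a :: rest) b → R b v → Sem I f (env ++ [v, enc a]) τ (g b a) R)
    (hinv : ∀ a rest b, Inv (a :: rest) b → ∀ b' ∈ (g b a).support, Inv rest b') :
    Sem I (.fold l i f) env (τ₁ + τ₂ + L.length * (τ + 7) + 5) (foldPMF g L b₀) R := by
  intro ρ t hρ σ hσ K B μ hK
  -- Loop invariant: `t` holds the remaining list and `t + 1` represents the accumulator. An encoded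
  -- list is `nil` exactly when it is empty, so the list itself serves as the loop test.
  have main : ∀ (L : List α) (b : β) (σ₁ : ℕ → Val), Inv L b → (∀ x < t, σ₁ x = σ x) →
      σ₁ t = Val.ofList (L.map enc) → R b (σ₁ (t + 1)) →
      (∀ b' ∈ (foldPMF g L b).support, ∀ σ' : ℕ → Val,
        (∀ x < t, σ' x = σ x) → R b' (σ' t) → HaltsWith I K σ' B (μ b')) →
      HaltsWith I (.loop t (.seq (.hd (t + 2) t) (.seq (.tl t t)
          (.seq (f.compile (ρ ++ [t + 1, t + 2]) (t + 3)) (.copy (t + 1) (t + 3))))) ::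
        .copy t (t + 1) :: K) σ₁ (L.length * (τ + 7) + 2 + B) ((foldPMF g L b).bind μ) := by
    intro L
    induction L with
    | nil =>
      intro b σ₁ _ h1 h1t h1t' hK
      rw [foldPMF, PMF.pure_bind]
      refine (HaltsWith.loop ?_).mono (B := 1 + (1 + B)) (by simp; omega)
      rw [h1t]
      refine HaltsWith.copy (hK b (by simp [foldPMF]) _ (fun x hx => ?_) ?_)
      · rw [Function.update_of_ne (by omega), h1 x hx]
      · rwa [Function.update_self]
    | cons a rest ih =>
      intro b σ₁ hinv₁ h1 h1t h1t' hK
      have hsem := hf a rest b _ hinv₁ h1t'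
      rw [foldPMF, PMF.bind_bind]
      have hlen : 1 + (1 + (1 + (1 + (1 + (1 + (τ + (1 + (rest.length * (τ + 7) + 2 + B)))))))) =
          (a :: rest).length * (τ + 7) + 2 + B := by
        rw [List.length_cons]; ring
      rw [← hlen]
      refine HaltsWith.loop ?_
      rw [h1t]
      refine HaltsWith.seq (HaltsWith.hd (HaltsWith.seq (HaltsWith.tl (HaltsWith.seq ?_))))
      refine hsem (ρ ++ [t + 1, t + 2]) (t + 3) ?_ _ ?_ _ _ _ fun b' hb' σ₂ h2 h2t =>
        HaltsWith.copy ?_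
      · intro x hx
        simp only [List.mem_append, List.mem_cons, List.not_mem_nil, or_false] at hx
        rcases hx with hx | hx | hx
        · exact (hρ x hx).trans (by omega)
        · omega
        · omega
      · rw [List.map_append, map_agree hρ (σ := σ), hσ]
        · have e1 : t + 1 ≠ t + 2 := by omega
          have e2 : t ≠ t + 2 := by omega
          simp [Function.update, h1t, Val.hd, Val.ofList]
        · intro x hx
          rw [Function.update_of_ne (by omega), Function.update_of_ne (by omega), h1 x hx]
      · refine ih b' _ (hinv a rest b hinv₁ b' hb') (fun x hx => ?_) ?_ ?_ ?_
        · rw [Function.update_of_ne (by omega), h2 x (by omega), Function.update_of_ne (by omega),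
            Function.update_of_ne (by omega), h1 x hx]
        · rw [Function.update_of_ne (by omega), h2 t (by omega), Function.update_self,
            Function.update_of_ne (by omega), h1t]
          rfl
        · rwa [Function.update_self]
        · intro v hv
          refine hK v ?_
          rw [foldPMF, PMF.mem_support_bind_iff]
          exact ⟨b', hb', hv⟩
  refine (HaltsWith.seq (hl.apply hρ hσ fun σ₁ h1 h1t => HaltsWith.seq (hi.apply
    (fun x hx => (hρ x hx).trans (by omega)) ((map_agree hρ h1).trans hσ)
    fun σ₂ h2 h2t => HaltsWith.seq (main L b₀ σ₂ h0 (fun x hx => (h2 x (by omega)).trans (h1 x hx))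
    ((h2 t (by omega)).trans h1t) (h2t ▸ hR) hK)))).mono
    (B := 1 + (τ₁ + (1 + (τ₂ + (1 + (L.length * (τ + 7) + 2 + B)))))) (by omega)

theorem Det.fold {l i f : Expr P} {τ₁ τ₂ τ : ℕ} {enc : α → Val} {encB : β → Val}
    {L : List α} {b₀ : β} {g : β → α → β} (Inv : List α → β → Prop)
    (hl : Det I l env τ₁ (Val.ofList (L.map enc))) (hi : Det I i env τ₂ (encB b₀)) (h0 : Inv L b₀)
    (hf : ∀ a rest b, Inv (a :: rest) b → Det I f (env ++ [encB b, enc a]) τ (encB (g b a)))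
    (hinv : ∀ a rest b, Inv (a :: rest) b → Inv rest (g b a)) :
    Det I (.fold l i f) env (τ₁ + τ₂ + L.length * (τ + 7) + 5) (encB (L.foldl g b₀)) := by
  have := Sem.fold (R := fun b v => v = encB b) (g := fun b a => PMF.pure (g b a)) Inv hl hi rfl h0
    (fun a rest b v hb hv => by subst hv; exact (hf a rest b hb).sem _ rfl)
    (fun a rest b hb b' hb' => by
      obtain rfl : b' = g b a := by simpa using hb'
      exact hinv a rest b hb)
  rw [foldPMF_pure] at this
  exact this.det fun w hw => hw

/-- Folds without an invariant. -/
theorem Det.fold' {l i f : Expr P} {τ₁ τ₂ τ : ℕ} {enc : α → Val} {encB : β → Val}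
    {L : List α} {b₀ : β} {g : β → α → β}
    (hl : Det I l env τ₁ (Val.ofList (L.map enc))) (hi : Det I i env τ₂ (encB b₀))
    (hf : ∀ a b, Det I f (env ++ [encB b, enc a]) τ (encB (g b a))) :
    Det I (.fold l i f) env (τ₁ + τ₂ + L.length * (τ + 7) + 5) (encB (L.foldl g b₀)) :=
  Det.fold (fun _ _ => True) hl hi trivial (fun a _ b _ => hf a b) (fun _ _ _ _ => trivial)

/-- `Computes` starts from a store that is `nil` outside the input variable, so the variables of the
callee are cleared first. Clocks are natural numbers, which is why the real bound `T` may be rounded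
down. -/
theorem Det.call {c : Cmd Empty} {a : Expr P} {τ : ℕ} {v w : Val} {T : ℝ}
    (ha : Det I a env τ v) (hc : c.Computes detInterp v T (PMF.pure w)) :
    Det I (.call c a) env (τ + ⌊T⌋₊ + 2 * c.maxVar + 3) w := by
  refine Det.of_apply fun ρ t hρ σ hσ K B μ hK => ?_
  refine (HaltsWith.seq (ha.apply hρ hσ fun σ₁ h1 h1t => HaltsWith.seq
    (HaltsWith.clear _ fun σ₂ h2 h2' => ?_))).mono
    (B := 1 + (τ + (1 + (2 * c.maxVar + 1 + (⌊T⌋₊ + B))))) (by omega)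
  obtain ⟨N, hN, hN'⟩ := hc
  have := HaltsWith.shift (I := I) (K := K) (B := B) (μ := μ) (t := t) (m := c.maxVar) (w := w)
    (T := ⌊T⌋₊) N [c] (Function.update (fun _ => Val.nil) 0 v) 0
    (by simpa using c.varsLE_maxVar)
    (fun s hs => ⟨(hN s hs).1, by rw [zero_add]; exact Nat.le_floor (hN s hs).2⟩) hN' σ₂ ?_ ?_
  · simpa using this
  · intro x hx
    rcases Nat.eq_zero_or_pos x with rfl | hx0
    · rw [Function.update_self, add_zero, h2 t (by omega), h1t]
    · rw [Function.update_of_ne (by omega), h2' _ (by omega) (by omega)]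
  · intro σ' h' h't
    exact hK σ' (fun x hx => by rw [h' x hx, h2 x (by omega), h1 x hx]) h't

end Rules

/-- The program that evaluates an expression at its input. -/
def Expr.toCmd {P : Type} (e : Expr P) : Cmd P := .seq (e.compile [0] 1) (.copy 0 1)

theorem Sem.computes {P : Type} {I : Interp P} {β : Type} {e : Expr P} {v : Val} {τ : ℕ}
    {m : PMF β} {enc : β → Val} (h : Sem I e [v] τ m fun b w => w = enc b) {T : ℝ}
    (hT : (τ : ℝ) + 2 ≤ T) : e.toCmd.Computes I v T (m.map enc) := by
  have h := h [0] 1 (by simp) (Function.update (fun _ => Val.nil) 0 v) (by simp) [.copy 0 1]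
    (1 + 0) (fun b => PMF.pure (enc b)) (fun w hw σ' _ hσ' => by
      have := HaltsWith.copy (I := I) (x := 0) (y := 1) (HaltsWith.empty (I := I)
        (Function.update σ' 0 (σ' 1)))
      simpa [hσ'] using this)
  obtain ⟨N, hN⟩ := HaltsWith.seq h
  refine ⟨N, fun s hs => ⟨((hN 0).1 s hs).1, ?_⟩, ?_⟩
  · have := ((hN 0).1 s hs).2
    refine le_trans ?_ hT
    have : s.clock ≤ τ + 2 := by omega
    exact_mod_cast this
  · rw [Config.init, Expr.toCmd, (hN 0).2]
    rfl

/-! ## Encodings -/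

namespace Val

/-- A clause. -/
def ofClause {n : ℕ} (C : List (Fin n × Bool)) : Val := ofList (C.map ofLit)

/-- A list of clauses. -/
def ofClauses {n : ℕ} (F : CNF n) : Val := ofList (F.map ofClause)

theorem ofCNF_eq {n : ℕ} (F : CNF n) : ofCNF F = node (ofNat n) (ofClauses F) := rfl

@[simp] theorem toList_ofList (l : List Val) : (ofList l).toList = l := by
  induction l with
  | nil => rfl
  | cons a l ih => rw [ofList, toList, ih]

theorem ofList_injective : Function.Injective ofList :=
  fun a b h => by rw [← toList_ofList a, h, toList_ofList]

theorem ofNat_succ (m : ℕ) : ofNat (m + 1) = node nil (ofNat m) := by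
  rw [ofNat, List.replicate_succ]; rfl

theorem ofNat_eq (m : ℕ) : ofNat m = ofList ((List.replicate m ()).map fun _ => nil) := by
  rw [ofNat, List.map_replicate]

theorem ofNat_injective : Function.Injective ofNat := fun a b h => by
  have := congrArg List.length (ofList_injective h)
  simpa using this

theorem ofBool_injective : Function.Injective ofBool := by
  intro a b h
  cases a <;> cases b <;> simp_all [ofBool]

@[simp] theorem toBool_ofBool (b : Bool) : (ofBool b).toBool = b := by cases b <;> rfl

theorem ofLit_injective {n : ℕ} : Function.Injective (ofLit (n := n)) := by
  rintro ⟨i, a⟩ ⟨j, b⟩ h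
  simp only [ofLit, node.injEq] at h
  exact Prod.ext (Fin.ext (ofNat_injective h.2)) (ofBool_injective h.1)

theorem ofClause_injective {n : ℕ} : Function.Injective (ofClause (n := n)) :=
  ofList_injective.comp (List.map_injective_iff.2 ofLit_injective)

theorem ofClauses_injective {n : ℕ} : Function.Injective (ofClauses (n := n)) :=
  ofList_injective.comp (List.map_injective_iff.2 ofClause_injective)

theorem tl_ofNat (m : ℕ) : (ofNat m).tl = ofNat (m - 1) := by
  cases m with
  | zero => rfl
  | succ m => rw [ofNat_succ]; rfl

theorem toBool_ofNat (m : ℕ) : (ofNat m).toBool = decide (0 < m) := by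
  cases m with
  | zero => rfl
  | succ m => rw [ofNat_succ]; simp [toBool]

end Val

theorem List.foldl_replicate_unit {β : Type*} (f : β → β) (m : ℕ) (b : β) :
    (List.replicate m ()).foldl (fun b _ => f b) b = f^[m] b := by
  induction m generalizing b with
  | zero => rfl
  | succ m ih => rw [List.replicate_succ, List.foldl_cons, ih, Function.iterate_succ_apply]

/-! ## Unary arithmetic -/

namespace Expr

variable {P : Type}

/-- `[m]` ↦ the list of the unary numerals `m - 1, …, 0`. -/
def varList : Expr P :=
  .tl (.fold (.var 0) (.cons .nil .nil)
    (.cons (.cons .nil (.hd (.var 1))) (.cons (.hd (.var 1)) (.tl (.var 1)))))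

/-- `[m]` ↦ `⌈m / 2⌉`. -/
def halve : Expr P :=
  .tl (.fold (.var 0) (.cons .nil .nil)
    (.ite (.hd (.var 1)) (.cons .nil (.tl (.var 1)))
      (.cons (.cons .nil .nil) (.cons .nil (.tl (.var 1))))))

/-- `[x, l]` ↦ the list `l` without its first `x` entries. -/
def dropList : Expr P := .fold (.var 0) (.var 1) (.tl (.var 2))

/-- `[a, l, acc]` ↦ the list `acc`, extended by `a :: c` for the entries `c` of `l`. -/
def consEach : Expr P := .fold (.var 1) (.var 2) (.cons (.cons (.var 0) (.var 4)) (.var 3))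

/-- `[l, acc]` ↦ the list `acc`, extended by the entries of `l`. -/
def revAppend : Expr P := .fold (.var 0) (.var 1) (.cons (.var 3) (.var 2))

end Expr

section Unary

variable {P : Type} {I : Interp P}

/-- The encoding of the variables `n - 1, …, 0`. -/
def varVals (n : ℕ) : Val := Val.ofList ((List.finRange n).reverse.map fun j : Fin n => Val.ofNat j)

theorem varVals_eq (n : ℕ) : varVals n = Val.ofList ((List.range n).reverse.map Val.ofNat) := by
  rw [varVals, ← List.map_coe_finRange_eq_range, ← List.map_reverse, List.map_map]
  rfl

theorem Det.varList (n : ℕ) : Det I .varList [Val.ofNat n] (40 * n + 20) (varVals n) := by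
  have := Det.tl (Det.fold' (I := I) (env := [Val.ofNat n])
    (L := List.replicate n ()) (enc := fun _ => Val.nil) (b₀ := 0) (g := fun i _ => i + 1)
    (encB := fun i => .node (Val.ofNat i) (Val.ofList ((List.range i).reverse.map Val.ofNat)))
    (Det.var (i := 0) (by rw [← Val.ofNat_eq]; rfl)) (Det.cons .nil .nil)
    (f := .cons (.cons .nil (.hd (.var 1))) (.cons (.hd (.var 1)) (.tl (.var 1))))
    (fun _ i => ((Det.cons (.cons .nil (.hd (.var rfl)))
      (.cons (.hd (.var rfl)) (.tl (.var rfl)))).congr (by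
        rw [Val.ofNat_succ, List.range_succ, List.reverse_append]; rfl))))
  rw [List.foldl_replicate_unit (f := fun i => i + 1), Nat.succ_iterate] at this
  refine (this.congr ?_).mono ?_
  · rw [varVals_eq, zero_add]; rfl
  · rw [List.length_replicate]; omega

/-- The accumulator pairs the parity of the number `i` of rounds with `⌈i / 2⌉`; the second
component grows in every other round. -/
theorem Det.halve (n : ℕ) : Det I .halve [Val.ofNat n] (40 * n + 20) (Val.ofNat ((n + 1) / 2)) := by
  have := Det.tl (Det.fold' (I := I) (env := [Val.ofNat n])
    (L := List.replicate n ()) (enc := fun _ => Val.nil) (b₀ := 0) (g := fun i _ => i + 1)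
    (encB := fun i => .node (Val.ofBool (decide (i % 2 = 1))) (Val.ofNat ((i + 1) / 2)))
    (Det.var (i := 0) (by rw [← Val.ofNat_eq]; rfl)) (Det.cons .nil .nil)
    (f := .ite (.hd (.var 1)) (.cons .nil (.tl (.var 1)))
      (.cons (.cons .nil .nil) (.cons .nil (.tl (.var 1)))))
    (fun _ i => (((Det.ite (.hd (.var rfl)) ((Det.cons .nil (.tl (.var rfl))).mono (by omega))
      (.cons (.cons .nil .nil) (.cons .nil (.tl (.var rfl)))))).congr (by
        simp only [Val.hd, Val.tl, Val.toBool_ofBool, decide_eq_true_eq]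
        split_ifs with h
        · have h1 : (i + 1) % 2 = 0 := by omega
          have h2 : (i + 1 + 1) / 2 = (i + 1) / 2 := by omega
          simp [h1, h2, Val.ofBool]
        · have h1 : (i + 1) % 2 = 1 := by omega
          have h2 : (i + 1 + 1) / 2 = (i + 1) / 2 + 1 := by omega
          simp [h1, h2, Val.ofBool, Val.ofNat_succ]))))
  rw [List.foldl_replicate_unit (f := fun i => i + 1), Nat.succ_iterate] at this
  refine (this.congr ?_).mono ?_
  · rw [zero_add]; rfl
  · rw [List.length_replicate]; omega

/-- Besides splitting lists this serves as the comparison of numbers: a list is longer than `x` iff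
something is left after dropping `x` entries. -/
theorem Det.dropList (x : ℕ) (L : List Val) :
    Det I .dropList [Val.ofNat x, Val.ofList L] (40 * x + 20) (Val.ofList (L.drop x)) := by
  have := Det.fold' (I := I) (env := [Val.ofNat x, Val.ofList L])
    (L := List.replicate x ()) (enc := fun _ => Val.nil) (b₀ := L) (g := fun L _ => L.drop 1)
    (encB := Val.ofList) (Det.var (i := 0) (by rw [← Val.ofNat_eq]; rfl)) (Det.var (i := 1) rfl)
    (f := .tl (.var 2)) (fun _ L => (Det.tl (.var rfl)).congr (by cases L <;> rfl))
  rw [List.foldl_replicate_unit (f := fun L : List Val => L.drop 1)] at this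
  refine (this.congr ?_).mono ?_
  · congr 1
    clear this
    induction x generalizing L with
    | zero => rfl
    | succ x ih => rw [Function.iterate_succ_apply, ih, List.drop_drop, add_comm]
  · rw [List.length_replicate]; omega

theorem Val.toBool_ofList (L : List Val) : (Val.ofList L).toBool = decide (0 < L.length) := by
  cases L <;> simp [Val.ofList, Val.toBool]

/-- `acc`, extended by `a :: c` for the entries `c` of `l`. -/
def consEach {α : Type} (a : α) (l acc : List (List α)) : List (List α) :=
  l.foldl (fun acc c => (a :: c) :: acc) acc

theorem consEach_eq {α : Type} (a : α) (l acc : List (List α)) :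
    consEach a l acc = (l.map (a :: ·)).reverse ++ acc := by
  induction l generalizing acc with
  | nil => rfl
  | cons c l ih => rw [consEach, List.foldl_cons, ← consEach, ih]; simp

theorem Det.consEach {n : ℕ} (a : Fin n × Bool) (l acc : CNF n) :
    Det I .consEach [Val.ofLit a, Val.ofClauses l, Val.ofClauses acc] (40 * l.length + 20)
      (Val.ofClauses (consEach a l acc)) := by
  refine (Det.fold' (I := I) (env := [Val.ofLit a, Val.ofClauses l, Val.ofClauses acc])
    (L := l) (enc := Val.ofClause) (b₀ := acc) (g := fun acc c => (a :: c) :: acc)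
    (encB := Val.ofClauses) (Det.var (i := 1) rfl) (Det.var (i := 2) rfl)
    (f := .cons (.cons (.var 0) (.var 4)) (.var 3))
    (fun c b => (Det.cons (.cons (.var rfl) (.var rfl)) (.var rfl)))).mono ?_
  omega

theorem Det.revAppend_list (l acc : List Val) :
    Det I .revAppend [Val.ofList l, Val.ofList acc] (40 * l.length + 20)
      (Val.ofList (l.reverse ++ acc)) := by
  refine ((Det.fold' (I := I) (env := [Val.ofList l, Val.ofList acc])
    (L := l) (enc := id) (b₀ := acc) (g := fun acc c => c :: acc)
    (encB := Val.ofList) (Det.var (i := 0) (by simp)) (Det.var (i := 1) rfl)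
    (f := .cons (.var 3) (.var 2))
    (fun c b => (Det.cons (.var rfl) (.var rfl)))).mono ?_).congr ?_
  · omega
  · rw [List.foldl_flip_cons_eq_append']

theorem Det.revAppend {n : ℕ} (l acc : CNF n) :
    Det I .revAppend [Val.ofClauses l, Val.ofClauses acc] (40 * l.length + 20)
      (Val.ofClauses (l.reverse ++ acc)) := by
  refine ((Det.revAppend_list (l.map Val.ofClause) (acc.map Val.ofClause)).mono ?_).congr ?_
  · simp
  · rw [Val.ofClauses, List.map_append, List.map_reverse]

end Unary

/-! ## Parity constraints as lists of clauses -/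

/-- The parity of `x` on the entries of `js`. -/
def par {n : ℕ} (js : List (Fin n)) (x : Fin n → Bool) : Bool :=
  js.foldl (fun b j => xor b (x j)) false

namespace CNF

variable {n : ℕ}

/-- The number of occurrences of literals. -/
def occ (F : CNF n) : ℕ := (F.map List.length).sum

theorem size_eq (F : CNF n) : F.size = n + F.length + F.occ := rfl

@[simp] theorem eval_nil (x : Fin n → Bool) : eval ([] : CNF n) x = true := rfl

@[simp] theorem eval_cons (C : List (Fin n × Bool)) (F : CNF n) (x : Fin n → Bool) :
    eval (C :: F) x = ((C.any fun l => x l.1 == l.2) && eval F x) := rfl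

@[simp] theorem eval_append (F G : CNF n) (x : Fin n → Bool) :
    eval (F ++ G) x = (eval F x && eval G x) := List.all_append

theorem eval_reverse (F : CNF n) (x : Fin n → Bool) : eval F.reverse x = eval F x :=
  List.all_reverse

theorem eval_consEach (a : Fin n × Bool) (F G : CNF n) (x : Fin n → Bool) :
    eval (consEach a F G) x = (((x a.1 == a.2) || eval F x) && eval G x) := by
  rw [consEach_eq, eval_append, eval_reverse]
  congr 1
  induction F with
  | nil => simp
  | cons C F ih =>
    rw [List.map_cons, eval_cons, ih, eval_cons, List.any_cons]
    cases (x a.1 == a.2) <;> simp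

theorem length_consEach {α : Type} (a : α) (F G : List (List α)) :
    (consEach a F G).length = F.length + G.length := by
  rw [consEach_eq]; simp

/-- One step of the construction of `parityPair`. -/
def parityStep (p : CNF n × CNF n) (j : Fin n) : CNF n × CNF n :=
  (consEach (j, false) p.2 (consEach (j, true) p.1 []),
    consEach (j, false) p.1 (consEach (j, true) p.2 []))

/-- Two formulas that express that the parity on `js` is `1`, and that it is `0`. -/
def parityPair (js : List (Fin n)) : CNF n × CNF n := js.foldl parityStep ([[]], [])

/-- The empty parity is 0, so the formula for parity 1 starts as the empty clause and the one for
parity 0 as the empty conjunction. With a further variable `j`, the parity is 1 iff both `x_j ∨ (old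
parity 1)` and `¬x_j ∨ (old parity 0)` hold, and dually for 0. -/
theorem eval_parityPair (js : List (Fin n)) (x : Fin n → Bool) :
    eval (parityPair js).1 x = par js x ∧ eval (parityPair js).2 x = !par js x := by
  have : ∀ (js : List (Fin n)) (p : CNF n × CNF n) (b : Bool), eval p.1 x = b → eval p.2 x = !b →
      eval (js.foldl parityStep p).1 x = js.foldl (fun b j => xor b (x j)) b ∧
      eval (js.foldl parityStep p).2 x = !js.foldl (fun b j => xor b (x j)) b := by
    intro js
    induction js with
    | nil => exact fun p b h1 h2 => ⟨h1, h2⟩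
    | cons j js ih =>
      intro p b h1 h2
      refine ih _ _ ?_ ?_ <;> simp only [parityStep, eval_consEach, h1, h2, eval_nil] <;>
        cases x j <;> cases b <;> rfl
  exact this js _ _ (by simp) (by simp)

/-- Each step uses every clause of either formula twice, so the total number doubles while all
widths grow by one. -/
theorem card_parityPair (js : List (Fin n)) :
    (parityPair js).1.length + (parityPair js).2.length = 2 ^ js.length ∧
      (∀ C ∈ (parityPair js).1, C.length = js.length) ∧
      ∀ C ∈ (parityPair js).2, C.length = js.length := by
  induction js using List.reverseRecOn with
  | nil => simp [parityPair]
  | append_singleton js j ih =>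
    rw [parityPair, List.foldl_concat, ← parityPair, List.length_append, List.length_singleton]
    refine ⟨?_, ?_, ?_⟩
    · simp only [parityStep, length_consEach, List.length_nil]
      rw [pow_succ, ← ih.1]; ring
    all_goals
      intro C hC
      simp only [parityStep, consEach_eq, List.mem_append, List.mem_reverse, List.mem_map,
        List.not_mem_nil, or_false] at hC
      rcases hC with ⟨D, hD, rfl⟩ | ⟨D, hD, rfl⟩
      · rw [List.length_cons]; first | rw [ih.2.1 D hD] | rw [ih.2.2 D hD]
      · rw [List.length_cons]; first | rw [ih.2.1 D hD] | rw [ih.2.2 D hD]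

/-- The formula `F` together with the constraint that the parity on `js` is `b`. -/
def addRow (js : List (Fin n)) (b : Bool) (F : CNF n) : CNF n :=
  (if b then (parityPair js).1 else (parityPair js).2).reverse ++ F

theorem eval_addRow (js : List (Fin n)) (b : Bool) (F : CNF n) (x : Fin n → Bool) :
    eval (addRow js b F) x = ((par js x == b) && eval F x) := by
  rw [addRow, eval_append, eval_reverse]
  cases b
  · rw [if_neg (by simp), (eval_parityPair js x).2]; cases par js x <;> rfl
  · rw [if_pos rfl, (eval_parityPair js x).1]; cases par js x <;> rfl

theorem length_addRow_le (js : List (Fin n)) (b : Bool) (F : CNF n) :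
    (addRow js b F).length ≤ F.length + 2 ^ js.length := by
  have := (card_parityPair js).1
  rw [addRow, List.length_append, List.length_reverse]
  split_ifs <;> omega

theorem occ_eq_of_length {F : CNF n} {m : ℕ} (h : ∀ C ∈ F, C.length = m) :
    F.occ = F.length * m := by
  induction F with
  | nil => simp [occ]
  | cons C F ih =>
    have h1 := ih fun C hC => h C (List.mem_cons_of_mem _ hC)
    have h2 := h C List.mem_cons_self
    simp only [occ, List.map_cons, List.sum_cons, List.length_cons] at h1 ⊢
    rw [h1, h2]; ring

@[simp] theorem occ_append (F G : CNF n) : occ (F ++ G) = F.occ + G.occ := by simp [occ]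

theorem occ_addRow_le (js : List (Fin n)) (b : Bool) (F : CNF n) :
    (addRow js b F).occ ≤ F.occ + 2 ^ js.length * js.length := by
  have h := card_parityPair js
  have hrev : ∀ G : CNF n, occ G.reverse = G.occ := fun G => by
    simp [occ, List.map_reverse, List.sum_reverse]
  rw [addRow, occ_append, hrev, add_comm]
  gcongr
  split_ifs
  · rw [occ_eq_of_length h.2.1]
    gcongr
    omega
  · rw [occ_eq_of_length h.2.2]
    gcongr
    omega

end CNF

namespace Expr

variable {P : Type}

/-- `[js]` ↦ the encoding of `CNF.parityPair js`. -/
def parityPair : Expr P :=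
  .fold (.var 0) (.cons (.cons .nil .nil) .nil)
    (.lett (.cons (.cons .nil .nil) (.var 2)) <| .lett (.cons .nil (.var 2)) <|
      .lett (.hd (.var 1)) <| .lett (.tl (.var 1)) <| .lett .nil <|
      .lett (.app consEach [3, 5, 7]) <| .lett (.app consEach [4, 6, 8]) <|
      .lett (.app consEach [3, 6, 7]) <| .lett (.app consEach [4, 5, 10]) <|
      .cons (.var 9) (.var 11))

/-- `[js, b, F]` ↦ the encoding of `CNF.addRow js b F`. -/
def addRow : Expr P :=
  .lett (.app parityPair [0]) <| .lett (.ite (.var 1) (.hd (.var 3)) (.tl (.var 3))) <|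
    .app revAppend [4, 2]

end Expr

section Parity

variable {P : Type} {I : Interp P} {n : ℕ}

/-- The encoding of a list of variables. -/
def varsVal (js : List (Fin n)) : Val := Val.ofList (js.map fun j : Fin n => Val.ofNat j)

theorem Det.parityPair (js : List (Fin n)) :
    Det I .parityPair [varsVal js] (js.length * (200 * 2 ^ js.length + 300) + 20)
      (.node (Val.ofClauses (CNF.parityPair js).1) (Val.ofClauses (CNF.parityPair js).2)) := by
  refine (Det.fold (I := I) (env := [varsVal js]) (L := js)
    (enc := fun j : Fin n => Val.ofNat j) (τ := 200 * 2 ^ js.length + 180)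
    (b₀ := (([[]], []) : CNF n × CNF n)) (g := CNF.parityStep)
    (encB := fun p => .node (Val.ofClauses p.1) (Val.ofClauses p.2))
    (fun rest p => p.1.length ≤ 2 ^ (js.length - rest.length) ∧
      p.2.length ≤ 2 ^ (js.length - rest.length) ∧ rest.length ≤ js.length)
    (Det.var (i := 0) rfl) (Det.cons (.cons .nil .nil) .nil) (by simp)
    (fun j rest p hp => ?_) (fun j rest p hp => ?_)).mono ?_
  · obtain ⟨h1, h2, h3⟩ := hp
    have h4 : 2 ^ (js.length - (j :: rest).length) ≤ 2 ^ js.length :=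
      Nat.pow_le_pow_right (by norm_num) (by omega)
    refine Det.mono (Det.lett (v := Val.ofLit (j, true)) (.cons (.cons .nil .nil) (.var rfl)) <|
      Det.lett (v := Val.ofLit (j, false)) (.cons .nil (.var rfl)) <|
      Det.lett (.hd (.var rfl)) <| Det.lett (.tl (.var rfl)) <| Det.lett (v := Val.ofClauses (n := n) []) .nil <|
      Det.lett (.app (.consEach (j, true) p.1 []) rfl) <|
      Det.lett (.app (.consEach (j, false) p.2 _) rfl) <|
      Det.lett (.app (.consEach (j, true) p.2 []) rfl) <|
      Det.lett (.app (.consEach (j, false) p.1 _) rfl) <|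
      .cons (.var rfl) (.var rfl)) ?_
    generalize 2 ^ (js.length - (j :: rest).length) = z at *
    generalize 2 ^ js.length = w at *
    omega
  · obtain ⟨h1, h2, h3⟩ := hp
    rw [List.length_cons] at h1 h2 h3
    have h4 : 2 ^ (js.length - rest.length) = 2 * 2 ^ (js.length - (rest.length + 1)) := by
      rw [← pow_succ']; congr 1; omega
    simp only [CNF.parityStep, CNF.length_consEach, List.length_nil, h4]
    omega
  · have : js.length * (200 * 2 ^ js.length + 180 + 7) ≤ js.length * (200 * 2 ^ js.length + 300) := by
      exact Nat.mul_le_mul_left _ (by omega)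
    linarith

theorem Det.addRow (js : List (Fin n)) (b : Bool) (F : CNF n) :
    Det I .addRow [varsVal js, Val.ofBool b, Val.ofClauses F]
      (500 * (js.length + 1) * 2 ^ js.length) (Val.ofClauses (CNF.addRow js b F)) := by
  have h := (CNF.card_parityPair js).1
  have hlen : (if b then (CNF.parityPair js).1 else (CNF.parityPair js).2).length ≤ 2 ^ js.length := by
    split_ifs <;> omega
  refine (Det.lett (.app (.parityPair js) rfl) <|
    Det.lett (v := Val.ofClauses (if b then (CNF.parityPair js).1 else (CNF.parityPair js).2))
    ((Det.ite (.var rfl) (.hd (.var rfl)) (.tl (.var rfl))).congr ?_) <|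
    .app (.revAppend _ F) rfl).mono ?_
  · cases b <;> rfl
  · have : 1 ≤ 2 ^ js.length := Nat.one_le_two_pow
    nlinarith [Nat.zero_le js.length]

end Parity

/-! ## Laws of folds -/

section Laws

theorem foldPMF_iid {α : Type} (D : PMF α) (l : ℕ) (acc : List α) :
    foldPMF (fun acc (_ : Unit) => D.map (· :: acc)) (List.replicate l ()) acc =
      (iid D l).map fun rows => rows.reverse ++ acc := by
  induction l generalizing acc with
  | zero => simp [foldPMF, iid, PMF.pure_map]
  | succ l ih =>
    rw [List.replicate_succ, foldPMF, iid, PMF.map_bind, PMF.bind_map]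
    refine congrArg _ (funext fun a => ?_)
    rw [Function.comp_apply, ih, PMF.map_comp]
    simp [Function.comp_def]

/-- Independent samples, accumulated by a fold. -/
theorem foldPMF_iid_map {α β : Type} (D : PMF α) (f : β → α → β) (l : ℕ) (b : β) :
    foldPMF (fun b (_ : Unit) => D.map (f b)) (List.replicate l ()) b =
      (iid D l).map fun rows => rows.foldl f b := by
  induction l generalizing b with
  | zero => simp [foldPMF, iid, PMF.pure_map]
  | succ l ih =>
    rw [List.replicate_succ, foldPMF, iid, PMF.map_bind, PMF.bind_map]
    refine congrArg _ (funext fun a => ?_)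
    rw [Function.comp_apply, ih, PMF.map_comp]
    rfl

theorem length_of_mem_support_iid {α : Type} {D : PMF α} {l : ℕ} {rows : List α}
    (h : rows ∈ (iid D l).support) : rows.length = l := by
  induction l generalizing rows with
  | zero => simpa [iid] using h
  | succ l ih =>
    simp only [iid, PMF.mem_support_bind_iff, PMF.mem_support_map_iff] at h
    obtain ⟨a, -, as, has, rfl⟩ := h
    rw [List.length_cons, ih has]

variable {n : ℕ} (p : ℝ≥0) (hp : p ≤ 1)

/-- The start set is arbitrary for the sake of the induction. Since the list has no repetitions and
avoids the start set, only one outcome of the coin for its first entry can lead to a given `S`. -/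
theorem foldPMF_biasedCoin_apply (L : List (Fin n)) (hL : L.Nodup) (S₀ S : Finset (Fin n))
    (h : ∀ j ∈ L, j ∉ S₀) :
    foldPMF (fun (S : Finset (Fin n)) j => (biasedCoin p hp).map fun b =>
      if b then insert j S else S) L S₀ S =
    if S₀ ⊆ S ∧ S \ S₀ ⊆ L.toFinset then
      (p : ℝ≥0∞) ^ (S \ S₀).card * ((1 - p : ℝ≥0) : ℝ≥0∞) ^ (L.length - (S \ S₀).card) else 0 := by
  induction L generalizing S₀ with
  | nil =>
    simp only [foldPMF, PMF.pure_apply, List.toFinset_nil, Finset.subset_empty,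
      Finset.sdiff_eq_empty_iff_subset]
    by_cases hS : S = S₀
    · subst hS; simp
    · rw [if_neg hS, if_neg]
      rintro ⟨h1, h2⟩
      exact hS (h2.antisymm h1)
  | cons a L ih =>
    rw [List.nodup_cons] at hL
    have ha : a ∉ S₀ := h a List.mem_cons_self
    have hrest : ∀ j ∈ L, j ∉ S₀ := fun j hj => h j (List.mem_cons_of_mem _ hj)
    rw [foldPMF, PMF.bind_map, PMF.bind_apply, tsum_fintype, Fintype.sum_bool]
    have c1 : biasedCoin p hp true = p := by simp [biasedCoin]
    have c0 : biasedCoin p hp false = ((1 - p : ℝ≥0) : ℝ≥0∞) := by simp [biasedCoin]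
    simp only [Function.comp_apply, if_true, Bool.false_eq_true, if_false, c1, c0]
    rw [ih hL.2 S₀ hrest, ih hL.2 (insert a S₀) fun j hj => by
      rw [Finset.mem_insert, not_or]
      exact ⟨fun hja => hL.1 (hja ▸ hj), hrest j hj⟩]
    by_cases haS : a ∈ S
    · have e1 : ¬ (S₀ ⊆ S ∧ S \ S₀ ⊆ L.toFinset) := fun hh => by
        have := hh.2 (Finset.mem_sdiff.2 ⟨haS, ha⟩)
        exact hL.1 (List.mem_toFinset.1 this)
      have e2 : (insert a S₀ ⊆ S ∧ S \ insert a S₀ ⊆ L.toFinset) ↔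
          (S₀ ⊆ S ∧ S \ S₀ ⊆ (a :: L).toFinset) := by
        rw [Finset.insert_subset_iff, List.toFinset_cons, Finset.sdiff_insert,
          Finset.subset_insert_iff]
        tauto
      have e3 : (S \ S₀).card = (S \ insert a S₀).card + 1 := by
        rw [Finset.sdiff_insert, Finset.card_erase_add_one (Finset.mem_sdiff.2 ⟨haS, ha⟩)]
      rw [if_neg e1, mul_zero, add_zero, e3, List.length_cons]
      simp only [e2, mul_ite, mul_zero]
      refine if_congr Iff.rfl ?_ rfl
      rw [pow_succ', Nat.add_sub_add_right, mul_assoc]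
    · have e1 : ¬ (insert a S₀ ⊆ S ∧ S \ insert a S₀ ⊆ L.toFinset) := fun hh =>
        haS (hh.1 (Finset.mem_insert_self _ _))
      have e2 : (S₀ ⊆ S ∧ S \ S₀ ⊆ L.toFinset) ↔ (S₀ ⊆ S ∧ S \ S₀ ⊆ (a :: L).toFinset) := by
        rw [List.toFinset_cons, Finset.subset_insert_iff, Finset.erase_eq_of_notMem]
        simp [haS]
      rw [if_neg e1, mul_zero, zero_add]
      simp only [e2, mul_ite, mul_zero]
      split_ifs with hc
      · have hcard : (S \ S₀).card ≤ L.length := by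
          have := e2.2 hc
          exact (Finset.card_le_card this.2).trans (List.toFinset_card_le L)
        rw [List.length_cons, Nat.succ_sub hcard, pow_succ]
        ring
      · rfl

theorem foldPMF_biasedCoin :
    foldPMF (fun (S : Finset (Fin n)) j => (biasedCoin p hp).map fun b =>
      if b then insert j S else S) (List.finRange n).reverse ∅ = bernoulliSubset n p hp := by
  ext S
  rw [foldPMF_biasedCoin_apply p hp _ (List.nodup_reverse.2 (List.nodup_finRange n)) _ _ (by simp),
    bernoulliSubset, PMF.ofFintype_apply, if_pos]
  · simp
  · simp only [Finset.empty_subset, true_and]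
    intro j _
    simp
end Laws

/-! ## Parities on sets -/

theorem Finset.par_toList {n : ℕ} (S : Finset (Fin n)) (js : List (Fin n)) (h : js.Nodup)
    (hS : js.toFinset = S) (x : Fin n → Bool) :
    par js x = decide ((S.filter fun j => x j = true).card % 2 = 1) := by
  subst hS
  induction js using List.reverseRecOn with
  | nil => simp [par]
  | append_singleton js j ih =>
    rw [List.nodup_append] at h
    have hj : j ∉ js := fun hj => by simpa using h.2.2 j hj j (by simp)
    rw [par, List.foldl_concat, ← par, ih h.1, List.toFinset_append, Finset.filter_union,
      Finset.card_union_of_disjoint]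
    · cases hx : x j
      · simp [Finset.filter_singleton, hx]
      · simp only [List.toFinset_cons, List.toFinset_nil, insert_empty_eq,
          Finset.filter_singleton, hx, if_true, Finset.card_singleton, Bool.xor_true]
        rw [← decide_not]
        congr 1
        rw [eq_iff_iff]
        omega
    · refine Finset.disjoint_filter_filter ?_
      simpa using hj

/-- The parity of `x` on the set `S`. -/
def parF {n : ℕ} (S : Finset (Fin n)) (x : Fin n → Bool) : Bool :=
  decide ((S.filter fun j => x j = true).card % 2 = 1)

namespace CNF

variable {n : ℕ}

/-- The clause of `T` fails exactly where the assignment agrees with the indicator of `T` on `S`. An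
assignment of wrong parity therefore violates the clause of its own support in `S`, and one of right
parity differs on `S` from every `T` of wrong parity. -/
theorem eval_parity (S : Finset (Fin n)) (b : Bool) (x : Fin n → Bool) :
    eval (parity S b) x = (parF S x == b) := by
  rw [Bool.eq_iff_iff, beq_iff_eq]
  simp only [eval, parity, List.all_eq_true, List.mem_map, Finset.mem_toList, Finset.mem_filter,
    Finset.mem_powerset, List.any_eq_true, beq_iff_eq, forall_exists_index, and_imp]
  constructor
  · intro h
    by_contra hb
    obtain ⟨l, hl, hx⟩ := h _ (S.filter fun j => x j = true) (Finset.filter_subset _ _) hb rfl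
    obtain ⟨j, hj, rfl⟩ := List.mem_map.1 hl
    rw [Finset.mem_toList] at hj
    simp only [Finset.mem_filter, hj, true_and] at hx
    cases hxj : x j <;> simp [hxj] at hx
  · rintro h C T hT hTb rfl
    have : ∃ j ∈ S, x j ≠ decide (j ∈ T) := by
      by_contra hcon
      push Not at hcon
      refine hTb ?_
      rw [← h, parF]
      congr 4
      ext j
      rw [Finset.mem_filter]
      constructor
      · exact fun hj => ⟨hT hj, by rw [hcon j (hT hj)]; simpa using hj⟩
      · rintro ⟨hj, hxj⟩
        rw [hcon j hj] at hxj
        simpa using hxj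
    obtain ⟨j, hj, hxj⟩ := this
    refine ⟨(j, decide (j ∉ T)), List.mem_map.2 ⟨j, by simpa using hj, rfl⟩, ?_⟩
    by_cases hjT : j ∈ T <;> simp_all

theorem eval_hashCNF (rows : List (Finset (Fin n) × Bool)) (x : Fin n → Bool) :
    eval (hashCNF rows) x = rows.all fun r => parF r.1 x == r.2 := by
  induction rows with
  | nil => rfl
  | cons r rows ih =>
    rw [hashCNF, List.flatMap_cons, eval_append, ← hashCNF, ih, eval_parity, List.all_cons]

theorem isSat_congr {F G : CNF n} (h : ∀ x, eval F x = eval G x) : F.isSat = G.isSat := by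
  simp [isSat, h]

end CNF

theorem satOracle_ofCNF {n : ℕ} (F : CNF n) : satOracle (Val.ofCNF F) = F.isSat := by
  classical
  rw [Bool.eq_iff_iff, satOracle]
  simp only [decide_eq_true_eq]
  constructor
  · rintro ⟨m, G, hG, hs⟩
    rw [Val.ofCNF_eq, Val.ofCNF_eq, Val.node.injEq] at hG
    obtain rfl := Val.ofNat_injective hG.1
    rwa [← Val.ofClauses_injective hG.2]
  · exact fun h => ⟨n, F, rfl, h⟩

theorem queryLength_ofCNF {n : ℕ} (F : CNF n) :
    queryLength (Val.ofCNF F) = F.length + F.occ := by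
  simp [queryLength, Val.ofCNF, Val.tl, CNF.occ, Function.comp_def]

/-! ## The program for ACOUNT -/

namespace Expr

/-- `[vars]` ↦ a random subset of the variables. -/
def sampleSet : Expr AcountPrim :=
  .fold (.var 0) .nil
    (.lett (.prim .biased .nil) (.ite (.var 3) (.cons (.var 2) (.var 1)) (.var 1)))

/-- `[vars, k, n, F, l]` ↦ one repetition of the inner loop. -/
def trial : Expr AcountPrim :=
  .lett (.fold (.var 4) (.cons .nil (.var 3))
    (.lett (.app sampleSet [0]) <| .lett (.prim .fair .nil) <|
      .ite (.hd (.var 5)) (.var 5) <| .lett (.app dropList [1, 7]) <|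
      .ite (.var 9) (.cons (.cons .nil .nil) .nil) <| .lett (.tl (.var 5)) <|
      .cons .nil (.app addRow [7, 8, 10]))) <|
  .ite (.hd (.var 5)) .nil <|
  .lett (.prim .sat (.cons (.var 2) (.tl (.var 5)))) <|
  .ite (.var 6) .nil (.cons .nil .nil)

/-- `[vars, k, n, F, reps, l]` ↦ the number of repetitions in which unsatisfiability is recorded. -/
def trials : Expr AcountPrim :=
  .fold (.var 4) .nil
    (.lett (.app trial [0, 1, 2, 3, 5]) (.ite (.var 8) (.cons .nil (.var 6)) (.var 6)))

/-- `[vars, k, n, F, reps, threshold]` ↦ the output of the outer loop. -/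
def outerLoop : Expr AcountPrim :=
  .hd <| .fold (.cons .nil (.var 2))
    (.cons .nil (.cons (.cons (.cons .nil .nil) .nil) (.cons .nil .nil)))
    (.ite (.hd (.var 6)) (.var 6) <| .lett (.tl (.tl (.var 6))) <|
      .lett (.app trials [0, 1, 2, 3, 4, 8]) <| .lett (.app dropList [5, 9]) <|
      .ite (.var 10) (.cons (.hd (.tl (.var 6))) (.tl (.var 6)))
        (.cons .nil (.cons (.cons .nil (.hd (.tl (.var 6)))) (.cons .nil (.var 8)))))

/-- `[n]` ↦ the pair of `8 ⌈log₂ n⌉` and `4 ⌈log₂ n⌉`. -/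
def logs {P : Type} : Expr P :=
  .tl <| .fold (.var 0) (.cons (.var 0) (.cons .nil .nil))
    (.lett (.hd (.var 1)) <| .ite (.tl (.var 3))
      (.cons (.app halve [3]) (.cons
        (.cons .nil <| .cons .nil <| .cons .nil <| .cons .nil <| .cons .nil <| .cons .nil <|
          .cons .nil <| .cons .nil (.hd (.tl (.var 1))))
        (.cons .nil <| .cons .nil <| .cons .nil <| .cons .nil (.tl (.tl (.var 1))))))
      (.var 1))

/-- The program for ACOUNT. -/
def acountProgram : Expr AcountPrim :=
  .lett (.hd (.var 0)) <| .lett (.hd (.tl (.var 0))) <| .lett (.tl (.tl (.var 0))) <|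
  .lett (.app varList [2]) <| .lett (.app logs [2]) <|
  .lett (.hd (.var 5)) <| .lett (.tl (.var 5)) <| .app outerLoop [4, 1, 2, 3, 6, 7]

end Expr

section Acount

theorem Det.logs {P : Type} {I : Interp P} (n : ℕ) :
    Det I .logs [Val.ofNat n] (n * (40 * n + 200) + 20)
      (.node (Val.ofNat (8 * Nat.clog 2 n)) (Val.ofNat (4 * Nat.clog 2 n))) := by
  -- Every effective halving, rounding up, lowers `Nat.clog 2` by one and raises the counter by one.
  -- The second bound shows that `n` rounds bring the number down to at most 1.
  have hinv : ∀ i, (fun s : ℕ × ℕ => if 2 ≤ s.1 then ((s.1 + 1) / 2, s.2 + 1) else s)^[i] (n, 0) =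
      ((fun s : ℕ × ℕ => if 2 ≤ s.1 then ((s.1 + 1) / 2, s.2 + 1) else s)^[i] (n, 0)) ∧
      Nat.clog 2 ((fun s : ℕ × ℕ => if 2 ≤ s.1 then ((s.1 + 1) / 2, s.2 + 1) else s)^[i] (n, 0)).1 +
      ((fun s : ℕ × ℕ => if 2 ≤ s.1 then ((s.1 + 1) / 2, s.2 + 1) else s)^[i] (n, 0)).2 =
      Nat.clog 2 n ∧
      ((fun s : ℕ × ℕ => if 2 ≤ s.1 then ((s.1 + 1) / 2, s.2 + 1) else s)^[i] (n, 0)).1 ≤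
        max 1 (n - i) := by
    intro i
    refine ⟨rfl, ?_⟩
    induction i with
    | zero => simp
    | succ i ih =>
      rw [Function.iterate_succ_apply']
      generalize (fun s : ℕ × ℕ => if 2 ≤ s.1 then ((s.1 + 1) / 2, s.2 + 1) else s)^[i] (n, 0) = s at ih ⊢
      obtain ⟨h1, h2⟩ := ih
      split_ifs with h
      · refine ⟨?_, ?_⟩
        · rw [← h1, Nat.clog_of_two_le (by norm_num) h]
          have : s.1 + 2 - 1 = s.1 + 1 := by omega
          rw [this]; ring
        · simp only; omega
      · exact ⟨h1, by omega⟩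
  have := Det.tl (Det.fold (I := I) (env := [Val.ofNat n])
    (L := List.replicate n ()) (enc := fun _ => Val.nil) (b₀ := (n, 0))
    (g := fun s _ => if 2 ≤ s.1 then ((s.1 + 1) / 2, s.2 + 1) else s)
    (encB := fun s : ℕ × ℕ => .node (Val.ofNat s.1)
      (.node (Val.ofNat (8 * s.2)) (Val.ofNat (4 * s.2))))
    (fun _ s => s.1 ≤ n)
    (Det.var (i := 0) (by rw [← Val.ofNat_eq]; rfl))
    (Det.cons (Det.var (i := 0) (v := Val.ofNat n) rfl) (.cons .nil .nil)) le_rfl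
    (τ := 40 * n + 150)
    (f := .lett (.hd (.var 1)) <| .ite (.tl (.var 3))
      (.cons (.app .halve [3]) (.cons
        (.cons .nil <| .cons .nil <| .cons .nil <| .cons .nil <| .cons .nil <| .cons .nil <|
          .cons .nil <| .cons .nil (.hd (.tl (.var 1))))
        (.cons .nil <| .cons .nil <| .cons .nil <| .cons .nil (.tl (.tl (.var 1))))))
      (.var 1))
    (fun _ _ s hs => ((Det.lett (.hd (.var rfl)) (.ite (.tl (.var rfl))
      (.cons (.app (.halve s.1) rfl) (.cons
        (.cons .nil <| .cons .nil <| .cons .nil <| .cons .nil <| .cons .nil <| .cons .nil <|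
          .cons .nil <| .cons .nil (.hd (.tl (.var rfl))))
        (.cons .nil <| .cons .nil <| .cons .nil <| .cons .nil (.tl (.tl (.var rfl))))))
      ((Det.var rfl).mono (by omega)))).mono (by omega)).congr (by
        simp only [Val.hd, Val.tl_ofNat, Val.toBool_ofNat, decide_eq_true_eq]
        by_cases h : 2 ≤ s.1
        · rw [if_pos (by omega), if_pos h]
          simp only [Val.tl, mul_add, mul_one, Val.ofNat_succ]
        · rw [if_neg (by omega), if_neg h]))
    (fun _ _ s hs => by split_ifs <;> first | (show (s.1 + 1) / 2 ≤ n; omega) | exact hs))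
  rw [List.foldl_replicate_unit
    (f := fun s : ℕ × ℕ => if 2 ≤ s.1 then ((s.1 + 1) / 2, s.2 + 1) else s)] at this
  refine (this.congr ?_).mono ?_
  · obtain ⟨-, h1, h2⟩ := hinv n
    rw [Nat.sub_self] at h2
    rw [Nat.clog_of_right_le_one (by simpa using h2), zero_add] at h1
    simp only [Val.tl]
    rw [h1]
  · rw [List.length_replicate]
    have : n * (40 * n + 150 + 7) ≤ n * (40 * n + 200) := Nat.mul_le_mul_left _ (by omega)
    linarith

variable {n k : ℕ} (p : ℝ≥0) (hp : p ≤ 1)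

theorem Sem.fair (env : List Val) :
    Sem (acountInterp p hp) (.prim .fair .nil) env 3 (PMF.uniformOfFintype Bool)
      fun b w => w = Val.ofBool b :=
  (Sem.prim (κ := 0) (f := fun b => (Val.ofBool b, 0)) .nil rfl (Set.toFinite _) (by simp))

theorem Sem.biased (env : List Val) :
    Sem (acountInterp p hp) (.prim .biased .nil) env 3 (biasedCoin p hp)
      fun b w => w = Val.ofBool b :=
  (Sem.prim (κ := 0) (f := fun b => (Val.ofBool b, 0)) .nil rfl (Set.toFinite _) (by simp))

/-- A list of values encodes a set of variables. -/
def SetRep (S : Finset (Fin n)) (v : Val) : Prop :=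
  ∃ js : List (Fin n), js.Nodup ∧ js.toFinset = S ∧ v = varsVal js

theorem Sem.sampleSet :
    Sem (acountInterp p hp) .sampleSet [varVals n] (40 * n + 20) (bernoulliSubset n p hp)
      SetRep := by
  rw [← foldPMF_biasedCoin]
  refine (Sem.fold (env := [varVals n]) (τ₁ := 1) (τ₂ := 1) (τ := 20) (R := SetRep)
    (enc := fun j : Fin n => Val.ofNat j) (iv := .nil)
    (fun L S => L.Nodup ∧ ∀ j ∈ L, j ∉ S)
    (.var rfl) .nil ⟨[], by simp, by simp, rfl⟩ ?_ ?_ ?_).mono ?_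
  · exact ⟨List.nodup_reverse.2 (List.nodup_finRange n), by simp⟩
  · rintro j rest S v ⟨hnd, hS⟩ ⟨js, h1, h2, rfl⟩
    rw [← PMF.bind_pure_comp]
    refine (Sem.lett (Sem.biased p hp _) (τ₂ := 8) fun b _ w hw => ?_).mono (by omega)
    subst hw
    have hj : j ∉ js := fun hj => hS j List.mem_cons_self (h2 ▸ List.mem_toFinset.2 hj)
    cases b
    · exact (Sem.ite (τ₂ := 5) (.var rfl) (fun h => by simp at h) fun _ =>
        (Det.mono (Det.var rfl) (by omega)).sem _ ⟨js, h1, h2, rfl⟩)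
    · exact (Sem.ite (.var rfl) (fun _ => (Det.cons (.var rfl) (.var rfl)).sem _
        ⟨j :: js, List.nodup_cons.2 ⟨hj, h1⟩, by simp [h2], rfl⟩) fun h => by simp at h)
  · rintro j rest S ⟨hnd, hS⟩ S' hS'
    rw [List.nodup_cons] at hnd
    refine ⟨hnd.2, fun i hi => ?_⟩
    simp only [PMF.mem_support_map_iff] at hS'
    obtain ⟨b, -, rfl⟩ := hS'
    split_ifs
    · rw [Finset.mem_insert, not_or]
      exact ⟨fun hij => hnd.1 (hij ▸ hi), hS i (List.mem_cons_of_mem _ hi)⟩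
    · exact hS i (List.mem_cons_of_mem _ hi)
  · simp; omega

variable (k) in
/-- The state of the construction of the query after the rows `rows`. -/
def RowsRep (F : CNF n) (rows : List (Finset (Fin n) × Bool)) (v : Val) : Prop :=
  if ∀ r ∈ rows, r.1.card ≤ k then
    ∃ G : CNF n, v = .node .nil (Val.ofClauses G) ∧
      (∀ x, G.eval x = (F.eval x && rows.all fun r => parF r.1 x == r.2)) ∧
      G.length ≤ F.length + rows.length * 2 ^ k ∧ G.occ ≤ F.occ + rows.length * (2 ^ k * k)
  else v.hd.toBool = true

/-- The law of a row, with the set distributed according to `D`. -/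
noncomputable def rowLaw {α : Type} (D : PMF α) : PMF (α × Bool) :=
  D.bind fun S => (PMF.uniformOfFintype Bool).map fun b => (S, b)

/-- The size of the set is tested before its clauses are built, so the cost stays of order `(k + 1)
* 2 ^ k`. The set is sampled and the fair coin flipped even after an earlier set was too large, so
the rows keep the law of independent samples. -/
theorem Sem.trialRow (F : CNF n) (N lu : Val) (rows : List (Finset (Fin n) × Bool)) (v : Val)
    (hv : RowsRep k F rows v) :
    Sem (acountInterp p hp)
      (.lett (.app .sampleSet [0]) <| .lett (.prim .fair .nil) <|
      .ite (.hd (.var 5)) (.var 5) <| .lett (.app .dropList [1, 7]) <|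
      .ite (.var 9) (.cons (.cons .nil .nil) .nil) <| .lett (.tl (.var 5)) <|
      .cons .nil (.app .addRow [7, 8, 10]))
      [varVals n, Val.ofNat k, N, Val.ofClauses F, lu, v, .nil]
      (40 * n + 540 * (k + 1) * 2 ^ k + 100)
      ((rowLaw (bernoulliSubset n p hp)).map (· :: rows)) (RowsRep k F) := by
  have hlaw : (rowLaw (bernoulliSubset n p hp)).map (· :: rows) = (bernoulliSubset n p hp).bind
      fun S => (PMF.uniformOfFintype Bool).bind fun b => PMF.pure ((S, b) :: rows) := by
    simp only [rowLaw, PMF.map_bind, PMF.map_comp]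
    rfl
  rw [hlaw]
  have hk1 : 1 ≤ 2 ^ k := Nat.one_le_two_pow
  refine (Sem.lett (.app (.sampleSet p hp) rfl) (τ₂ := 540 * (k + 1) * 2 ^ k + 70)
    fun S _ w hw => ?_).mono (by omega)
  obtain ⟨js, h1, h2, rfl⟩ := hw
  refine (Sem.lett (.fair p hp _) (τ₂ := 540 * (k + 1) * 2 ^ k + 60) fun b _ w hw => ?_).mono (by omega)
  subst hw
  have hcard : S.card = js.length := by rw [← h2, List.toFinset_card_of_nodup h1]
  by_cases hall : ∀ r ∈ rows, r.1.card ≤ k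
  · rw [RowsRep, if_pos hall] at hv
    obtain ⟨G, rfl, hG, hlen, hocc⟩ := hv
    refine (Sem.ite (τ₂ := 540 * (k + 1) * 2 ^ k + 50) (.hd (.var rfl)) (fun h => by simp [Val.hd, Val.toBool] at h) fun _ => ?_).mono (by omega)
    refine (Sem.lett_det (.app (.dropList k _) rfl) (τ₂ := 500 * (k + 1) * 2 ^ k + 20) ?_).mono (by nlinarith [Nat.zero_le k])
    refine (Sem.ite (τ₂ := 500 * (k + 1) * 2 ^ k + 11) (.var rfl) (fun h => ?_) fun h => ?_).mono (by omega)
    · refine ((Det.cons (.cons .nil .nil) .nil).mono (by omega)).sem _ ?_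
      rw [Val.toBool_ofList] at h
      simp only [List.length_drop, List.length_map, decide_eq_true_eq] at h
      rw [RowsRep, if_neg]
      · rfl
      · intro h'
        have := h' (S, b) List.mem_cons_self
        simp only at this
        omega
    · rw [Val.toBool_ofList] at h
      simp only [List.length_drop, List.length_map, decide_eq_false_iff_not] at h
      have hjk : js.length ≤ k := by omega
      have hpow : 2 ^ js.length ≤ 2 ^ k := Nat.pow_le_pow_right (by norm_num) hjk
      refine ((Det.lett (.tl (.var rfl)) (.cons .nil (.app (.addRow js b G) rfl))).mono ?_).sem _ ?_
      · have : 500 * (js.length + 1) * 2 ^ js.length ≤ 500 * (k + 1) * 2 ^ k := by gcongr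
        omega
      · rw [RowsRep, if_pos]
        · refine ⟨_, rfl, fun x => ?_, ?_, ?_⟩
          · rw [CNF.eval_addRow, hG, List.all_cons, S.par_toList js h1 h2, ← parF]
            cases F.eval x <;> simp
          · refine (CNF.length_addRow_le js b G).trans ?_
            rw [List.length_cons, add_mul]
            omega
          · refine (CNF.occ_addRow_le js b G).trans ?_
            have : 2 ^ js.length * js.length ≤ 2 ^ k * k := by gcongr
            rw [List.length_cons, add_mul]
            omega
        · simpa [hcard, hjk] using hall
  · rw [RowsRep, if_neg hall] at hv
    refine (Sem.ite (τ₂ := 1) (.hd (.var rfl)) (fun h => ?_) fun h => ?_).mono (by omega)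
    · refine (Det.var rfl).sem _ ?_
      rw [RowsRep, if_neg]
      · exact hv
      · exact fun h' => hall fun r hr => h' r (List.mem_cons_of_mem _ hr)
    · rw [hv] at h; exact absurd h (by simp)

theorem Sem.trial (F : CNF n) (l : ℕ) :
    Sem (acountInterp p hp) .trial
      [varVals n, Val.ofNat k, Val.ofNat n, Val.ofClauses F, Val.ofNat l]
      (l * (40 * n + 542 * (k + 1) * 2 ^ k + 120) + F.size + 50)
      (acountTrial (bernoulliSubset n p hp) k F l) fun b w => w = Val.ofBool b := by
  -- The fold collects the rows in reverse order, which affects neither the size test nor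
  -- satisfiability.
  have hlaw : acountTrial (bernoulliSubset n p hp) k F l =
      (foldPMF (fun acc (_ : Unit) => (rowLaw (bernoulliSubset n p hp)).map (· :: acc))
        (List.replicate l ()) []).bind fun rows => PMF.pure
        (if ∀ r ∈ rows, r.1.card ≤ k then !CNF.isSat (F ++ CNF.hashCNF rows) else false) := by
    rw [foldPMF_iid, PMF.bind_map]
    refine congrArg₂ PMF.bind rfl (funext fun rows => ?_)
    simp only [Function.comp_apply, List.append_nil, List.mem_reverse]
    congr 1
    split_ifs
    · congr 1
      refine CNF.isSat_congr fun x => ?_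
      rw [CNF.eval_append, CNF.eval_append, CNF.eval_hashCNF, CNF.eval_hashCNF, List.all_reverse]
    · rfl
  rw [hlaw]
  have hfold := Sem.fold (R := RowsRep k F) (enc := fun _ : Unit => Val.nil)
    (env := [varVals n, Val.ofNat k, Val.ofNat n, Val.ofClauses F, Val.ofNat l])
    (L := List.replicate l ()) (b₀ := []) (iv := .node .nil (Val.ofClauses F))
    (l := .var 4) (i := .cons .nil (.var 3))
    (Inv := fun L rows => L.length + rows.length = l) (.var (by rw [← Val.ofNat_eq]; rfl))
    (.cons .nil (.var rfl))
    (by rw [RowsRep, if_pos (by simp)]; exact ⟨F, rfl, by simp, by simp, by simp⟩)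
    (by simp) (fun _ rest rows v _ hv => Sem.trialRow (p := p) (hp := hp) F _ _ rows v hv)
    (fun _ rest rows h rows' h' => by
      simp only [PMF.mem_support_map_iff] at h'
      obtain ⟨r, -, rfl⟩ := h'
      simp only [List.length_cons] at h ⊢
      omega)
  have hsupp : ∀ rows ∈ (foldPMF (fun acc (_ : Unit) =>
      (rowLaw (bernoulliSubset n p hp)).map (· :: acc)) (List.replicate l ()) []).support,
      rows.length = l := by
    intro rows h
    rw [foldPMF_iid, PMF.mem_support_map_iff] at h
    obtain ⟨rows', h', rfl⟩ := h
    simpa using length_of_mem_support_iid h'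
  refine (Sem.lett hfold (τ₂ := l * ((k + 1) * 2 ^ k) + F.size + 30)
    fun rows hrows v hv => ?_).mono ?_
  · have hl := hsupp rows hrows
    by_cases hall : ∀ r ∈ rows, r.1.card ≤ k
    · rw [RowsRep, if_pos hall] at hv
      obtain ⟨G, rfl, hG, hlen, hocc⟩ := hv
      rw [if_pos hall]
      -- The formula that is built differs from `F ++ hashCNF rows` in the order of clauses and
      -- literals, but has the same satisfying assignments; the answer of the oracle depends on
      -- nothing else.
      have hsat : CNF.isSat (F ++ CNF.hashCNF rows) = G.isSat := CNF.isSat_congr fun x => by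
        rw [CNF.eval_append, CNF.eval_hashCNF, hG]
      rw [hsat]
      refine (Sem.ite (τ₂ := l * ((k + 1) * 2 ^ k) + F.size + 22) (.hd (.var rfl)) (fun h => by simp [Val.hd, Val.toBool] at h) fun _ => ?_).mono (by omega)
      have hq : Sem (acountInterp p hp) (.prim .sat (.cons (.var 2) (.tl (.var 5))))
          ([varVals n, Val.ofNat k, Val.ofNat n, Val.ofClauses F, Val.ofNat l] ++
            [Val.node Val.nil (Val.ofClauses G)]) (7 + (G.length + G.occ) + 2)
          (PMF.pure ()) fun _ w => w = Val.ofBool G.isSat :=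
        (Sem.prim (v := Val.ofCNF G) (f := fun _ => (Val.ofBool G.isSat, G.length + G.occ))
          (Det.cons (Det.var (v := Val.ofNat n) rfl)
            (Det.tl (Det.var (v := .node .nil (Val.ofClauses G)) rfl)))
          (by simp only [acountInterp, satOracle_ofCNF, queryLength_ofCNF, PMF.pure_map])
          (Set.toFinite _) (by simp))
      have hsz : G.length + G.occ ≤ l * ((k + 1) * 2 ^ k) + F.size := by
        rw [CNF.size_eq, ← hl]
        have : rows.length * ((k + 1) * 2 ^ k) = rows.length * 2 ^ k + rows.length * (2 ^ k * k) := by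
          ring
        omega
      refine (Sem.lett_det (v := Val.ofBool G.isSat) hq (((Det.ite (τ₂ := 5) (Det.var (v := Val.ofBool G.isSat) rfl) (Det.nil.mono (by omega))
        (Det.cons .nil .nil)).sem _ ?_))).mono ?_
      · cases G.isSat <;> rfl
      · omega
    · rw [RowsRep, if_neg hall] at hv
      rw [if_neg hall]
      refine Sem.mono (Sem.ite (τ₁ := 3) (τ₂ := 1) (v := v.hd) (Det.hd (Det.var rfl)) (fun h => Det.nil.sem _ rfl)
        fun h => ?_) (by omega)
      rw [hv] at h; exact absurd h (by simp)
  · rw [List.length_replicate]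
    have : l * (40 * n + 542 * (k + 1) * 2 ^ k + 120) =
      l * (40 * n + 540 * (k + 1) * 2 ^ k + 100 + 7) + l * ((k + 1) * 2 ^ k) + l * ((k + 1) * 2 ^ k) + 13 * l := by ring
    omega

theorem Sem.trials (F : CNF n) (l m : ℕ) :
    Sem (acountInterp p hp) .trials
      [varVals n, Val.ofNat k, Val.ofNat n, Val.ofClauses F, Val.ofNat m, Val.ofNat l]
      (m * (l * (40 * n + 542 * (k + 1) * 2 ^ k + 120) + F.size + 70) + 10)
      ((iid (acountTrial (bernoulliSubset n p hp) k F l) m).map fun rec => rec.count true)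
      fun c w => w = Val.ofNat c := by
  have hlaw : (iid (acountTrial (bernoulliSubset n p hp) k F l) m).map (fun rec => rec.count true) =
      foldPMF (fun c (_ : Unit) => (acountTrial (bernoulliSubset n p hp) k F l).map
        fun b : Bool => if b then c + 1 else c) (List.replicate m ()) 0 := by
    rw [foldPMF_iid_map (f := fun c (b : Bool) => if b then c + 1 else c)]
    congr 1
    funext rec
    have : ∀ (rec : List Bool) (c : ℕ),
        rec.foldl (fun c (b : Bool) => if b then c + 1 else c) c = c + rec.count true := by
      intro rec
      induction rec with
      | nil => simp
      | cons b rec ih =>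
        intro c
        rw [List.foldl_cons, ih, List.count_cons]
        cases b <;> simp; omega
    rw [this, zero_add]
  rw [hlaw]
  refine (Sem.fold (R := fun c w => w = Val.ofNat c) (enc := fun _ : Unit => Val.nil)
    (env := [varVals n, Val.ofNat k, Val.ofNat n, Val.ofClauses F, Val.ofNat m, Val.ofNat l])
    (τ := l * (40 * n + 542 * (k + 1) * 2 ^ k + 120) + F.size + 63)
    (L := List.replicate m ()) (b₀ := 0) (iv := .nil) (l := .var 4) (i := .nil)
    (Inv := fun _ _ => True) (.var (by rw [← Val.ofNat_eq]; rfl)) .nil rfl trivial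
    (fun _ rest c v _ hv => ?_) (fun _ _ _ _ _ _ => trivial)).mono ?_
  · subst hv
    rw [← PMF.bind_pure_comp]
    refine (Sem.lett (τ₂ := 8)
      (.app (.trial p hp F l) rfl) fun b _ w hw => ?_).mono (by omega)
    subst hw
    cases b
    · exact Sem.ite (τ₂ := 5) (.var rfl) (fun h => by simp at h) fun _ =>
        (Det.mono (Det.var rfl) (by omega)).sem _ rfl
    · exact Sem.ite (τ₂ := 5) (.var rfl) (fun _ => (Det.cons .nil (.var rfl)).sem _
        (Val.ofNat_succ c).symm) fun h => by simp at h
  · rw [List.length_replicate]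
    generalize l * (40 * n + 542 * (k + 1) * 2 ^ k + 120) + F.size = z
    have : m * (z + 63 + 7) = m * (z + 70) := rfl
    omega

/-- The number `2 ^ m` in binary. -/
def twoPowVal : ℕ → Val
  | 0 => .node (.node .nil .nil) .nil
  | m + 1 => .node .nil (twoPowVal m)

theorem binToNat_twoPowVal (m : ℕ) : (twoPowVal m).binToNat = 2 ^ m := by
  induction m with
  | zero => simp [twoPowVal, Val.binToNat, Val.toBool]
  | succ m ih => rw [twoPowVal, Val.binToNat, ih, pow_succ']; simp [Val.toBool]

theorem toBool_twoPowVal (m : ℕ) : (twoPowVal m).toBool = true := by cases m <;> rfl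

/-- The state of the outer loop: the exponent of the output, if it has been determined, and the current `l`. -/
def LoopRep (s : Option ℕ × ℕ) (v : Val) : Prop :=
  match s.1 with
  | none => v = .node .nil (.node (twoPowVal (s.2 - 1)) (Val.ofNat s.2)) ∧ 1 ≤ s.2
  | some e => v.hd = twoPowVal e

/-- The law of a step of the outer loop. -/
noncomputable def loopStep (D : PMF (Finset (Fin n))) (k : ℕ) (F : CNF n) (s : Option ℕ × ℕ) :
    PMF (Option ℕ × ℕ) :=
  match s.1 with
  | none => (iid (acountTrial D k F s.2) (8 * Nat.clog 2 n)).map fun recorded =>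
      if 4 * Nat.clog 2 n < recorded.count true then (some (s.2 - 1), s.2)
      else (none, s.2 + 1)
  | some _ => PMF.pure s

/-- Once the output is determined the remaining rounds change nothing, so a fold of fixed length has
the law of the recursion that stops early. -/
theorem foldPMF_loopStep (D : PMF (Finset (Fin n))) (k : ℕ) (F : CNF n) (fuel l : ℕ) :
    (foldPMF (fun s (_ : Unit) => loopStep D k F s) (List.replicate fuel ()) (none, l)).map
      (fun s => s.1.elim 0 (2 ^ ·)) = acountLoop D k F fuel l := by
  have hsome : ∀ (fuel a l : ℕ), foldPMF (fun s (_ : Unit) => loopStep D k F s)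
      (List.replicate fuel ()) (some a, l) = PMF.pure (some a, l) := by
    intro fuel a l
    induction fuel with
    | zero => rfl
    | succ fuel ih => rw [List.replicate_succ, foldPMF, loopStep, PMF.pure_bind, ih]
  induction fuel generalizing l with
  | zero => simp [foldPMF, acountLoop, PMF.pure_map]
  | succ fuel ih =>
    rw [List.replicate_succ, foldPMF, loopStep, acountLoop, PMF.map_bind, PMF.bind_map]
    refine congrArg _ (funext fun rec => ?_)
    rw [Function.comp_apply]
    split_ifs
    · rw [hsome, PMF.pure_map]; rfl
    · exact ih (l + 1)

/-- The law of the exponent of the output. -/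
noncomputable def exponentLaw (D : PMF (Finset (Fin n))) (k : ℕ) (F : CNF n) : PMF (Option ℕ) :=
  (foldPMF (fun s (_ : Unit) => loopStep D k F s) (List.replicate (n + 1) ()) (none, 1)).map
    Prod.fst

/-- The encoding of the output. -/
def outputVal (o : Option ℕ) : Val := o.elim .nil twoPowVal

theorem Sem.outerLoop (F : CNF n) :
    Sem (acountInterp p hp) .outerLoop
      [varVals n, Val.ofNat k, Val.ofNat n, Val.ofClauses F, Val.ofNat (8 * Nat.clog 2 n),
        Val.ofNat (4 * Nat.clog 2 n)]
      ((n + 1) * (8 * Nat.clog 2 n *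
        ((n + 1) * (40 * n + 542 * (k + 1) * 2 ^ k + 120) + F.size + 100) + 100) + 50)
      (exponentLaw (bernoulliSubset n p hp) k F) fun o w => w = outputVal o := by
  set Z := (n + 1) * (40 * n + 542 * (k + 1) * 2 ^ k + 120) + F.size with hZ
  have hfold := Sem.fold (R := LoopRep) (enc := fun _ : Unit => Val.nil) (I := acountInterp p hp)
    (env := [varVals n, Val.ofNat k, Val.ofNat n, Val.ofClauses F, Val.ofNat (8 * Nat.clog 2 n),
        Val.ofNat (4 * Nat.clog 2 n)])
    (τ := 8 * Nat.clog 2 n * (Z + 100) + 90)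
    (L := List.replicate (n + 1) ()) (b₀ := (none, 1))
    (g := fun s _ => loopStep (bernoulliSubset n p hp) k F s)
    (iv := .node .nil (.node (twoPowVal 0) (Val.ofNat 1)))
    (l := .cons .nil (.var 2))
    (i := (.cons .nil (.cons (.cons (.cons .nil .nil) .nil) (.cons .nil .nil))))
    (f := .ite (.hd (.var 6)) (.var 6) <| .lett (.tl (.tl (.var 6))) <|
      .lett (.app .trials [0, 1, 2, 3, 4, 8]) <| .lett (.app .dropList [5, 9]) <|
      .ite (.var 10) (.cons (.hd (.tl (.var 6))) (.tl (.var 6)))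
        (.cons .nil (.cons (.cons .nil (.hd (.tl (.var 6)))) (.cons .nil (.var 8)))))
    -- As long as nothing has been decided, `l` is determined by the number of rounds left; in
    -- particular `l ≤ n + 1`, which bounds the cost of each round.
    (Inv := fun L s => s.1 = none → s.2 + L.length = n + 2)
    ((Det.cons .nil (.var rfl)).congr (by rw [← Val.ofNat_succ, Val.ofNat_eq]))
    (.cons .nil (.cons (.cons (.cons .nil .nil) .nil) (.cons .nil .nil))) ⟨rfl, le_rfl⟩
    (by simp; omega) ?_ ?_
  · refine fun ρ t hρ σ hσ K B μ hK => ?_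
    have hmain := (hfold.mono (τ' := (n + 1) * (8 * Nat.clog 2 n * (Z + 100) + 100) + 47)
      (by rw [List.length_replicate]
          have : (n + 1) * (8 * Nat.clog 2 n * (Z + 100) + 100) =
            (n + 1) * (8 * Nat.clog 2 n * (Z + 100) + 90 + 7) + 3 * (n + 1) := by ring
          omega)) ρ t hρ σ hσ (.hd t t :: K) (1 + B) (fun s => μ s.1) ?_
    · rw [exponentLaw, PMF.bind_map]
      exact (HaltsWith.seq hmain).mono (by omega)
    · intro s hs σ' h' hR
      refine HaltsWith.hd (hK _ ((PMF.mem_support_map_iff _ _ _).2 ⟨s, hs, rfl⟩) _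
        (fun x hx => ?_) ?_)
      · rw [Function.update_of_ne (by omega), h' x hx]
      · rw [Function.update_self]
        obtain ⟨o, l⟩ := s
        cases o with
        | none => rw [hR.1]; rfl
        | some a => exact hR
  · rintro u rest ⟨o, l⟩ v hinv hR
    cases o with
    | some a =>
      refine (Sem.ite (τ₁ := 3) (τ₂ := 1) (v := v.hd) (Det.hd (Det.var rfl))
        (fun _ => (Det.var rfl).sem _ hR) fun h => ?_).mono (by omega)
      rw [show v.hd = twoPowVal a from hR, toBool_twoPowVal] at h; exact absurd h (by simp)
    | none =>
      obtain ⟨rfl, hl⟩ := hR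
      have hl' : l ≤ n + 1 := by
        have := hinv rfl
        simp only [List.length_cons] at this
        omega
      refine (Sem.ite (τ₁ := 3) (τ₂ := 8 * Nat.clog 2 n * (Z + 100) + 80) (Det.hd (Det.var rfl))
        (fun h => by simp [Val.hd, Val.toBool] at h) fun _ => ?_).mono (by omega)
      refine (Sem.lett_det (τ₁ := 5) (τ₂ := 8 * Nat.clog 2 n * (Z + 100) + 70)
        (.tl (.tl (.var rfl))) ?_).mono (by omega)
      have hlaw : loopStep (bernoulliSubset n p hp) k F (none, l) =
          ((iid (acountTrial (bernoulliSubset n p hp) k F l) (8 * Nat.clog 2 n)).map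
            fun rec => rec.count true).bind fun c => PMF.pure
              (if 4 * Nat.clog 2 n < c then (some (l - 1), l) else (none, l + 1)) := by
        rw [PMF.bind_map]; rfl
      rw [hlaw]
      refine (Sem.lett (τ₁ := 8 * Nat.clog 2 n * (Z + 70) + 10)
        (τ₂ := 40 * (4 * Nat.clog 2 n) + 55) (Sem.mono (.app (.trials p hp F l _) rfl) ?_)
        fun c _ w hw => ?_).mono ?_
      · rw [hZ]; gcongr
      · subst hw
        refine (Sem.lett_det (τ₂ := 30) (.app (.dropList (4 * Nat.clog 2 n)
          (List.replicate c .nil)) rfl) ?_).mono (by omega)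
        have hb : (Val.ofList (List.drop (4 * Nat.clog 2 n) (List.replicate c Val.nil))).toBool =
            decide (4 * Nat.clog 2 n < c) := by
          rw [Val.toBool_ofList]; simp
        refine (Sem.ite (τ₁ := 1) (τ₂ := 25) (.var rfl) (fun h => ?_) fun h => ?_).mono (by omega)
        · rw [hb, decide_eq_true_eq] at h
          rw [if_pos h]
          refine ((Det.cons (.hd (.tl (.var rfl))) (.tl (.var rfl))).mono (by omega)).sem _ ?_
          exact rfl
        · rw [hb, decide_eq_false_iff_not] at h
          rw [if_neg h]
          refine ((Det.cons .nil (.cons (.cons .nil (.hd (.tl (.var rfl))))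
            (.cons .nil (.var rfl)))).mono (by omega)).sem _ ⟨?_, by simp⟩
          simp only [Val.tl, Val.hd, Nat.add_sub_cancel, Val.ofNat_succ]
          obtain ⟨l, rfl⟩ := Nat.exists_eq_add_of_le' hl
          rfl
      · have : 8 * Nat.clog 2 n * (Z + 100) = 8 * Nat.clog 2 n * (Z + 70) + 240 * Nat.clog 2 n := by
          ring
        omega
  · rintro u rest ⟨o, l⟩ hinv s' hs' hnone
    cases o with
    | some a =>
      simp only [loopStep, PMF.support_pure, Set.mem_singleton_iff] at hs'
      subst hs'
      simp at hnone
    | none =>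
      simp only [loopStep, PMF.mem_support_map_iff] at hs'
      obtain ⟨rec, -, rfl⟩ := hs'
      have := hinv rfl
      simp only [List.length_cons] at this
      split_ifs at hnone ⊢ with h
      show l + 1 + rest.length = n + 2
      omega

theorem Sem.acountProgram (F : CNF n) :
    Sem (acountInterp p hp) .acountProgram [.node (Val.ofNat k) (Val.ofCNF F)]
      ((n + 1) * (8 * Nat.clog 2 n *
        ((n + 1) * (40 * n + 542 * (k + 1) * 2 ^ k + 120) + F.size + 100) + 100) +
        n * (40 * n + 240) + 200)
      (exponentLaw (bernoulliSubset n p hp) k F) fun o w => w = outputVal o := by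
  refine Sem.mono (Sem.lett_det (Det.hd (Det.var rfl)) <| Sem.lett_det (Det.hd (.tl (.var rfl))) <|
    Sem.lett_det (.tl (.tl (.var rfl))) <| Sem.lett_det (.app (.varList n) rfl) <|
    Sem.lett_det (.app (.logs n) rfl) <| Sem.lett_det (.hd (.var rfl)) <|
    Sem.lett_det (.tl (.var rfl)) <| .app (.outerLoop p hp F) rfl) ?_
  have : n * (40 * n + 240) = n * (40 * n + 200) + 40 * n := by ring
  omega

theorem clog_le_two_mul_logb {n : ℕ} (hn : 2 ≤ n) : (Nat.clog 2 n : ℝ) ≤ 2 * Real.logb 2 n := by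
  have h1 : 1 ≤ Real.logb 2 n := by
    rw [Real.le_logb_iff_rpow_le (by norm_num) (by positivity)]
    simpa using (by exact_mod_cast hn : (2 : ℝ) ≤ n)
  have h2 : (Nat.clog 2 n : ℝ) < Real.logb 2 n + 1 := by
    rw [← Real.natCeil_logb_natCast 2 n]
    exact Nat.ceil_lt_add_one (by simpa using le_trans zero_le_one h1)
  linarith

theorem acount_runningTime :
    ∃ (prog : Cmd AcountPrim) (C : ℕ), ∀ (n k : ℕ) (h : k + 1 ≤ n),
      4 * Real.logb 2 (16 * (n : ℝ)) ≤ (k : ℝ) + 1 → ∀ F : CNF n,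
        ∃ μ : PMF Val,
          prog.Computes (acountInterp (acountBias n k) (acountBias_le_one h))
            (Val.node (Val.ofNat k) (Val.ofCNF F))
            ((C : ℝ) * ((n : ℝ) * Real.logb 2 (n : ℝ) *
              ((n : ℝ) ^ 2 + (2 : ℝ) ^ k * (k : ℝ) * (n : ℝ) + (F.size : ℝ)))) μ ∧
          μ.map Val.binToNat = acount k h F := by
  refine ⟨Expr.acountProgram.toCmd, 1000000, fun n k h hk F => ?_⟩
  have hn1 : 1 ≤ n := by omega
  -- With `k ≥ 1` the term `(k + 1) * 2 ^ k` is absorbed by `2 ^ k * k`; it also yields `n ≥ 2`,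
  -- hence `log n ≥ 1`, which absorbs the additive constants.
  have hk1 : 1 ≤ k := by
    have : (4 : ℝ) ≤ Real.logb 2 (16 * (n : ℝ)) := by
      rw [Real.le_logb_iff_rpow_le (by norm_num) (by positivity)]
      have : (1 : ℝ) ≤ n := by exact_mod_cast hn1
      norm_num; linarith
    have : (1 : ℝ) ≤ k := by linarith
    exact_mod_cast this
  have hn2 : 2 ≤ n := by omega
  have hlog := clog_le_two_mul_logb hn2
  have hlog1 : 1 ≤ Real.logb 2 n := by
    rw [Real.le_logb_iff_rpow_le (by norm_num) (by positivity)]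
    simpa using (by exact_mod_cast hn2 : (2 : ℝ) ≤ n)
  have hsem := Sem.acountProgram (k := k) (acountBias n k) (acountBias_le_one h) F
  refine ⟨(exponentLaw (bernoulliSubset n (acountBias n k) (acountBias_le_one h)) k F).map outputVal,
    Sem.computes hsem ?_, ?_⟩
  · have hs : (n : ℝ) ≤ F.size := by
      exact_mod_cast (by rw [CNF.size_eq]; omega : n ≤ F.size)
    push_cast
    set L : ℝ := Real.logb 2 n
    set c : ℝ := (Nat.clog 2 n : ℝ)
    have hn : (2 : ℝ) ≤ n := by exact_mod_cast hn2
    have hkr : (1 : ℝ) ≤ k := by exact_mod_cast hk1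
    have hw : (0 : ℝ) < 2 ^ k := by positivity
    set X : ℝ := (n : ℝ) ^ 2 + (2 : ℝ) ^ k * k * n + F.size with hX
    have hA : ((n : ℝ) + 1) * (40 * n + 542 * (k + 1) * 2 ^ k + 120) ≤ 2200 * (n ^ 2 + 2 ^ k * k * n) := by
      have h1 : (n : ℝ) + 1 ≤ 2 * n := by linarith
      have h2 : (542 : ℝ) * (k + 1) * 2 ^ k ≤ 1084 * (2 ^ k * k) := by nlinarith
      have h3 : 40 * (n : ℝ) + 542 * (k + 1) * 2 ^ k + 120 ≤ 100 * n + 1084 * (2 ^ k * k) := by linarith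
      calc _ ≤ (2 * (n : ℝ)) * (100 * n + 1084 * (2 ^ k * k)) := by gcongr
        _ ≤ _ := by nlinarith [mul_pos (mul_pos hw (by linarith : (0 : ℝ) < k)) (by linarith : (0 : ℝ) < n)]
    have hXn : (n : ℝ) ^ 2 ≤ X := by
      have : (0 : ℝ) ≤ 2 ^ k * k * n := by positivity
      have : (0 : ℝ) ≤ F.size := by positivity
      linarith
    have hX1 : 1 ≤ X := by nlinarith
    have hB : ((n : ℝ) + 1) * (40 * n + 542 * (k + 1) * 2 ^ k + 120) + F.size + 100 ≤ 2300 * X := by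
      have : (0 : ℝ) ≤ F.size := by positivity
      have : (0 : ℝ) ≤ n ^ 2 + 2 ^ k * k * n := by positivity
      linarith
    have hLX : 1 ≤ L * X := by nlinarith
    have hC : 8 * c * (((n : ℝ) + 1) * (40 * n + 542 * (k + 1) * 2 ^ k + 120) + F.size + 100) + 100 ≤
        40000 * (L * X) := by
      have : 8 * c * (((n : ℝ) + 1) * (40 * n + 542 * (k + 1) * 2 ^ k + 120) + F.size + 100) ≤
        (16 * L) * (2300 * X) := by
        have h8 : 8 * c ≤ 16 * L := by linarith
        gcongr
      linarith
    have hD : ((n : ℝ) + 1) * (8 * c * (((n : ℝ) + 1) * (40 * n + 542 * (k + 1) * 2 ^ k + 120) +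
        F.size + 100) + 100) ≤ (2 * n) * (40000 * (L * X)) := by
      gcongr
      linarith
    have hE : (n : ℝ) * (40 * n + 240) ≤ 160 * n * (L * X) := by
      have h1 : (40 * (n : ℝ) + 240) ≤ 160 * n ^ 2 := by nlinarith
      have h2 : X ≤ L * X := by nlinarith
      have h3 : (40 * (n : ℝ) + 240) ≤ 160 * (L * X) := by linarith
      calc (n : ℝ) * (40 * n + 240) ≤ n * (160 * (L * X)) := by gcongr
        _ = _ := by ring
    have hF : (1 : ℝ) ≤ n * (L * X) := by nlinarith
    calc _ ≤ (2 * n) * (40000 * (L * X)) + 160 * n * (L * X) + 202 := by linarith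
      _ ≤ 1000000 * (n * (L * X)) := by linarith
      _ = _ := by ring
  · rw [PMF.map_comp, exponentLaw, PMF.map_comp, acount, ← foldPMF_loopStep]
    congr 1
    funext s
    obtain ⟨o, l⟩ := s
    cases o with
    | none => rfl
    | some e => exact binToNat_twoPowVal e

end Acount

/-! ## Counting with a bound on the number of solutions -/

namespace CNF

variable {n : ℕ}

open Classical in
/-- Extend `acc` by `G` with the literal `(j, v)` fixed, if this is satisfiable. -/
noncomputable def tryLit (v : Bool) (j : Fin n) (acc : List (CNF n)) (G : CNF n) : List (CNF n) :=
  if isSat ([(j, v)] :: G) then ([(j, v)] :: G) :: acc else acc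

/-- Split all formulas of a list according to the value of the variable `j`, and keep the satisfiable
ones. -/
noncomputable def splitAll (j : Fin n) (A : List (CNF n)) : List (CNF n) :=
  A.foldl (fun acc G => tryLit false j (tryLit true j acc G) G) []

/-- Split a list of formulas, but give up if there are more than `M` of them. -/
noncomputable def splitStep (M : ℕ) (o : Option (List (CNF n))) (j : Fin n) :
    Option (List (CNF n)) :=
  match o with
  | none => none
  | some A => if M < (splitAll j A).length then none else some (splitAll j A)

/-- The list of the solutions of `F`, each given by a formula, or `none` if there are more than `M`
of them. -/
noncomputable def solutions (M : ℕ) (F : CNF n) : Option (List (CNF n)) :=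
  (List.finRange n).reverse.foldl (splitStep M) (some (if F.isSat then [F] else []))

theorem isSat_iff (F : CNF n) : F.isSat = true ↔ 0 < F.numSols := by
  rw [isSat, decide_eq_true_iff, numSols, Finset.card_pos]
  constructor
  · rintro ⟨x, hx⟩
    exact ⟨x, by simpa using hx⟩
  · rintro ⟨x, hx⟩
    exact ⟨x, by simpa using hx⟩

theorem numSols_split (j : Fin n) (G : CNF n) :
    numSols ([(j, true)] :: G) + numSols ([(j, false)] :: G) = G.numSols := by
  rw [numSols, numSols, numSols, ← Finset.card_union_of_disjoint]
  · congr 1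
    ext x
    simp only [eval_cons, Finset.mem_union, Finset.mem_filter, Finset.mem_univ, true_and,
      List.any_cons, List.any_nil]
    cases hx : x j <;> simp [hx]
  · rw [Finset.disjoint_filter]
    intro x _
    simp only [eval_cons, List.any_cons, List.any_nil]
    cases x j <;> simp

theorem tryLit_spec (v : Bool) (j : Fin n) (acc : List (CNF n)) (G : CNF n) :
    ((tryLit v j acc G).map numSols).sum = numSols ([(j, v)] :: G) + (acc.map numSols).sum ∧
    ∀ H ∈ tryLit v j acc G, H ∈ acc ∨ (H = [(j, v)] :: G ∧ 0 < H.numSols) := by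
  rw [tryLit]
  split_ifs with h
  · refine ⟨by simp, fun H hH => ?_⟩
    rcases List.mem_cons.1 hH with rfl | hH
    · exact Or.inr ⟨rfl, (isSat_iff _).1 h⟩
    · exact Or.inl hH
  · refine ⟨?_, fun H hH => Or.inl hH⟩
    have : numSols ([(j, v)] :: G) = 0 := by
      by_contra h0
      exact h ((isSat_iff _).2 (Nat.pos_of_ne_zero h0))
    rw [this, zero_add]

/-- Fixing a variable partitions the solutions of a formula, and discarding unsatisfiable formulas
loses none of them; hence the total number of solutions is preserved. -/
theorem splitAll_spec (j : Fin n) (A : List (CNF n)) :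
    ((splitAll j A).map numSols).sum = (A.map numSols).sum ∧
    ∀ H ∈ splitAll j A, 0 < H.numSols ∧ ∃ G ∈ A, ∃ v, H = [(j, v)] :: G := by
  have : ∀ (A acc : List (CNF n)),
      ((A.foldl (fun acc G => tryLit false j (tryLit true j acc G) G) acc).map numSols).sum =
        (A.map numSols).sum + (acc.map numSols).sum ∧
      ∀ H ∈ A.foldl (fun acc G => tryLit false j (tryLit true j acc G) G) acc,
        H ∈ acc ∨ (0 < H.numSols ∧ ∃ G ∈ A, ∃ v, H = [(j, v)] :: G) := by
    intro A
    induction A with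
    | nil => simp
    | cons G A ih =>
      intro acc
      rw [List.foldl_cons]
      obtain ⟨h1, h2⟩ := ih (tryLit false j (tryLit true j acc G) G)
      obtain ⟨h3, h4⟩ := tryLit_spec false j (tryLit true j acc G) G
      obtain ⟨h5, h6⟩ := tryLit_spec true j acc G
      refine ⟨?_, fun H hH => ?_⟩
      · rw [h1, h3, h5, List.map_cons, List.sum_cons, ← numSols_split j G]
        ring
      · rcases h2 H hH with h | ⟨h, G', hG', v, hv⟩
        · rcases h4 H h with h | ⟨h, h'⟩
          · rcases h6 H h with h | ⟨h, h'⟩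
            · exact Or.inl h
            · exact Or.inr ⟨h', G, List.mem_cons_self, true, h⟩
          · exact Or.inr ⟨h', G, List.mem_cons_self, false, h⟩
        · exact Or.inr ⟨h, G', List.mem_cons_of_mem _ hG', v, hv⟩
  obtain ⟨h1, h2⟩ := this A []
  refine ⟨by simpa [splitAll] using h1, fun H hH => ?_⟩
  rcases h2 H hH with h | h
  · exact absurd h (List.not_mem_nil)
  · exact h

theorem length_le_sum_numSols {A : List (CNF n)} (h : ∀ H ∈ A, 0 < H.numSols) :
    A.length ≤ (A.map numSols).sum := by
  have := List.length_le_sum_of_one_le (A.map numSols) (by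
    intro i hi
    obtain ⟨H, hH, rfl⟩ := List.mem_map.1 hi
    exact h H hH)
  simpa using this

/-- Every listed formula is satisfiable and their solutions add up to those of `F`, so a list longer
than `M` proves that `F` has more than `M` solutions. If the list never gets that long, in the end
all variables are fixed, every formula has exactly one solution, and the length is the count. -/
theorem solutions_spec (M : ℕ) (F : CNF n) (hM : 1 ≤ M) :
    (F.numSols ≤ M → ∃ A, solutions M F = some A ∧ A.length = F.numSols) ∧
    (M < F.numSols → solutions M F = none) := by
  set A₀ : List (CNF n) := if F.isSat then [F] else [] with hA₀
  have h0 : (A₀.map numSols).sum = F.numSols ∧ (∀ H ∈ A₀, 0 < H.numSols) ∧ A₀.length ≤ M := by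
    rw [hA₀]
    split_ifs with h
    · have := (isSat_iff F).1 h
      simpa [this] using hM
    · have : F.numSols = 0 := by
        by_contra h0
        exact h ((isSat_iff _).2 (Nat.pos_of_ne_zero h0))
      simp [this]
  have key : ∀ (js done : List (Fin n)) (A : List (CNF n)), (A.map numSols).sum = F.numSols →
      (∀ H ∈ A, 0 < H.numSols) → A.length ≤ M →
      (∀ H ∈ A, ∀ j ∈ done, ∃ v, ∀ x, eval H x = true → x j = v) →
      (js.foldl (splitStep M) (some A) = none ∧ M < F.numSols) ∨
      ∃ B, js.foldl (splitStep M) (some A) = some B ∧ (B.map numSols).sum = F.numSols ∧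
        (∀ H ∈ B, 0 < H.numSols) ∧ B.length ≤ M ∧
        ∀ H ∈ B, ∀ j, j ∈ done ∨ j ∈ js → ∃ v, ∀ x, eval H x = true → x j = v := by
    intro js
    induction js with
    | nil => exact fun done A h1 h2 h3 h4 => Or.inr ⟨A, rfl, h1, h2, h3, by simpa using h4⟩
    | cons j js ih =>
      intro done A h1 h2 h3 h4
      obtain ⟨hs1, hs2⟩ := splitAll_spec j A
      rw [List.foldl_cons, splitStep]
      split_ifs with hlen
      · refine Or.inl ⟨?_, ?_⟩
        · clear ih
          induction js with
          | nil => rfl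
          | cons i js ih => rw [List.foldl_cons, splitStep]; exact ih
        · have := length_le_sum_numSols fun H hH => (hs2 H hH).1
          omega
      · have hnew : ∀ H ∈ splitAll j A, ∀ i ∈ j :: done, ∃ v, ∀ x, eval H x = true → x i = v := by
          intro H hH i hi
          obtain ⟨-, G, hG, v, rfl⟩ := hs2 H hH
          rcases List.mem_cons.1 hi with rfl | hi
          · refine ⟨v, fun x hx => ?_⟩
            rw [eval_cons, Bool.and_eq_true] at hx
            simpa using hx.1
          · obtain ⟨v', hv'⟩ := h4 G hG i hi
            refine ⟨v', fun x hx => hv' x ?_⟩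
            rw [eval_cons, Bool.and_eq_true] at hx
            exact hx.2
        rcases ih (j :: done) (splitAll j A) (hs1.trans h1) (fun H hH => (hs2 H hH).1) (by omega)
          hnew with h | ⟨B, hB1, hB2, hB3, hB4, hB5⟩
        · exact Or.inl h
        · refine Or.inr ⟨B, hB1, hB2, hB3, hB4, fun H hH i hi => hB5 H hH i ?_⟩
          simp only [List.mem_cons] at hi ⊢
          tauto
  have := key (List.finRange n).reverse [] A₀ h0.1 h0.2.1 h0.2.2 (by simp)
  rw [solutions, ← hA₀]
  rcases this with ⟨h, h'⟩ | ⟨B, h1, h2, h3, h4, h5⟩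
  · exact ⟨fun h'' => absurd h' (by omega), fun _ => h⟩
  · have hone : ∀ H ∈ B, H.numSols = 1 := by
      intro H hH
      refine le_antisymm ?_ (h3 H hH)
      rw [numSols, Finset.card_le_one]
      intro x hx y hy
      simp only [Finset.mem_filter, Finset.mem_univ, true_and] at hx hy
      funext j
      obtain ⟨v, hv⟩ := h5 H hH j (Or.inr (by simp))
      rw [hv x hx, hv y hy]
    have hB : B.length = F.numSols := by
      rw [← h2, List.map_congr_left hone]
      simp
    exact ⟨fun _ => ⟨B, h1, hB⟩, fun h => absurd h (by omega)⟩

end CNF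

/-! ## Binary counters -/

/-- The value of a binary number, least significant bit first. -/
def bitsVal : List Bool → ℕ
  | [] => 0
  | b :: l => b.toNat + 2 * bitsVal l

/-- Add a carry to a binary number. -/
def ripple : Bool → List Bool → List Bool
  | c, [] => if c then [true] else []
  | c, b :: l => xor c b :: ripple (c && b) l

theorem bitsVal_ripple (c : Bool) (l : List Bool) :
    bitsVal (ripple c l) = bitsVal l + c.toNat := by
  induction l generalizing c with
  | nil => cases c <;> rfl
  | cons b l ih => rw [ripple, bitsVal, ih, bitsVal]; cases b <;> cases c <;> simp <;> ring

theorem length_ripple_le (c : Bool) (l : List Bool) : (ripple c l).length ≤ l.length + 1 := by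
  induction l generalizing c with
  | nil => cases c <;> simp [ripple]
  | cons b l ih => rw [ripple]; simpa using ih _

/-- The encoding of a binary number. -/
def bitsEnc (l : List Bool) : Val := Val.ofList (l.map Val.ofBool)

theorem binToNat_bitsEnc (l : List Bool) : (bitsEnc l).binToNat = bitsVal l := by
  induction l with
  | nil => rfl
  | cons b l ih =>
    rw [bitsEnc, List.map_cons, Val.ofList, Val.binToNat, ← bitsEnc, ih, bitsVal,
      Val.toBool_ofBool]
    cases b <;> rfl

/-- One step of the addition of a carry. -/
def rippleStep (s : Bool × List Bool) (b : Bool) : Bool × List Bool :=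
  (s.1 && b, xor s.1 b :: s.2)

theorem foldl_ripple (l : List Bool) (c : Bool) (o : List Bool) :
    (if (l.foldl rippleStep (c, o)).1 then true :: (l.foldl rippleStep (c, o)).2
      else (l.foldl rippleStep (c, o)).2).reverse = o.reverse ++ ripple c l := by
  induction l generalizing c o with
  | nil => cases c <;> simp [ripple]
  | cons b l ih =>
    rw [List.foldl_cons, rippleStep, ih, ripple]
    simp

theorem length_foldl_rippleStep (l : List Bool) (c : Bool) (o : List Bool) :
    (l.foldl rippleStep (c, o)).2.length = o.length + l.length := by
  induction l generalizing c o with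
  | nil => simp
  | cons b l ih =>
    rw [List.foldl_cons, rippleStep, ih, List.length_cons, List.length_cons]
    ring

/-- The binary representation of a number. -/
def bitsOf (m : ℕ) : List Bool := (ripple true)^[m] []

theorem bitsVal_bitsOf (m : ℕ) : bitsVal (bitsOf m) = m := by
  induction m with
  | zero => rfl
  | succ m ih =>
    rw [bitsOf, Function.iterate_succ_apply', ← bitsOf, bitsVal_ripple, ih]; rfl

namespace Expr

variable {P : Type}

/-- `[x]` ↦ `x + 1` in binary. -/
def incr : Expr P :=
  .lett (.fold (.var 0) (.cons (.cons .nil .nil) .nil)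
    (.ite (.hd (.var 1))
      (.ite (.var 2) (.cons (.cons .nil .nil) (.cons .nil (.tl (.var 1))))
        (.cons .nil (.cons (.cons .nil .nil) (.tl (.var 1)))))
      (.cons .nil (.cons (.var 2) (.tl (.var 1)))))) <|
  .lett (.ite (.hd (.var 1)) (.cons (.cons .nil .nil) (.tl (.var 1))) (.tl (.var 1))) <|
  .lett .nil <| .app revAppend [2, 3]

/-- `[l]` ↦ the length of `l` in binary. -/
def lengthBin : Expr P := .fold (.var 0) .nil (.app incr [1])

/-- `[l, x]` ↦ `2 ^ l * x`, with `l` in unary and `x` in binary. -/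
def shiftBin : Expr P := .fold (.var 0) (.var 1) (.cons .nil (.var 2))

/-- The iterated tail. -/
def tlN : ℕ → Expr P → Expr P
  | 0, e => e
  | m + 1, e => .tl (tlN m e)

/-- The list extended by `m` entries. -/
def consN : ℕ → Expr P → Expr P
  | 0, e => e
  | m + 1, e => .cons .nil (consN m e)

/-- `[m]` ↦ `m`, halved `b` times (rounding up). -/
def halveN : ℕ → Expr P
  | 0 => .var 0
  | b + 1 => .lett (.app halve [0]) (.app (halveN b) [1])

/-- `[m]` ↦ `2 ^ (m + m₀)` in unary. -/
def twoPow (m₀ : ℕ) : Expr P :=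
  .fold (consN m₀ (.var 0)) (.cons .nil .nil) (.app revAppend [1, 1])

end Expr

section Binary

variable {P : Type} {I : Interp P}

theorem Det.incr (l : List Bool) :
    Det I .incr [bitsEnc l] (100 * l.length + 120) (bitsEnc (ripple true l)) := by
  have h1 := Det.fold' (I := I) (env := [bitsEnc l]) (L := l) (enc := Val.ofBool)
    (l := .var 0) (i := .cons (.cons .nil .nil) .nil)
    (b₀ := (true, [])) (g := rippleStep)
    (encB := fun s => .node (Val.ofBool s.1) (bitsEnc s.2)) (Det.var rfl)
    (.cons (.cons .nil .nil) .nil)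
    (f := .ite (.hd (.var 1))
      (.ite (.var 2) (.cons (.cons .nil .nil) (.cons .nil (.tl (.var 1))))
        (.cons .nil (.cons (.cons .nil .nil) (.tl (.var 1)))))
      (.cons .nil (.cons (.var 2) (.tl (.var 1))))) (τ := 30)
    (fun b s => ((Det.ite (τ₁ := 3) (τ₂ := 20) (.hd (.var rfl))
      ((Det.ite (.var rfl) (.cons (.cons .nil .nil) (.cons .nil (.tl (.var rfl))))
        (.cons .nil (.cons (.cons .nil .nil) (.tl (.var rfl))))).mono (by omega))
      ((Det.cons .nil (.cons (.var rfl) (.tl (.var rfl)))).mono (by omega))).mono (by omega)).congr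
      (by obtain ⟨c, o⟩ := s; cases c <;> cases b <;> rfl))
  have h2 := foldl_ripple l true []
  simp only [List.reverse_nil, List.nil_append] at h2
  rw [← h2]
  have h3 := length_foldl_rippleStep l true []
  generalize l.foldl rippleStep (true, []) = s at h1 h3 ⊢
  refine (Det.lett h1 <| Det.lett (v := bitsEnc (if s.1 then true :: s.2 else s.2))
    ((Det.ite (τ₁ := 3) (τ₂ := 12) (.hd (.var rfl)) ((Det.cons (.cons .nil .nil) (.tl (.var rfl))).mono (by omega))
      ((Det.tl (.var rfl)).mono (by omega))).congr ?_) <| Det.lett .nil <|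
      Det.app ((Det.revAppend_list _ []).congr ?_) rfl).mono ?_
  · cases s.1 <;> rfl
  · rw [List.append_nil, bitsEnc, List.map_reverse]
  · have : (if s.1 then true :: s.2 else s.2).length ≤ s.2.length + 1 := by split_ifs <;> simp
    simp only [List.length_nil, List.length_map] at h3 ⊢
    omega

end Binary

/-! ## A program that counts solutions up to a bound -/

namespace Expr

variable {P : Type}

/-- `[N, j, acc, G]` ↦ the list `acc`, extended by `G` with the literal `(j, v)` if this is
satisfiable; `prog` decides satisfiability. -/
def tryLit (prog : Cmd Empty) (v : Bool) : Expr P :=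
  .lett (.cons (.cons (.cons (if v then .cons .nil .nil else .nil) (.var 1)) .nil) (.var 3)) <|
  .ite (.call prog (.cons (.var 0) (.var 4))) (.cons (.var 4) (.var 2)) (.var 2)

/-- `[N, j, A]` ↦ the satisfiable formulas that arise from those in `A` by fixing the variable
`j`. -/
def splitAll (prog : Cmd Empty) : Expr P :=
  .fold (.var 2) .nil
    (.lett (.app (tryLit prog true) [0, 1, 3, 4]) (.app (tryLit prog false) [0, 1, 5, 4]))

/-- `[N, vars, M, F]` ↦ the list of solutions of `F`, or `nil` if there are more than `M`. -/
def solutions (prog : Cmd Empty) : Expr P :=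
  .fold (.var 1) (.cons .nil (.ite (.call prog (.cons (.var 0) (.var 3))) (.cons (.var 3) .nil) .nil))
    (.ite (.var 4)
      (.lett (.tl (.var 4)) <| .lett (.app (splitAll prog) [0, 5, 6]) <|
        .lett (.app dropList [2, 7]) <| .ite (.var 8) .nil (.cons .nil (.var 7))) .nil)

end Expr

section Solve

variable {P : Type} {I : Interp P} {n : ℕ}

theorem Det.shiftBin (l : ℕ) (x : List Bool) :
    Det I .shiftBin [Val.ofNat l, bitsEnc x] (20 * l + 20)
      (bitsEnc (List.replicate l false ++ x)) := by
  have := Det.fold' (I := I) (env := [Val.ofNat l, bitsEnc x])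
    (L := List.replicate l ()) (enc := fun _ => Val.nil) (b₀ := x) (g := fun x _ => false :: x)
    (encB := bitsEnc) (l := .var 0) (i := .var 1) (Det.var (by rw [← Val.ofNat_eq]; rfl))
    (Det.var rfl) (f := .cons .nil (.var 2)) (fun _ x => Det.cons .nil (.var rfl))
  rw [List.foldl_replicate_unit (f := fun x : List Bool => false :: x)] at this
  refine (this.congr ?_).mono ?_
  · congr 1
    clear this
    induction l with
    | zero => rfl
    | succ l ih => rw [Function.iterate_succ_apply', ih]; rfl
  · rw [List.length_replicate]; omega

theorem bitsVal_shift (l : ℕ) (x : List Bool) :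
    bitsVal (List.replicate l false ++ x) = 2 ^ l * bitsVal x := by
  induction l with
  | zero => simp
  | succ l ih =>
    rw [List.replicate_succ, List.cons_append, bitsVal, ih, pow_succ]
    simp; ring

theorem Det.lengthBin (l : List Val) :
    Det I .lengthBin [Val.ofList l] (l.length * (100 * l.length + 130) + 20)
      (bitsEnc (bitsOf l.length)) := by
  have := Det.fold (I := I) (env := [Val.ofList l]) (L := l) (enc := id) (b₀ := [])
    (g := fun x _ => ripple true x) (encB := bitsEnc) (l := .var 0) (i := .nil)
    (fun rest x => x.length + rest.length ≤ l.length) (Det.var (by simp)) Det.nil (by simp)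
    (f := .app .incr [1]) (τ := 100 * l.length + 120)
    (fun a rest x hx => Det.app ((Det.incr x).mono (by simp at hx; omega)) rfl)
    (fun a rest x hx => by
      have := length_ripple_le true x
      simp at hx
      omega)
  refine (this.congr ?_).mono ?_
  · congr 1
    clear this
    rw [bitsOf]
    have : ∀ (l : List Val) (x : List Bool),
        l.foldl (fun x _ => ripple true x) x = (ripple true)^[l.length] x := by
      intro l
      induction l with
      | nil => exact fun _ => rfl
      | cons a l ih => intro x; rw [List.foldl_cons, ih]; rfl
    exact this l []
  · have : l.length * (100 * l.length + 130) = l.length * (100 * l.length + 120 + 7) + l.length * 3 := by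
      ring
    omega

theorem Det.tlN {env : List Val} (m : ℕ) {e : Expr P} {τ : ℕ} {L : List Val}
    (h : Det I e env τ (Val.ofList L)) :
    Det I (.tlN m e) env (τ + 2 * m) (Val.ofList (L.drop m)) := by
  induction m with
  | zero => exact h
  | succ m ih =>
    refine (ih.tl.congr ?_).mono (by omega)
    rw [← List.drop_drop]
    cases L.drop m <;> rfl

theorem Det.consN {env : List Val} (m : ℕ) {e : Expr P} {τ k : ℕ}
    (h : Det I e env τ (Val.ofNat k)) :
    Det I (.consN m e) env (τ + 4 * m) (Val.ofNat (k + m)) := by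
  induction m with
  | zero => exact h
  | succ m ih => exact ((Det.cons .nil ih).congr (Val.ofNat_succ _).symm).mono (by omega)

/-- The result of repeated halving, rounding up. -/
def halvings : ℕ → ℕ → ℕ
  | 0, m => m
  | b + 1, m => halvings b ((m + 1) / 2)

/-- Together with the next bound this says that `halvings b m` is `⌈m / 2 ^ b⌉`. The lower bound
makes the blocks cover all variables; the upper one keeps the rows short. -/
theorem le_two_pow_mul_halvings (b m : ℕ) : m ≤ 2 ^ b * halvings b m := by
  induction b generalizing m with
  | zero => simp [halvings]
  | succ b ih =>
    have := ih ((m + 1) / 2)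
    rw [halvings, pow_succ]
    have h : 2 ^ b * 2 * halvings b ((m + 1) / 2) = 2 * (2 ^ b * halvings b ((m + 1) / 2)) := by ring
    omega

theorem two_pow_mul_halvings_le (b m : ℕ) : 2 ^ b * halvings b m + 1 ≤ m + 2 ^ b := by
  induction b generalizing m with
  | zero => simp [halvings]
  | succ b ih =>
    have := ih ((m + 1) / 2)
    rw [halvings, pow_succ]
    have h : 2 ^ b * 2 * halvings b ((m + 1) / 2) = 2 * (2 ^ b * halvings b ((m + 1) / 2)) := by ring
    have h' : 0 < 2 ^ b := by positivity
    omega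

theorem Det.halveN (b m : ℕ) :
    Det I (.halveN b) [Val.ofNat m] (b * (40 * m + 70) + 1) (Val.ofNat (halvings b m)) := by
  induction b generalizing m with
  | zero => exact (Det.var rfl).mono (by omega)
  | succ b ih =>
    refine (Det.lett (.app (Det.halve m) rfl) (.app (ih _) rfl)).mono ?_
    have : b * (40 * ((m + 1) / 2) + 70) ≤ b * (40 * m + 70) := by gcongr; omega
    have : (b + 1) * (40 * m + 70) = b * (40 * m + 70) + (40 * m + 70) := by ring
    omega

theorem Det.twoPow (m₀ w : ℕ) :
    Det I (.twoPow m₀) [Val.ofNat w] ((w + m₀) * (40 * 2 ^ (w + m₀) + 40) + 4 * m₀ + 20)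
      (Val.ofNat (2 ^ (w + m₀))) := by
  have := Det.fold (I := I) (env := [Val.ofNat w]) (L := List.replicate (w + m₀) ())
    (enc := fun _ => Val.nil) (b₀ := 1)
    (g := fun x _ => 2 * x) (encB := Val.ofNat) (l := .consN m₀ (.var 0)) (i := .cons .nil .nil)
    (fun rest x => x * 2 ^ rest.length ≤ 2 ^ (w + m₀))
    ((Det.consN m₀ (.var rfl)).congr (by rw [← Val.ofNat_eq])) (Det.cons .nil .nil) (by simp)
    (f := .app .revAppend [1, 1]) (τ := 40 * 2 ^ (w + m₀) + 20)
    (fun a rest x hx => by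
      have h : x ≤ 2 ^ (w + m₀) := le_trans (Nat.le_mul_of_pos_right _ (by positivity)) hx
      refine Det.app (env' := [Val.ofNat x, Val.ofNat x])
        (((Det.revAppend_list _ _).congr ?_).mono ?_) rfl
      · rw [List.reverse_replicate, ← List.replicate_add, ← two_mul, Val.ofNat]
      · rw [List.length_replicate]; omega)
    (fun a rest x hx => by
      rw [List.length_cons, pow_succ] at hx
      calc 2 * x * 2 ^ rest.length = x * (2 ^ rest.length * 2) := by ring
        _ ≤ _ := hx)
  refine (this.congr ?_).mono ?_
  · rw [List.foldl_replicate_unit (f := fun x => 2 * x), mul_left_iterate]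
    simp
  · rw [List.length_replicate]
    have : (w + m₀) * (40 * 2 ^ (w + m₀) + 40) =
      (w + m₀) * (40 * 2 ^ (w + m₀) + 20 + 7) + (w + m₀) * 13 := by ring
    omega

/-- The program `prog` decides satisfiability of formulas up to size `Z` in time `T`. -/
def DecidesSAT (prog : Cmd Empty) (n Z : ℕ) (T : ℝ) : Prop :=
  ∀ G : CNF n, G.size ≤ Z → ∃ v : Val, prog.Computes detInterp (Val.ofCNF G) T (PMF.pure v) ∧
    v.toBool = G.isSat

variable {prog : Cmd Empty} {Z : ℕ} {T : ℝ}

/-- A bound on the time for a call of `prog`. -/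
noncomputable def callTime (prog : Cmd Empty) (T : ℝ) : ℕ := ⌊T⌋₊ + 2 * prog.maxVar

theorem CNF.size_lit (l : Fin n × Bool) (G : CNF n) : CNF.size ([l] :: G) = G.size + 2 := by
  simp [CNF.size]; omega

theorem Det.tryLit (h : DecidesSAT prog n Z T) (v : Bool) (j : Fin n) (acc : List (CNF n))
    (G : CNF n) (hG : G.size + 2 ≤ Z) :
    Det I (.tryLit prog v) [Val.ofNat n, Val.ofNat j, Val.ofList (acc.map Val.ofClauses),
      Val.ofClauses G] (callTime prog T + 60)
      (Val.ofList ((CNF.tryLit v j acc G).map Val.ofClauses)) := by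
  obtain ⟨w, hw, hw'⟩ := h ([(j, v)] :: G) (by rw [CNF.size_lit]; exact hG)
  refine (Det.lett (v := Val.ofClauses ([(j, v)] :: G)) (τ₁ := 22) ?_ <|
    (Det.ite (τ₁ := callTime prog T + 8) (τ₂ := 8)
      ((Det.call (.cons (.var rfl) (.var rfl)) (v := .node (Val.ofNat n) (Val.ofClauses ([(j, v)] :: G))) (by rw [← Val.ofCNF_eq]; exact hw)).mono ?_)
      (((Det.cons (.var rfl) (.var rfl))).mono (by omega)) ((Det.var rfl).mono (by omega))).congr
        ?_).mono ?_
  · refine (Det.cons (.cons (.cons (τ₁ := 5) (v := Val.ofBool v) ?_ (.var rfl)) .nil) (.var rfl)).mono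
      (by omega)
    cases v
    · exact Det.nil.mono (by omega)
    · exact Det.cons .nil .nil
  · rw [callTime]; omega
  · rw [hw', CNF.tryLit]
    split_ifs <;> rfl
  · omega

theorem Det.splitAll (h : DecidesSAT prog n Z T) (j : Fin n) (A : List (CNF n))
    (hA : ∀ G ∈ A, G.size + 2 ≤ Z) :
    Det I (.splitAll prog) [Val.ofNat n, Val.ofNat j, Val.ofList (A.map Val.ofClauses)]
      (A.length * (2 * callTime prog T + 130) + 10)
      (Val.ofList ((CNF.splitAll j A).map Val.ofClauses)) := by
  refine (Det.fold (I := I)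
    (env := [Val.ofNat n, Val.ofNat j, Val.ofList (A.map Val.ofClauses)]) (L := A)
    (enc := Val.ofClauses) (b₀ := [])
    (g := fun acc G => CNF.tryLit false j (CNF.tryLit true j acc G) G)
    (encB := fun A => Val.ofList (A.map Val.ofClauses)) (fun rest _ => ∀ G ∈ rest, G.size + 2 ≤ Z)
    (Det.var (i := 2) rfl) Det.nil hA (τ := 2 * callTime prog T + 123)
    (f := .lett (.app (Expr.tryLit prog true) [0, 1, 3, 4])
      (.app (Expr.tryLit prog false) [0, 1, 5, 4]))
    (fun G rest acc hr => (Det.lett (.app (Det.tryLit h true j acc G (hr G List.mem_cons_self)) rfl)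
      (.app (Det.tryLit h false j _ G (hr G List.mem_cons_self)) rfl)).mono (by omega))
    (fun G rest acc hr => fun H hH => hr H (List.mem_cons_of_mem _ hH))).mono ?_
  rw [show 2 * callTime prog T + 123 + 7 = 2 * callTime prog T + 130 by omega]
  omega

/-- The encoding of the result of `CNF.solutions`. -/
def solutionsVal (o : Option (List (CNF n))) : Val :=
  o.elim .nil fun A => .node .nil (Val.ofList (A.map Val.ofClauses))

/-- At most `M` formulas are split in each of the `n` rounds, with two SAT calls per formula. A
round adds one unit clause to a formula, which increases its size by 2; this is the `2 * n` in the
hypothesis. -/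
theorem Det.solutions (h : DecidesSAT prog n Z T) (M : ℕ) (hM : 1 ≤ M) (F : CNF n)
    (hF : F.size + 2 * n ≤ Z) :
    Det I (.solutions prog) [Val.ofNat n, varVals n, Val.ofNat M, Val.ofClauses F]
      (n * (M * (2 * callTime prog T + 170) + 100) + callTime prog T + 50)
      (solutionsVal (CNF.solutions M F)) := by
  obtain ⟨w, hw, hw'⟩ := h F (by omega)
  have hstep : ∀ (j : Fin n) (rest : List (Fin n)) (o : Option (List (CNF n))),
      (∀ A, o = some A → A.length ≤ M ∧ ∀ G ∈ A, G.size + 2 * (j :: rest).length ≤ Z) →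
      ∀ A, CNF.splitStep M o j = some A → A.length ≤ M ∧ ∀ G ∈ A, G.size + 2 * rest.length ≤ Z := by
    intro j rest o ho A hA
    match o with
    | none => cases hA
    | some B =>
      rw [CNF.splitStep] at hA
      split_ifs at hA with hlen
      cases hA
      refine ⟨by omega, fun G hG => ?_⟩
      obtain ⟨-, H, hH, v, rfl⟩ := (CNF.splitAll_spec j B).2 G hG
      have := (ho B rfl).2 H hH
      rw [List.length_cons] at this
      rw [CNF.size_lit]
      omega
  refine (Det.fold (I := I) (L := (List.finRange n).reverse) (enc := fun j : Fin n => Val.ofNat j)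
    (b₀ := some (if F.isSat then [F] else [])) (g := CNF.splitStep M)
    (encB := solutionsVal)
    (fun rest o => ∀ A, o = some A → A.length ≤ M ∧ ∀ G ∈ A, G.size + 2 * rest.length ≤ Z)
    (Det.var rfl) (τ₂ := callTime prog T + 30) ?_ ?_
    (τ := M * (2 * callTime prog T + 170) + 90) ?_ hstep).mono ?_
  · refine ((Det.cons .nil (Det.ite (τ₁ := callTime prog T + 8) (τ₂ := 6)
      ((Det.call (.cons (.var rfl) (.var rfl)) (v := .node (Val.ofNat n) (Val.ofClauses F)) (by rw [← Val.ofCNF_eq]; exact hw)).mono ?_)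
      ((Det.cons (.var rfl) .nil).mono (by omega)) (Det.nil.mono (by omega)))).congr ?_).mono ?_
    · rw [callTime]; omega
    · rw [hw']; split_ifs <;> rfl
    · omega
  · intro A hA
    cases hA
    split_ifs
    · simp; omega
    · simp
  · intro j rest o ho
    match o with
    | none =>
      exact (Sem.ite (v := Val.nil) (Det.var rfl) (fun h => by cases h)
        (fun _ => Det.nil.mono (by omega))).mono
        (show 1 + (M * (2 * callTime prog T + 170) + 80) + 2 ≤ _ by omega)
    | some A =>
      obtain ⟨hA1, hA2⟩ := ho A rfl
      have h1 : A.length * (2 * callTime prog T + 130) ≤ M * (2 * callTime prog T + 130) := by gcongr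
      have h2 : M * (2 * callTime prog T + 170) = M * (2 * callTime prog T + 130) + 40 * M := by ring
      refine (Sem.ite (τ₂ := M * (2 * callTime prog T + 170) + 80) (v := solutionsVal (some A))
        (Det.var rfl) (fun _ => ?_) (fun h => by cases h)).mono (by omega)
      refine ((Det.lett (.tl (Det.var (v := solutionsVal (some A)) rfl)) <|
        Det.lett (.app (Det.splitAll h j A (fun G hG => ?_)) rfl) <|
        Det.lett (.app (Det.dropList M _) rfl) <|
        Det.ite (.var rfl) (Det.nil.mono (τ' := 5) (by omega)) (.cons .nil (.var rfl))).congr ?_).mono ?_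
      · have := hA2 G hG
        rw [List.length_cons] at this
        omega
      · rw [CNF.splitStep, Val.toBool_ofList]
        simp only [List.length_drop, List.length_map, decide_eq_true_eq, Nat.sub_pos_iff_lt]
        split_ifs <;> rfl
      · omega
  · rw [List.length_reverse, List.length_finRange,
      show M * (2 * callTime prog T + 170) + 90 + 7 = M * (2 * callTime prog T + 170) + 97 by omega]
    have : n * (M * (2 * callTime prog T + 170) + 97) + n * 3 =
      n * (M * (2 * callTime prog T + 170) + 100) := by ring
    omega

end Solve

/-! ## Random sparse rows -/

/-- A fair coin. -/
noncomputable abbrev fairCoin : PMF Bool := PMF.uniformOfFintype Bool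

/-- A uniformly random one among the first `2 ^ b` entries of a list, or nothing if the list has no
such entry. -/
noncomputable def pickLaw {α : Type} : ℕ → List α → PMF (List α)
  | 0, L => PMF.pure (L.take 1)
  | b + 1, L => fairCoin.bind fun c => pickLaw b (if c then L.drop (2 ^ b) else L)

/-- Take a random entry from the next block of length `2 ^ b` with probability `1/2`. -/
noncomputable def blockStep {α : Type} (b : ℕ) (s : List α × List α) (_ : Unit) :
    PMF (List α × List α) :=
  (pickLaw b s.2).bind fun p => fairCoin.map fun c =>
    (if c then p ++ s.1 else s.1, s.2.drop (2 ^ b))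

/-- The law of a random set, given by a list, that contains at most one entry from each of the first
`w` blocks of the list `L`. -/
noncomputable def blockLaw {α : Type} (b w : ℕ) (L : List α) : PMF (List α) :=
  (foldPMF (blockStep b) (List.replicate w ()) ([], L)).map Prod.fst

theorem length_of_mem_support_pickLaw {α : Type} {b : ℕ} {L p : List α}
    (h : p ∈ (pickLaw b L).support) : p.length ≤ 1 := by
  induction b generalizing L with
  | zero =>
    obtain rfl : p = L.take 1 := by simpa [pickLaw] using h
    simp
  | succ b ih =>
    obtain ⟨c, -, hc⟩ := (PMF.mem_support_bind_iff _ _ _).1 h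
    exact ih hc

theorem length_of_mem_support_foldPMF_blockStep {α : Type} {b w : ℕ} {s s' : List α × List α}
    (h : s' ∈ (foldPMF (blockStep b) (List.replicate w ()) s).support) :
    s'.1.length ≤ s.1.length + w := by
  induction w generalizing s with
  | zero =>
    obtain rfl : s' = s := by simpa [foldPMF] using h
    simp
  | succ w ih =>
    rw [List.replicate_succ, foldPMF, PMF.mem_support_bind_iff] at h
    obtain ⟨t, ht, h⟩ := h
    obtain ⟨p, hp, ht⟩ := (PMF.mem_support_bind_iff _ _ _).1 ht
    obtain ⟨c, -, rfl⟩ := (PMF.mem_support_map_iff _ _ _).1 ht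
    have h1 := ih h
    have h2 := length_of_mem_support_pickLaw hp
    have h3 : (if c then p ++ s.1 else s.1).length ≤ s.1.length + 1 := by
      split_ifs
      · rw [List.length_append]; omega
      · omega
    simp only at h1
    omega

namespace Expr

/-- `[L]` ↦ the list of a random one among the first `2 ^ b` entries. -/
def pick : ℕ → Expr Unit
  | 0 => .ite (.var 0) (.cons (.hd (.var 0)) .nil) .nil
  | b + 1 => .lett (.prim () .nil) <| .lett (.ite (.var 1) (tlN (2 ^ b) (.var 0)) (.var 0)) <|
      .app (pick b) [2]

/-- `[L, w]` ↦ a random set with at most one entry from each of the first `w` blocks, and the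
remaining entries. -/
def sampleRow (b : ℕ) : Expr Unit :=
  .fold (.var 1) (.cons .nil (.var 0)) <|
    .lett (.tl (.var 2)) <| .lett (.app (pick b) [4]) <| .lett (.prim () .nil) <|
      .cons (.ite (.var 6) (.ite (.var 5) (.cons (.hd (.var 5)) (.hd (.var 2))) (.hd (.var 2)))
        (.hd (.var 2))) (tlN (2 ^ b) (.var 4))

end Expr

theorem Sem.coin (env : List Val) :
    Sem coinInterp (.prim () .nil) env 3 fairCoin fun b w => w = Val.ofBool b :=
  (Sem.prim (κ := 0) (f := fun b => (Val.ofBool b, 0)) Det.nil rfl (Set.toFinite _)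
    fun _ _ => le_rfl).mono (by omega)

theorem Sem.pick {α : Type} (enc : α → Val) (b : ℕ) (L : List α) :
    Sem coinInterp (.pick b) [Val.ofList (L.map enc)] (2 * 2 ^ b + 15 * b + 15) (pickLaw b L)
      fun p v => v = Val.ofList (p.map enc) := by
  induction b generalizing L with
  | zero =>
    refine ((Det.ite (.var rfl) (.cons (.hd (.var rfl)) .nil) (Det.nil.mono (by omega))).mono
      (by omega)).sem _ ?_
    cases L <;> rfl
  | succ b ih =>
    refine (Sem.lett (Sem.coin _) fun c _ v hv => ?_).mono
      (τ := 3 + (2 * 2 ^ b + 4 + (2 * 2 ^ b + 15 * b + 15) + 3) + 3) (by rw [pow_succ]; omega)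
    subst hv
    refine Sem.lett_det (v := Val.ofList ((if c then L.drop (2 ^ b) else L).map enc))
      ((Det.ite (.var rfl) ((Det.tlN (2 ^ b) (.var rfl))) ((Det.var rfl).mono (by omega))).congr
        ?_ |>.mono (by omega)) (Sem.app (ih _) rfl)
    rw [Val.toBool_ofBool]
    split_ifs
    · rw [List.map_drop]
    · rfl

/-- The encoding of the state of `Expr.sampleRow`. -/
def rowVal {n : ℕ} (s : List (Fin n) × List (Fin n)) : Val :=
  .node (varsVal s.1) (Val.ofList (s.2.map fun j : Fin n => Val.ofNat j))

theorem Sem.sampleRow {n : ℕ} (b w : ℕ) :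
    Sem coinInterp (.sampleRow b) [varVals n, Val.ofNat w]
      (w * (4 * 2 ^ b + 15 * b + 80) + 20)
      (foldPMF (blockStep b) (List.replicate w ()) ([], (List.finRange n).reverse))
      fun s v => v = rowVal s := by
  refine (Sem.fold (I := coinInterp) (env := [varVals n, Val.ofNat w])
    (enc := fun _ => Val.nil) (R := fun s v => v = rowVal s) (fun _ _ => True)
    (τ := 4 * 2 ^ b + 15 * b + 73)
    (Det.var (i := 1) (by rw [← Val.ofNat_eq]; rfl)) (Det.cons .nil (.var rfl)) rfl trivial ?_
    (fun _ _ _ _ _ _ => trivial)).mono ?_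
  · rintro - rest s v - rfl
    refine (Sem.lett_det (.tl (.var (v := rowVal s) rfl)) <|
      Sem.lett (Sem.app (Sem.pick (fun j : Fin n => Val.ofNat j) b s.2) rfl) fun p hp v hv => ?_).mono
      (τ := 3 + (2 * 2 ^ b + 15 * b + 15 + (3 + (2 * 2 ^ b + 30) + 3) + 3) + 3) (by omega)
    subst hv
    rw [← PMF.bind_pure_comp]
    refine Sem.lett (Sem.coin _) fun c _ v hv => ?_
    subst hv
    refine ((Det.cons (Det.ite (τ₂ := 13) (.var rfl) ((Det.ite (.var rfl)
      (.cons (.hd (.var rfl)) (.hd (.var (v := rowVal s) rfl)))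
      ((Det.hd (.var (v := rowVal s) rfl)).mono (by omega))).mono (by omega))
      ((Det.hd (.var (v := rowVal s) rfl)).mono (by omega))) (Det.tlN (2 ^ b) (.var rfl))).mono
      (by omega)).sem _ ?_
    have h2 := length_of_mem_support_pickLaw hp
    rw [Val.toBool_ofBool, ← List.map_drop]
    match p, h2 with
    | [], _ => cases c <;> rfl
    | [j], _ => cases c <;> rfl
  · rw [List.length_replicate, show 4 * 2 ^ b + 15 * b + 73 + 7 = 4 * 2 ^ b + 15 * b + 80 by omega]
    omega

/-! ## The counting program -/

section Count

variable {n : ℕ}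

/-- One iteration of the counting program on the state `(o, l, G)`, where `G` is the input formula with
`l` random parity constraints: count the solutions of `G` if there are at most `M`, and add another
constraint otherwise. -/
noncomputable def countStep (R : PMF (List (Fin n) × Bool)) (M : ℕ)
    (s : Option (ℕ × ℕ) × (ℕ × CNF n)) (_ : Unit) : PMF (Option (ℕ × ℕ) × (ℕ × CNF n)) :=
  match s.1 with
  | some _ => PMF.pure s
  | none => match CNF.solutions M s.2.2 with
    | some A => PMF.pure (some (s.2.1, A.length), s.2)
    | none => R.map fun r => (none, s.2.1 + 1, CNF.addRow r.1 r.2 s.2.2)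

/-- The output of the counting program if the random constraints are `rows`. -/
def countResult (M : ℕ) : List (List (Fin n) × Bool) → ℕ → CNF n → ℕ
  | [], _, _ => 0
  | r :: rows, l, G =>
      if G.numSols ≤ M then 2 ^ l * G.numSols else countResult M rows (l + 1) (CNF.addRow r.1 r.2 G)

theorem foldPMF_countStep_some (R : PMF (List (Fin n) × Bool)) (M m : ℕ) (x : ℕ × ℕ)
    (y : ℕ × CNF n) : foldPMF (countStep R M) (List.replicate m ()) (some x, y) =
      PMF.pure (some x, y) := by
  induction m with
  | zero => rfl
  | succ m ih => rw [List.replicate_succ, foldPMF, countStep, PMF.pure_bind, ih]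

/-- The program draws a row only when it needs one. Drawing all rows in advance gives the same law,
because the unused ones integrate out. -/
theorem foldPMF_countStep (R : PMF (List (Fin n) × Bool)) (M : ℕ) (hM : 1 ≤ M) (m l : ℕ)
    (G : CNF n) :
    (foldPMF (countStep R M) (List.replicate m ()) (none, l, G)).map
      (fun s => s.1.elim 0 fun x => 2 ^ x.1 * x.2) =
    (iid R m).map fun rows => countResult M rows l G := by
  induction m generalizing l G with
  | zero => simp [foldPMF, iid, PMF.pure_map, countResult]
  | succ m ih =>
    rw [List.replicate_succ, foldPMF, iid, countStep, PMF.map_bind]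
    simp only [PMF.map_bind, PMF.map_comp, Function.comp_def, countResult]
    by_cases h : G.numSols ≤ M
    · obtain ⟨A, hA, hA'⟩ := (CNF.solutions_spec M G hM).1 h
      rw [hA]
      simp only [PMF.pure_bind, foldPMF_countStep_some, PMF.pure_map, Option.elim, if_pos h, hA']
      have : ∀ (p : PMF (List (List (Fin n) × Bool))) (c : ℕ), p.map (fun _ => c) = PMF.pure c :=
        fun p c => PMF.map_const p c
      simp only [this, PMF.bind_const]
    · rw [(CNF.solutions_spec M G hM).2 (by omega)]
      simp only [if_neg h, PMF.bind_map, Function.comp_def, ih]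

/-- The encoding of the state of the counting program. -/
def countVal (s : Option (ℕ × ℕ) × (ℕ × CNF n)) : Val :=
  .node (s.1.elim .nil fun x => .node .nil (bitsEnc (List.replicate x.1 false ++ bitsOf x.2)))
    (.node (Val.ofNat s.2.1) (Val.ofClauses s.2.2))

/-- The output of the counting program. -/
def countOutput (s : Option (ℕ × ℕ)) : Val :=
  s.elim .nil fun x => bitsEnc (List.replicate x.1 false ++ bitsOf x.2)

theorem binToNat_countOutput (s : Option (ℕ × ℕ)) :
    (countOutput s).binToNat = s.elim 0 fun x => 2 ^ x.1 * x.2 := by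
  cases s with
  | none => rfl
  | some x => rw [countOutput, Option.elim, binToNat_bitsEnc, bitsVal_shift, bitsVal_bitsOf]; rfl

namespace Expr

/-- The body of the loop of `approxCount`. -/
def countBody (prog : Cmd Empty) (b : ℕ) : Expr Unit :=
  .ite (.hd (.var 5)) (.var 5) <|
  .lett (.tl (.tl (.var 5))) <|
  .lett (.app (solutions prog) [1, 2, 4, 7]) <|
  .ite (.var 8)
    (.lett (.tl (.var 8)) <| .lett (.app lengthBin [9]) <| .lett (.hd (.tl (.var 5))) <|
      .lett (.app shiftBin [11, 10]) <| .cons (.cons .nil (.var 12)) (.tl (.var 5)))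
    (.lett (.app (sampleRow b) [2, 3]) <| .lett (.hd (.var 9)) <| .lett (.prim () .nil) <|
      .cons .nil (.cons (.cons .nil (.hd (.tl (.var 5)))) (.app addRow [10, 11, 7])))

/-- `[F]` ↦ an approximation of the number of solutions of `F`. -/
def approxCount (prog : Cmd Empty) (b m₀ : ℕ) : Expr Unit :=
  .lett (.hd (.var 0)) <|
  .lett (.app varList [1]) <|
  .lett (.app (halveN b) [1]) <|
  .lett (.app (twoPow m₀) [3]) <|
  .lett (.fold (.cons .nil (.var 1)) (.cons .nil (.cons .nil (.tl (.var 0)))) (countBody prog b)) <|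
  .tl (.hd (.var 5))

end Expr

variable {prog : Cmd Empty} {Z : ℕ} {T : ℝ}

/-- A bound on the time of `Expr.countBody`. -/
noncomputable def countBodyTime (prog : Cmd Empty) (T : ℝ) (n b w M : ℕ) : ℕ :=
  (n * (M * (2 * callTime prog T + 170) + 100) + callTime prog T + 50) +
    (M * (100 * M + 130) + 20) + 20 * (n + 1) + (w * (4 * 2 ^ b + 15 * b + 80) + 20) +
    500 * (w + 1) * 2 ^ w + 200

theorem Sem.countBody (h : DecidesSAT prog n Z T) (b w M : ℕ) (hM : 1 ≤ M)
    (input a : Val) (s : Option (ℕ × ℕ) × (ℕ × CNF n)) (hl : s.2.1 ≤ n + 1)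
    (hG : s.2.2.size + 2 * n ≤ Z) :
    Sem coinInterp (.countBody prog b)
      [input, Val.ofNat n, varVals n, Val.ofNat w, Val.ofNat M, countVal s, a]
      (countBodyTime prog T n b w M)
      (countStep (rowLaw (blockLaw b w (List.finRange n).reverse)) M s ())
      fun s v => v = countVal s := by
  obtain ⟨o, l, G⟩ := s
  simp only at hl hG
  set t₁ := n * (M * (2 * callTime prog T + 170) + 100) + callTime prog T + 50 with ht₁
  set t₂ := M * (100 * M + 130) + 20 with ht₂
  set t₃ := w * (4 * 2 ^ b + 15 * b + 80) + 20 with ht₃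
  set t₄ := 500 * (w + 1) * 2 ^ w with ht₄
  have hT : countBodyTime prog T n b w M = t₁ + t₂ + 20 * (n + 1) + t₃ + t₄ + 200 := rfl
  rw [hT]
  match o with
  | some x =>
    have hvar : Det coinInterp (.var 5) [input, Val.ofNat n, varVals n, Val.ofNat w, Val.ofNat M,
        countVal (some x, l, G), a] 1 (countVal (some x, l, G)) := Det.var rfl
    refine (Sem.ite (τ₁ := 3) (τ₂ := 1) (.hd hvar) (fun _ => hvar.sem (R := fun s v => v = countVal s) (some x, l, G) rfl)
      (fun h => by cases h)).mono ?_
    omega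
  | none =>
    refine (Sem.ite (τ₂ := t₁ + t₂ + 20 * (n + 1) + t₃ + t₄ + 190)
      (.hd (.var (v := countVal (none, l, G)) rfl))
      (fun h => by cases h) (fun _ => ?_)).mono (by omega)
    refine (Sem.lett_det (.tl (.tl (.var (v := countVal (none, l, G)) rfl))) <|
      Sem.lett_det (Det.app (Det.solutions h M hM G hG) rfl)
      (τ₂ := t₂ + 20 * (n + 1) + t₃ + t₄ + 150) ?_).mono (by omega)
    rw [countStep]
    simp only
    by_cases hs : G.numSols ≤ M
    · obtain ⟨A, hA, hA'⟩ := (CNF.solutions_spec M G hM).1 hs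
      rw [hA]
      refine (Sem.ite (v := solutionsVal (some A)) (τ₂ := t₂ + 20 * (n + 1) + 100) (.var rfl)
        (fun _ => ?_) (fun h => by cases h)).mono (by omega)
      have hlen := Det.lengthBin (I := coinInterp) (A.map Val.ofClauses)
      rw [List.length_map] at hlen
      refine ((Det.lett (.tl (.var (v := solutionsVal (some A)) rfl)) <|
        Det.lett (.app (hlen.mono (τ' := t₂) ?_) rfl) <|
        Det.lett (.hd (.tl (.var (v := countVal (none, l, G)) rfl))) <|
        Det.lett (.app (Det.shiftBin l _) rfl) <|
        Det.cons (.cons .nil (.var rfl)) (.tl (.var (v := countVal (none, l, G)) rfl))).mono ?_).sem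
        _ rfl
      · rw [ht₂]
        have : A.length ≤ M := by omega
        gcongr
      · omega
    · rw [(CNF.solutions_spec M G hM).2 (by omega)]
      refine (Sem.ite (v := solutionsVal (none : Option (List (CNF n)))) (τ₂ := t₃ + t₄ + 100)
        (.var rfl) (fun h => by cases h) (fun _ => ?_)).mono (by omega)
      have hlaw : (rowLaw (blockLaw b w (List.finRange n).reverse)).map (fun r =>
          ((none : Option (ℕ × ℕ)), l + 1, CNF.addRow r.1 r.2 G)) =
          (foldPMF (blockStep b) (List.replicate w ()) ([], (List.finRange n).reverse)).bind fun s =>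
            fairCoin.bind fun c => PMF.pure (none, l + 1, CNF.addRow s.1 c G) := by
        rw [rowLaw, blockLaw, PMF.map_bind, PMF.bind_map]
        simp only [Function.comp_def, ← PMF.bind_pure_comp, PMF.bind_bind, PMF.pure_bind]
      rw [hlaw]
      refine (Sem.lett (Sem.app (Sem.sampleRow b w) rfl) (τ₂ := t₄ + 90) fun s hs v hv => ?_).mono
        (by omega)
      subst hv
      have hlen := length_of_mem_support_foldPMF_blockStep hs
      rw [List.length_nil, zero_add] at hlen
      refine (Sem.lett_det (.hd (.var (v := rowVal s) rfl)) <|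
        Sem.lett (Sem.coin _) (τ₂ := t₄ + 40) fun c _ v hv => ?_).mono (by omega)
      subst hv
      refine ((Det.cons .nil (.cons (.cons .nil (.hd (.tl
        (.var (v := countVal (none, l, G)) rfl))))
        (.app ((Det.addRow s.1 c G).mono (τ' := t₄) ?_) rfl))).mono (by omega)).sem _ rfl
      rw [ht₄]
      gcongr
      norm_num

/-- A bound on the time of `Expr.approxCount`. -/
noncomputable def approxCountTime (prog : Cmd Empty) (T : ℝ) (n b m₀ w : ℕ) : ℕ :=
  (n + 1) * (countBodyTime prog T n b w (2 ^ (w + m₀)) + 7) + (40 * n + 20) +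
    (b * (40 * n + 70) + 1) + ((w + m₀) * (40 * 2 ^ (w + m₀) + 40) + 4 * m₀ + 20) + 100

theorem Sem.approxCount (b m₀ : ℕ) (F : CNF n) (h : DecidesSAT prog n Z T)
    (hZ : F.size + (n + 1) * (2 ^ halvings b n * (halvings b n + 1)) + 2 * n ≤ Z) :
    Sem coinInterp (.approxCount prog b m₀) [Val.ofCNF F]
      (approxCountTime prog T n b m₀ (halvings b n))
      ((foldPMF (countStep (rowLaw (blockLaw b (halvings b n) (List.finRange n).reverse))
        (2 ^ (halvings b n + m₀))) (List.replicate (n + 1) ()) (none, 0, F)).map Prod.fst)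
      fun s v => v = countOutput s := by
  set w := halvings b n with hw
  set M := 2 ^ (w + m₀) with hM
  set W := 2 ^ w * (w + 1) with hW
  have hM1 : 1 ≤ M := Nat.one_le_two_pow
  rw [Val.ofCNF_eq]
  have hloop : Sem coinInterp
      (.lett (.fold (.cons .nil (.var 1)) (.cons .nil (.cons .nil (.tl (.var 0))))
        (Expr.countBody prog b)) (.tl (.hd (.var 5))))
      [.node (Val.ofNat n) (Val.ofClauses F), Val.ofNat n, varVals n, Val.ofNat w, Val.ofNat M]
      ((n + 1) * (countBodyTime prog T n b w M + 7) + 40)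
      ((foldPMF (countStep (rowLaw (blockLaw b w (List.finRange n).reverse)) M)
        (List.replicate (n + 1) ()) (none, 0, F)).map Prod.fst) fun s v => v = countOutput s := by
    rw [← PMF.bind_pure_comp]
    refine (Sem.lett (Sem.fold (L := List.replicate (n + 1) ()) (enc := fun _ => Val.nil)
      (R := fun s v => v = countVal s) (τ := countBodyTime prog T n b w M)
      (g := countStep (rowLaw (blockLaw b w (List.finRange n).reverse)) M)
      -- A row adds at most `W` to the size, so all formulas passed to the SAT algorithm stay within
      -- the size `Z` for which the time bound `T` is available.
      (b₀ := (none, 0, F)) (fun rest s => s.2.1 + rest.length ≤ n + 1 ∧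
        s.2.2.size + rest.length * W + 2 * n ≤ Z)
      ((Det.cons .nil (.var rfl)).congr (by rw [Val.ofNat_eq]; rfl))
      (.cons .nil (.cons .nil (.tl (.var rfl)))) rfl ?_ ?_ ?_) (τ₂ := 5) ?_).mono ?_
    · simpa using hZ
    · rintro a rest s v ⟨h1, h2⟩ rfl
      rw [List.length_cons] at h1 h2
      have hr : (rest.length + 1) * W = rest.length * W + W := by ring
      exact Sem.countBody h b w M hM1 _ _ s (by omega) (by omega)
    · rintro a rest ⟨o, l, G⟩ ⟨h1, h2⟩ s' hs'
      rw [List.length_cons] at h1 h2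
      have hr : (rest.length + 1) * W = rest.length * W + W := by ring
      rw [countStep] at hs'
      simp only at h1 h2 hs'
      match o with
      | some x =>
        obtain rfl : s' = (some x, l, G) := by simpa using hs'
        exact ⟨by simp only; omega, by simp only; omega⟩
      | none =>
        simp only at hs'
        match hsol : CNF.solutions M G with
        | some A =>
          rw [hsol] at hs'
          obtain rfl : s' = (some (l, A.length), l, G) := by simpa using hs'
          exact ⟨by simp only; omega, by simp only; omega⟩
        | none =>
          rw [hsol] at hs'
          obtain ⟨⟨js, c⟩, hr', rfl⟩ := (PMF.mem_support_map_iff _ _ _).1 hs'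
          rw [rowLaw, PMF.mem_support_bind_iff] at hr'
          obtain ⟨js', hjs, hr'⟩ := hr'
          obtain ⟨c', -, hc⟩ := (PMF.mem_support_map_iff _ _ _).1 hr'
          cases hc
          obtain ⟨s, hs, rfl⟩ := (PMF.mem_support_map_iff _ _ _).1 hjs
          have hlen := length_of_mem_support_foldPMF_blockStep hs
          rw [List.length_nil, zero_add] at hlen
          refine ⟨by simp only; omega, ?_⟩
          have h3 := CNF.length_addRow_le s.1 c G
          have h4 := CNF.occ_addRow_le s.1 c G
          have h5 : 2 ^ s.1.length ≤ 2 ^ w := Nat.pow_le_pow_right (by norm_num) hlen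
          have h6 : 2 ^ s.1.length * s.1.length ≤ 2 ^ w * w := Nat.mul_le_mul h5 hlen
          have h7 : W = 2 ^ w * w + 2 ^ w := by rw [hW]; ring
          simp only [CNF.size_eq] at h2 ⊢
          omega
    · rintro s - v rfl
      exact ((Det.tl (.hd (.var (v := countVal s) rfl))).congr (by
        obtain ⟨o, s⟩ := s; cases o <;> rfl)).sem _ rfl
    · rw [List.length_replicate]
      omega
  refine (Sem.lett_det (.hd (.var rfl)) <|
    Sem.lett_det (.app (Det.varList n) rfl) <|
    Sem.lett_det (.app (Det.halveN b n) rfl) <|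
    Sem.lett_det (.app (Det.twoPow m₀ w) rfl) hloop).mono ?_
  rw [approxCountTime, ← hM]
  omega

end Count

/-! ## Expectations -/

open Classical in
/-- The indicator of a proposition. -/
noncomputable def ind (p : Prop) : ℝ≥0∞ := if p then 1 else 0

theorem ind_true {p : Prop} (h : p) : ind p = 1 := if_pos h

theorem ind_false {p : Prop} (h : ¬p) : ind p = 0 := if_neg h

theorem ind_le_one (p : Prop) : ind p ≤ 1 := by rw [ind]; split_ifs <;> simp

theorem ind_and (p q : Prop) : ind (p ∧ q) = ind p * ind q := by
  by_cases hp : p <;> by_cases hq : q <;> simp [ind, hp, hq]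

theorem ind_mono {p q : Prop} (h : p → q) : ind p ≤ ind q := by
  by_cases hp : p
  · rw [ind_true hp, ind_true (h hp)]
  · rw [ind_false hp]; exact zero_le

theorem ind_or_le (p q : Prop) : ind (p ∨ q) ≤ ind p + ind q := by
  by_cases hp : p <;> by_cases hq : q <;> simp [ind, hp, hq]

theorem ind_add_ind_not (p : Prop) : ind p + ind (¬p) = 1 := by
  by_cases hp : p <;> simp [ind, hp]

namespace PMF

variable {α β : Type} (μ : PMF α)

/-- The expectation of a function with values in `[0, ∞]`. -/
noncomputable def ex (f : α → ℝ≥0∞) : ℝ≥0∞ := ∑' a, μ a * f a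

theorem ex_pure (a : α) (f : α → ℝ≥0∞) : (PMF.pure a).ex f = f a := by
  rw [ex, tsum_eq_single a]
  · simp
  · intro b hb
    simp [hb]

theorem ex_comm (ν : PMF β) (f : α → β → ℝ≥0∞) :
    μ.ex (fun a => ν.ex (f a)) = ν.ex fun b => μ.ex fun a => f a b := by
  simp only [ex, ← ENNReal.tsum_mul_left]
  rw [ENNReal.tsum_comm]
  refine tsum_congr fun b => tsum_congr fun a => ?_
  ring

theorem ex_bind (g : α → PMF β) (f : β → ℝ≥0∞) : (μ.bind g).ex f = μ.ex fun a => (g a).ex f := by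
  simp only [ex, PMF.bind_apply, ← ENNReal.tsum_mul_left, ← ENNReal.tsum_mul_right]
  rw [ENNReal.tsum_comm]
  refine tsum_congr fun b => tsum_congr fun a => ?_
  ring

theorem ex_map (g : α → β) (f : β → ℝ≥0∞) : (μ.map g).ex f = μ.ex fun a => f (g a) := by
  rw [← PMF.bind_pure_comp, ex_bind]
  simp only [Function.comp_apply, ex_pure]

theorem ex_mono_support {f g : α → ℝ≥0∞} (h : ∀ a ∈ μ.support, f a ≤ g a) : μ.ex f ≤ μ.ex g := by
  refine ENNReal.tsum_le_tsum fun a => ?_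
  by_cases ha : μ a = 0
  · simp [ha]
  · gcongr
    exact h a ha

theorem ex_mono {f g : α → ℝ≥0∞} (h : ∀ a, f a ≤ g a) : μ.ex f ≤ μ.ex g :=
  μ.ex_mono_support fun a _ => h a

theorem ex_congr {f g : α → ℝ≥0∞} (h : ∀ a ∈ μ.support, f a = g a) : μ.ex f = μ.ex g :=
  le_antisymm (μ.ex_mono_support fun a ha => (h a ha).le)
    (μ.ex_mono_support fun a ha => (h a ha).ge)

theorem ex_add (f g : α → ℝ≥0∞) : μ.ex (fun a => f a + g a) = μ.ex f + μ.ex g := by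
  simp only [ex, mul_add, ENNReal.tsum_add]

theorem ex_mul_left (c : ℝ≥0∞) (f : α → ℝ≥0∞) : μ.ex (fun a => c * f a) = c * μ.ex f := by
  simp only [ex, ← ENNReal.tsum_mul_left]
  exact tsum_congr fun a => by ring

theorem ex_mul_right (c : ℝ≥0∞) (f : α → ℝ≥0∞) : μ.ex (fun a => f a * c) = μ.ex f * c := by
  simp only [mul_comm _ c, ex_mul_left]

theorem ex_const (c : ℝ≥0∞) : μ.ex (fun _ => c) = c := by
  rw [ex, ENNReal.tsum_mul_right, PMF.tsum_coe, one_mul]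

theorem ex_sum {ι : Type} (s : Finset ι) (f : ι → α → ℝ≥0∞) :
    μ.ex (fun a => ∑ i ∈ s, f i a) = ∑ i ∈ s, μ.ex (f i) := by
  classical
  induction s using Finset.induction_on with
  | empty => simpa using μ.ex_const 0
  | insert i s hi ih => simp only [Finset.sum_insert hi, ex_add, ih]

theorem ex_ind_le_one (E : α → Prop) : μ.ex (fun a => ind (E a)) ≤ 1 :=
  (μ.ex_mono fun a => ind_le_one (E a)).trans_eq (μ.ex_const 1)

theorem pr_eq (E : α → Prop) : μ.pr E = (μ.ex fun a => ind (E a)).toReal := by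
  rw [pr, PMF.toOuterMeasure_apply, ex]
  congr 2
  funext a
  by_cases h : E a
  · rw [ind_true h, Set.indicator_of_mem (by exact h), mul_one]
  · rw [ind_false h, Set.indicator_of_notMem (by exact h), mul_zero]

theorem ofReal_pr (E : α → Prop) : ENNReal.ofReal (μ.pr E) = μ.ex fun a => ind (E a) := by
  rw [pr_eq, ENNReal.ofReal_toReal]
  exact ne_top_of_le_ne_top ENNReal.one_ne_top (μ.ex_ind_le_one E)

theorem pr_nonneg (E : α → Prop) : 0 ≤ μ.pr E := ENNReal.toReal_nonneg

theorem pr_le_one (E : α → Prop) : μ.pr E ≤ 1 := by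
  rw [pr_eq]
  exact ENNReal.toReal_le_of_le_ofReal zero_le_one (by simpa using μ.ex_ind_le_one E)

theorem pr_le_iff {E : α → Prop} {c : ℝ} (hc : 0 ≤ c) :
    μ.pr E ≤ c ↔ (μ.ex fun a => ind (E a)) ≤ ENNReal.ofReal c := by
  rw [← ofReal_pr, ENNReal.ofReal_le_ofReal_iff hc]

theorem pr_mono_support {E E' : α → Prop} (h : ∀ a ∈ μ.support, E a → E' a) : μ.pr E ≤ μ.pr E' := by
  rw [pr_le_iff _ (μ.pr_nonneg E'), ofReal_pr]
  exact μ.ex_mono_support fun a ha => ind_mono (h a ha)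

theorem pr_mono {E E' : α → Prop} (h : ∀ a, E a → E' a) : μ.pr E ≤ μ.pr E' :=
  μ.pr_mono_support fun a _ => h a

theorem pr_congr {E E' : α → Prop} (h : ∀ a ∈ μ.support, E a ↔ E' a) : μ.pr E = μ.pr E' :=
  le_antisymm (μ.pr_mono_support fun a ha => (h a ha).1) (μ.pr_mono_support fun a ha => (h a ha).2)

theorem pr_or_le (E E' : α → Prop) : μ.pr (fun a => E a ∨ E' a) ≤ μ.pr E + μ.pr E' := by
  rw [pr_le_iff _ (add_nonneg (μ.pr_nonneg _) (μ.pr_nonneg _)),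
    ENNReal.ofReal_add (μ.pr_nonneg _) (μ.pr_nonneg _), ofReal_pr, ofReal_pr, ← ex_add]
  exact μ.ex_mono fun a => ind_or_le _ _

theorem pr_not (E : α → Prop) : μ.pr (fun a => ¬E a) = 1 - μ.pr E := by
  have h : μ.ex (fun a => ind (E a)) + μ.ex (fun a => ind (¬E a)) = 1 := by
    rw [← ex_add, ← μ.ex_const 1]
    exact congrArg _ (funext fun a => ind_add_ind_not _)
  rw [← ofReal_pr, ← ofReal_pr, ← ENNReal.ofReal_add (μ.pr_nonneg _) (μ.pr_nonneg _),
    ENNReal.ofReal_eq_one] at h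
  linarith

theorem pr_exists_le {ι : Type} (s : Finset ι) (E : ι → α → Prop) :
    μ.pr (fun a => ∃ i ∈ s, E i a) ≤ ∑ i ∈ s, μ.pr (E i) := by
  classical
  induction s using Finset.induction_on with
  | empty =>
    simp only [Finset.notMem_empty, false_and, exists_false, Finset.sum_empty]
    rw [pr_eq]
    simp [ind, ex]
  | insert i s hi ih =>
    rw [Finset.sum_insert hi]
    refine (μ.pr_mono ?_).trans ((μ.pr_or_le (E i) _).trans (by gcongr))
    rintro a ⟨j, hj, h⟩
    rcases Finset.mem_insert.1 hj with rfl | hj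
    · exact Or.inl h
    · exact Or.inr ⟨j, hj, h⟩

theorem pr_map (g : α → β) (E : β → Prop) : (μ.map g).pr E = μ.pr fun a => E (g a) := by
  rw [pr_eq, pr_eq, ex_map]

theorem pr_pure (a : α) (E : α → Prop) [Decidable (E a)] :
    (PMF.pure a).pr E = if E a then 1 else 0 := by
  rw [pr_eq, ex_pure]
  split_ifs with h
  · rw [ind_true h]; rfl
  · rw [ind_false h]; rfl

theorem pr_eq_one {E : α → Prop} (h : ∀ a ∈ μ.support, E a) : μ.pr E = 1 := by
  rw [pr_eq, μ.ex_congr (g := fun _ => 1) fun a ha => ind_true (h a ha), ex_const]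
  rfl

/-- Total probability, for a kernel with two values. -/
theorem pr_bind_of_two {g : α → PMF β} {E : β → Prop} {P : α → Prop} {A B : ℝ}
    (hP : ∀ a ∈ μ.support, P a → (g a).pr E = A) (hN : ∀ a ∈ μ.support, ¬P a → (g a).pr E = B) :
    (μ.bind g).pr E = μ.pr P * A + (1 - μ.pr P) * B := by
  by_cases h1 : ∃ a ∈ μ.support, P a
  · have hA : 0 ≤ A := by obtain ⟨a, ha, h⟩ := h1; rw [← hP a ha h]; exact pr_nonneg _ _
    by_cases h2 : ∃ a ∈ μ.support, ¬P a
    · have hB : 0 ≤ B := by obtain ⟨a, ha, h⟩ := h2; rw [← hN a ha h]; exact pr_nonneg _ _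
      have h3 := μ.pr_not P
      have h4 : 0 ≤ 1 - μ.pr P := by rw [← h3]; exact pr_nonneg _ _
      rw [pr_eq, ex_bind, μ.ex_congr (g := fun a => ind (P a) * ENNReal.ofReal A +
        ind (¬P a) * ENNReal.ofReal B), ex_add, ex_mul_right, ex_mul_right, ← ofReal_pr, ← ofReal_pr,
        h3, ← ENNReal.ofReal_mul (pr_nonneg _ _), ← ENNReal.ofReal_mul h4,
        ← ENNReal.ofReal_add (mul_nonneg (pr_nonneg _ _) hA) (mul_nonneg h4 hB),
        ENNReal.toReal_ofReal]
      · exact add_nonneg (mul_nonneg (pr_nonneg _ _) hA) (mul_nonneg h4 hB)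
      · intro a ha
        rw [← ofReal_pr]
        by_cases h : P a
        · rw [ind_true h, ind_false (not_not.2 h), hP a ha h]; simp
        · rw [ind_false h, ind_true h, hN a ha h]; simp
    · push Not at h2
      rw [μ.pr_eq_one h2, pr_eq, ex_bind, μ.ex_congr (g := fun _ => ENNReal.ofReal A), ex_const,
        ENNReal.toReal_ofReal hA]
      · ring
      · intro a ha
        rw [← ofReal_pr, hP a ha (h2 a ha)]
  · push Not at h1
    have h0 : μ.pr P = 0 := by
      have := μ.pr_eq_one h1
      rw [pr_not] at this
      linarith
    obtain ⟨a₀, ha₀⟩ := μ.support_nonempty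
    have hB : 0 ≤ B := by rw [← hN a₀ ha₀ (h1 a₀ ha₀)]; exact pr_nonneg _ _
    rw [h0, pr_eq, ex_bind, μ.ex_congr (g := fun _ => ENNReal.ofReal B), ex_const,
      ENNReal.toReal_ofReal hB]
    · ring
    · intro a ha
      rw [← ofReal_pr, hN a ha (h1 a ha)]

end PMF

theorem ex_fairCoin (f : Bool → ℝ≥0∞) : fairCoin.ex f = 2⁻¹ * (f true + f false) := by
  rw [PMF.ex, tsum_fintype]
  simp [mul_add]

/-! ## Independent samples -/

section Iid

variable {α : Type} (R : PMF α)

theorem ex_iid_succ (l : ℕ) (f : List α → ℝ≥0∞) :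
    (iid R (l + 1)).ex f = R.ex fun a => (iid R l).ex fun as => f (a :: as) := by
  rw [iid, PMF.ex_bind]
  simp only [PMF.ex_map]

theorem ex_iid_forall (P : α → Prop) (l : ℕ) :
    (iid R l).ex (fun as => ind (∀ a ∈ as, P a)) = (R.ex fun a => ind (P a)) ^ l := by
  induction l with
  | zero => simp [iid, PMF.ex_pure, ind]
  | succ l ih =>
    rw [ex_iid_succ]
    simp only [List.forall_mem_cons, ind_and, PMF.ex_mul_left, ih, PMF.ex_mul_right, pow_succ']

theorem pr_iid_exists_le (P : α → Prop) (l : ℕ) :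
    (iid R l).pr (fun as => ∃ a ∈ as, P a) ≤ l * R.pr P := by
  induction l with
  | zero => simp [PMF.pr_eq, iid, PMF.ex_pure, ind]
  | succ l ih =>
    have h := PMF.pr_nonneg R P
    have h' := PMF.pr_nonneg (iid R l) fun as => ∃ a ∈ as, P a
    rw [PMF.pr_le_iff _ (by positivity), ex_iid_succ]
    calc _ ≤ R.ex fun a => (iid R l).ex fun as => ind (P a) + ind (∃ a ∈ as, P a) := by
          refine R.ex_mono fun a => PMF.ex_mono _ fun as => ?_
          refine le_trans (ind_mono ?_) (ind_or_le _ _)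
          simp
      _ = ENNReal.ofReal (R.pr P) + ENNReal.ofReal ((iid R l).pr fun as => ∃ a ∈ as, P a) := by
          simp only [PMF.ex_add, PMF.ex_const, PMF.ofReal_pr]
      _ ≤ _ := by
          rw [← ENNReal.ofReal_add h h']
          refine ENNReal.ofReal_le_ofReal ?_
          push_cast
          linarith

/-- The law of a prefix of a list of independent samples. -/
theorem iid_map_take {l m : ℕ} (h : l ≤ m) : (iid R m).map (List.take l) = iid R l := by
  induction m generalizing l with
  | zero =>
    obtain rfl : l = 0 := by omega
    simp [iid, PMF.pure_map]
  | succ m ih =>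
    cases l with
    | zero =>
      rw [show (List.take 0 : List α → List α) = Function.const _ [] from funext fun _ => rfl,
        PMF.map_const, iid]
    | succ l =>
      rw [iid, iid, PMF.map_bind]
      congr 1
      funext a
      rw [PMF.map_comp, ← ih (l := l) (by omega), PMF.map_comp]
      rfl

end Iid

/-! ## The second moment method -/

section SecondMoment

variable {ρ V : Type} (sat : ρ → V → Prop) (A : Finset V)

open Classical in
/-- The number of elements of `A` that satisfy all constraints. -/
noncomputable def survivors (rows : List ρ) : ℕ := (A.filter fun x => ∀ r ∈ rows, sat r x).card

theorem survivors_pos {rows : List ρ} :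
    0 < survivors sat A rows ↔ ∃ x ∈ A, ∀ r ∈ rows, sat r x := by
  classical
  rw [survivors, Finset.card_pos]
  simp only [Finset.Nonempty, Finset.mem_filter]

theorem two_le_survivors {rows : List ρ} {x y : V} (hxy : x ≠ y) (hx : x ∈ A) (hy : y ∈ A)
    (hx' : ∀ r ∈ rows, sat r x) (hy' : ∀ r ∈ rows, sat r y) : 2 ≤ survivors sat A rows := by
  classical
  rw [survivors]
  exact Finset.one_lt_card.2
    ⟨x, Finset.mem_filter.2 ⟨hx, hx'⟩, y, Finset.mem_filter.2 ⟨hy, hy'⟩, hxy⟩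

theorem coe_survivors (rows : List ρ) :
    (survivors sat A rows : ℝ≥0∞) = ∑ x ∈ A, ind (∀ r ∈ rows, sat r x) := by
  classical
  rw [survivors, Finset.card_filter]
  push_cast
  refine Finset.sum_congr rfl fun x _ => ?_
  rw [ind]
  congr

theorem coe_survivors_sq (rows : List ρ) :
    (survivors sat A rows : ℝ≥0∞) ^ 2 =
      ∑ x ∈ A, ∑ y ∈ A, ind (∀ r ∈ rows, sat r x ∧ sat r y) := by
  rw [sq, coe_survivors, Finset.sum_mul_sum]
  refine Finset.sum_congr rfl fun x _ => Finset.sum_congr rfl fun y _ => ?_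
  rw [← ind_and]
  congr 1
  exact propext ⟨fun h r hr => ⟨h.1 r hr, h.2 r hr⟩,
    fun h => ⟨fun r hr => (h r hr).1, fun r hr => (h r hr).2⟩⟩

variable (R : PMF ρ)

theorem ex_survivors (h1 : ∀ x ∈ A, R.pr (fun r => sat r x) = 1 / 2) (l : ℕ) :
    (iid R l).ex (fun rows => (survivors sat A rows : ℝ≥0∞)) =
      ENNReal.ofReal ((A.card : ℝ) / 2 ^ l) := by
  simp only [coe_survivors]
  rw [PMF.ex_sum]
  simp only [ex_iid_forall R fun r => sat r _]
  rw [Finset.sum_congr rfl fun x hx => by rw [← PMF.ofReal_pr, h1 x hx]]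
  rw [Finset.sum_const, nsmul_eq_mul, ← ENNReal.ofReal_pow (by norm_num),
    ← ENNReal.ofReal_natCast, ← ENNReal.ofReal_mul (by positivity)]
  congr 1
  rw [one_div, inv_pow, div_eq_mul_inv]

theorem pr_survivors_pos_le (h1 : ∀ x ∈ A, R.pr (fun r => sat r x) = 1 / 2) (l : ℕ) :
    (iid R l).pr (fun rows => 0 < survivors sat A rows) ≤ (A.card : ℝ) / 2 ^ l := by
  rw [PMF.pr_le_iff _ (by positivity), ← ex_survivors sat A R h1 l]
  refine PMF.ex_mono _ fun rows => ?_
  by_cases h : 0 < survivors sat A rows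
  · rw [ind_true h]; exact_mod_cast h
  · rw [ind_false h]; exact zero_le

-- The second moment is a sum over pairs. For a far pair the hypothesis bounds each factor; for a
-- near pair the event is relaxed to satisfaction by `x` alone, of probability `2 ^ (-l)`, and each
-- `x` has at most `B` near partners.
open Classical in
theorem ex_survivors_sq_le (h1 : ∀ x ∈ A, R.pr (fun r => sat r x) = 1 / 2)
    (near : V → V → Prop) {γ : ℝ} {B : ℕ} (hγ : 0 ≤ γ)
    (hfar : ∀ x ∈ A, ∀ y ∈ A, ¬near x y → R.pr (fun r => sat r x ∧ sat r y) ≤ (1 + γ) / 4)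
    (hnear : ∀ x ∈ A, (A.filter (near x)).card ≤ B) (l : ℕ) :
    (iid R l).ex (fun rows => (survivors sat A rows : ℝ≥0∞) ^ 2) ≤
      ENNReal.ofReal ((A.card : ℝ) ^ 2 * ((1 + γ) / 4) ^ l + A.card * (B * (1 / 2) ^ l)) := by
  simp only [coe_survivors_sq]
  simp only [PMF.ex_sum, ex_iid_forall R fun r => sat r _ ∧ sat r _]
  have hx : ∀ x ∈ A, ∑ y ∈ A, (R.ex fun r => ind (sat r x ∧ sat r y)) ^ l ≤
      ENNReal.ofReal (A.card * ((1 + γ) / 4) ^ l + B * (1 / 2) ^ l) := by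
    intro x hx
    have hxy : ∀ y ∈ A, (R.ex fun r => ind (sat r x ∧ sat r y)) ^ l ≤
        ENNReal.ofReal (((1 + γ) / 4) ^ l) + ENNReal.ofReal ((1 / 2) ^ l) * ind (near x y) := by
      intro y hy
      rw [← PMF.ofReal_pr, ← ENNReal.ofReal_pow (PMF.pr_nonneg _ _)]
      by_cases h : near x y
      · rw [ind_true h, mul_one]
        refine le_trans (ENNReal.ofReal_le_ofReal ?_) le_add_self
        refine pow_le_pow_left₀ (PMF.pr_nonneg _ _) ?_ l
        rw [← h1 x hx]
        exact R.pr_mono fun r hr => hr.1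
      · refine le_trans (ENNReal.ofReal_le_ofReal ?_) le_self_add
        exact pow_le_pow_left₀ (PMF.pr_nonneg _ _) (hfar x hx y hy h) l
    refine (Finset.sum_le_sum hxy).trans ?_
    have hn : ∑ y ∈ A, ind (near x y) ≤ B := by
      have : ∑ y ∈ A, ind (near x y) = ((A.filter (near x)).card : ℝ≥0∞) := by
        rw [Finset.card_filter]
        push_cast
        exact Finset.sum_congr rfl fun y _ => by rw [ind]
      rw [this]
      exact_mod_cast hnear x hx
    rw [Finset.sum_add_distrib, Finset.sum_const, ← Finset.mul_sum, nsmul_eq_mul,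
      ENNReal.ofReal_add (by positivity) (by positivity), ENNReal.ofReal_mul (by positivity),
      ENNReal.ofReal_mul (by positivity), ENNReal.ofReal_natCast, ENNReal.ofReal_natCast,
      mul_comm (B : ℝ≥0∞)]
    gcongr
  refine (Finset.sum_le_sum hx).trans_eq ?_
  rw [Finset.sum_const, nsmul_eq_mul, ← ENNReal.ofReal_natCast, ← ENNReal.ofReal_mul (by positivity)]
  congr 1
  ring

open Classical in
/-- Concentration of the number of survivors, if the constraints are nearly pairwise independent except for
few pairs. -/
theorem pr_survivors_deviation_le (h1 : ∀ x ∈ A, R.pr (fun r => sat r x) = 1 / 2)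
    (near : V → V → Prop) {γ : ℝ} {B : ℕ} (hγ : 0 ≤ γ)
    (hfar : ∀ x ∈ A, ∀ y ∈ A, ¬near x y → R.pr (fun r => sat r x ∧ sat r y) ≤ (1 + γ) / 4)
    (hnear : ∀ x ∈ A, (A.filter (near x)).card ≤ B) (hA : 0 < A.card) (l : ℕ) {t : ℝ} (ht : 0 ≤ t) :
    (iid R l).pr (fun rows =>
      t * ((A.card : ℝ) / 2 ^ l) ≤ |(survivors sat A rows : ℝ) - (A.card : ℝ) / 2 ^ l|) * t ^ 2 ≤
      (1 + γ) ^ l - 1 + 2 ^ l * B / A.card := by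
  set m : ℝ := (A.card : ℝ) / 2 ^ l with hm
  have hm0 : 0 < m := by positivity
  set E := fun rows : List ρ => t * m ≤ |(survivors sat A rows : ℝ) - m|
  set p := (iid R l).pr E with hp
  have hp0 : 0 ≤ p := PMF.pr_nonneg _ _
  -- This is `(t m) ^ 2 * 1_E ≤ (X - m) ^ 2` with the mixed term `2 m X` moved to the left, which
  -- avoids subtraction in `[0, ∞]`. Integrated, it is Chebyshev's inequality.
  have key : (iid R l).ex (fun rows => ENNReal.ofReal ((t * m) ^ 2) * ind (E rows) +
      ENNReal.ofReal (2 * m) * (survivors sat A rows : ℝ≥0∞)) ≤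
      (iid R l).ex (fun rows => (survivors sat A rows : ℝ≥0∞) ^ 2 + ENNReal.ofReal (m ^ 2)) := by
    refine PMF.ex_mono _ fun rows => ?_
    set X := survivors sat A rows with hX
    have h2 : ENNReal.ofReal ((t * m) ^ 2) * ind (E rows) ≤ ENNReal.ofReal (((X : ℝ) - m) ^ 2) := by
      by_cases h : E rows
      · rw [ind_true h, mul_one]
        refine ENNReal.ofReal_le_ofReal ?_
        rw [← sq_abs ((X : ℝ) - m)]
        exact pow_le_pow_left₀ (by positivity) h 2
      · rw [ind_false h, mul_zero]; exact zero_le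
    refine (add_le_add_left h2 _).trans_eq ?_
    rw [← ENNReal.ofReal_natCast, ← ENNReal.ofReal_mul (by positivity),
      ← ENNReal.ofReal_pow (by positivity), ← ENNReal.ofReal_add (by positivity) (by positivity),
      ← ENNReal.ofReal_add (by positivity) (by positivity)]
    congr 1
    ring
  rw [PMF.ex_add, PMF.ex_add, PMF.ex_const, PMF.ex_mul_left, PMF.ex_mul_left,
    ex_survivors sat A R h1, ← PMF.ofReal_pr, ← hp, ← hm] at key
  have key2 := key.trans (add_le_add_left
    (ex_survivors_sq_le sat A R h1 near hγ hfar hnear l) _)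
  rw [← ENNReal.ofReal_mul (by positivity), ← ENNReal.ofReal_mul (by positivity),
    ← ENNReal.ofReal_add (by positivity) (by positivity),
    ← ENNReal.ofReal_add (by positivity) (by positivity),
    ENNReal.ofReal_le_ofReal_iff (by positivity)] at key2
  have h3 : (A.card : ℝ) ^ 2 * ((1 + γ) / 4) ^ l + A.card * (B * (1 / 2) ^ l) =
      m ^ 2 * ((1 + γ) ^ l + 2 ^ l * B / A.card) := by
    rw [hm, div_pow (1 + γ), show (4 : ℝ) = 2 ^ 2 by norm_num, ← pow_mul, div_pow 1]
    have : (0 : ℝ) < A.card := by exact_mod_cast hA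
    field_simp
    ring
  rw [h3] at key2
  have h4 : m ^ 2 * (p * t ^ 2) ≤ m ^ 2 * ((1 + γ) ^ l - 1 + 2 ^ l * B / A.card) := by nlinarith
  exact le_of_mul_le_mul_left h4 (by positivity)

end SecondMoment

/-! ## Binomial tails -/

/-- The probability that at least `j` of `m` independent trials with success probability `q`
succeed. -/
noncomputable def binTail (q : ℝ) : ℕ → ℕ → ℝ
  | _, 0 => 1
  | 0, _ + 1 => 0
  | m + 1, j + 1 => q * binTail q m j + (1 - q) * binTail q m (j + 1)

theorem binTail_zero_right (q : ℝ) (m : ℕ) : binTail q m 0 = 1 := by cases m <;> rfl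

theorem binTail_succ_le {q : ℝ} (h0 : 0 ≤ q) (h1 : q ≤ 1) (m j : ℕ) :
    binTail q m (j + 1) ≤ binTail q m j := by
  induction m generalizing j with
  | zero => cases j <;> simp [binTail]
  | succ m ih =>
    have h2 : 0 ≤ 1 - q := by linarith
    have h3 := ih j
    have h4 := ih (j + 1)
    cases j with
    | zero =>
      rw [binTail_zero_right] at h3 ⊢
      rw [binTail, binTail_zero_right]
      nlinarith
    | succ j =>
      have h5 := ih j
      rw [binTail, binTail]
      exact add_le_add (mul_le_mul_of_nonneg_left h5 h0) (mul_le_mul_of_nonneg_left h3 h2)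

theorem binTail_mono {q q' : ℝ} (h0 : 0 ≤ q) (h : q ≤ q') (h1 : q' ≤ 1) (m j : ℕ) :
    binTail q m j ≤ binTail q' m j := by
  induction m generalizing j with
  | zero => cases j <;> simp [binTail]
  | succ m ih =>
    cases j with
    | zero => simp [binTail]
    | succ j =>
      have h2 : 0 ≤ 1 - q' := by linarith
      have h3 := ih j
      have h4 := ih (j + 1)
      have h5 := binTail_succ_le h0 (h.trans h1) m j
      rw [binTail, binTail]
      nlinarith

/-- Markov's inequality for `16 ^ count`, whose expectation is `(1 + 15 q) ^ m`. For `q ≤ 1/15` and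
`j = m / 2` the resulting bound is `2 ^ (-m)`. -/
theorem binTail_le {q : ℝ} (h0 : 0 ≤ q) (h1 : q ≤ 1) (m j : ℕ) :
    binTail q m j * 16 ^ j ≤ (1 + 15 * q) ^ m := by
  induction m generalizing j with
  | zero => cases j <;> simp [binTail]
  | succ m ih =>
    cases j with
    | zero =>
      simp only [binTail, pow_zero, mul_one]
      exact one_le_pow₀ (by linarith)
    | succ j =>
      have h2 : 0 ≤ 1 - q := by linarith
      have h3 := mul_le_mul_of_nonneg_left (ih j) h0
      have h4 := mul_le_mul_of_nonneg_left (ih (j + 1)) h2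
      rw [binTail, pow_succ, pow_succ]
      rw [pow_succ] at h4
      nlinarith

theorem binTail_half (m j : ℕ) (h : j ≤ m + 1) :
    binTail (1 / 2) m j * 2 ^ m = ∑ i ∈ Finset.Ico j (m + 1), (m.choose i : ℝ) := by
  induction m generalizing j with
  | zero =>
    interval_cases j <;> simp [binTail]
  | succ m ih =>
    cases j with
    | zero =>
      rw [binTail_zero_right, one_mul, Nat.Ico_zero_eq_range]
      exact_mod_cast (Nat.sum_range_choose (m + 1)).symm
    | succ j =>
      have h1 := ih j (by omega)
      have h2 : binTail (1 / 2) m (j + 1) * 2 ^ m =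
          ∑ i ∈ Finset.Ico j (m + 1), (m.choose (i + 1) : ℝ) := by
        rw [Finset.sum_Ico_add' (fun i => (m.choose i : ℝ)) j (m + 1) 1]
        by_cases hj : j = m + 1
        · subst hj
          have : ∀ m j, m < j → binTail (1 / 2) m j = 0 := by
            intro m
            induction m with
            | zero => intro j hj; cases j with | zero => omega | succ j => rfl
            | succ m ih =>
              intro j hj
              cases j with
              | zero => omega
              | succ j => rw [binTail, ih _ (by omega), ih _ (by omega)]; ring
          rw [this _ _ (by omega)]
          simp
        · rw [ih (j + 1) (by omega),
            Finset.sum_Ico_succ_top (show j + 1 ≤ m + 1 by omega) fun i => (m.choose i : ℝ)]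
          simp
      rw [binTail, ← Finset.sum_Ico_add' (fun i => ((m + 1).choose i : ℝ)) j (m + 1) 1, pow_succ]
      simp only [Nat.choose_succ_succ, Nat.cast_add, Finset.sum_add_distrib]
      rw [← h1, ← h2]
      ring

/-- Successive values of `centralBinom n / 4 ^ n` have ratio `(2 n + 1) / (2 n + 2)`, which is less
than 1; at `n = 4` the value is `70 / 256`. -/
theorem centralBinom_le (n : ℕ) (h : 4 ≤ n) : n.centralBinom * 256 ≤ 70 * 4 ^ n := by
  induction n, h using Nat.le_induction with
  | base => decide
  | succ n hn ih =>
    have h1 := Nat.succ_mul_centralBinom_succ n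
    have h2 : (n + 1) * ((n + 1).centralBinom * 256) ≤ (n + 1) * (70 * 4 ^ (n + 1)) := by
      calc (n + 1) * ((n + 1).centralBinom * 256) = 2 * (2 * n + 1) * (n.centralBinom * 256) := by
            rw [← mul_assoc, h1]; ring
        _ ≤ 2 * (2 * n + 1) * (70 * 4 ^ n) := by gcongr
        _ ≤ 2 * (2 * n + 2) * (70 * 4 ^ n) := by gcongr; omega
        _ = _ := by rw [pow_succ]; ring
    exact Nat.le_of_mul_le_mul_left h2 (by omega)

/-- By symmetry a strict majority has half of the probability outside the central term, which is at
least `(1 - 70 / 256) / 2`. -/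
theorem binTail_half_majority (m : ℕ) (hm : 4 ≤ m) :
    93 / 256 ≤ binTail (1 / 2) (2 * m) (m + 1) := by
  have h1 := binTail_half (2 * m) (m + 1) (by omega)
  have h2 : ∑ i ∈ Finset.Ico (m + 1) (2 * m + 1), ((2 * m).choose i : ℝ) =
      ∑ i ∈ Finset.range m, ((2 * m).choose i : ℝ) := by
    rw [Finset.sum_Ico_eq_sum_range, show 2 * m + 1 - (m + 1) = m by omega,
      ← Finset.sum_range_reflect]
    refine Finset.sum_congr rfl fun i hi => ?_
    rw [Finset.mem_range] at hi
    rw [← Nat.choose_symm (by omega)]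
    congr 2
    omega
  have h3 : ∑ i ∈ Finset.range m, ((2 * m).choose i : ℝ) + ((2 * m).choose m : ℝ) +
      ∑ i ∈ Finset.Ico (m + 1) (2 * m + 1), ((2 * m).choose i : ℝ) = 2 ^ (2 * m) := by
    rw [← Finset.sum_range_succ, Finset.sum_range_add_sum_Ico _ (by omega)]
    exact_mod_cast Nat.sum_range_choose (2 * m)
  have h4 : ((2 * m).choose m : ℝ) * 256 ≤ 70 * 4 ^ m := by
    have := centralBinom_le m hm
    rw [Nat.centralBinom] at this
    exact_mod_cast this
  have h5 : (2 : ℝ) ^ (2 * m) = 4 ^ m := by rw [pow_mul]; norm_num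
  have h6 : (0 : ℝ) < 4 ^ m := by positivity
  rw [h5] at h1 h3
  nlinarith

theorem pr_iid_count (μ : PMF Bool) (m j : ℕ) :
    (iid μ m).pr (fun as => j ≤ as.count true) = binTail (μ.pr fun a => a = true) m j := by
  induction m generalizing j with
  | zero =>
    classical
    rw [iid, PMF.pr_pure]
    cases j <;> simp [binTail]
  | succ m ih =>
    cases j with
    | zero => rw [binTail]; exact PMF.pr_eq_one _ fun _ _ => Nat.zero_le _
    | succ j =>
      rw [iid, binTail, ← ih, ← ih]
      refine PMF.pr_bind_of_two _ (P := fun a => a = true) ?_ ?_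
      · rintro a - rfl
        rw [PMF.pr_map]
        simp
      · rintro a - ha
        rw [PMF.pr_map]
        simp [ha]

/-! ## The loop of ACOUNT -/

section Loop

variable {n : ℕ} (D : PMF (Finset (Fin n))) (k : ℕ) (F : CNF n)

/-- The probability that the majority of the repetitions records unsatisfiability. -/
noncomputable def majority (l : ℕ) : ℝ :=
  (iid (acountTrial D k F l) (8 * Nat.clog 2 n)).pr fun recorded =>
    4 * Nat.clog 2 n < recorded.count true

/-- The output can be bad only if the loop stops before `l₀`, or reaches `l₁` and does not stop
there. Stopping anywhere between is harmless, so no estimate for those levels is needed. -/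
theorem pr_acountLoop_le {good : ℕ → Prop} {l₀ l₁ : ℕ} (hl : l₀ ≤ l₁)
    (hgood : ∀ l, l₀ ≤ l → l ≤ l₁ → good (2 ^ (l - 1))) (fuel l : ℕ) (h1 : l ≤ l₁)
    (h2 : l₁ < l + fuel) :
    (acountLoop D k F fuel l).pr (fun a => ¬good a) ≤
      ∑ j ∈ Finset.Ico l l₀, majority D k F j + (1 - majority D k F l₁) := by
  classical
  induction fuel generalizing l with
  | zero => omega
  | succ fuel ih =>
    rw [acountLoop, PMF.pr_bind_of_two _ (A := (PMF.pure (2 ^ (l - 1))).pr fun a => ¬good a)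
      (B := (acountLoop D k F fuel (l + 1)).pr fun a => ¬good a)
      (P := fun recorded : List Bool => 4 * Nat.clog 2 n < recorded.count true)
      (fun a _ h => by rw [if_pos h]) (fun a _ h => by rw [if_neg h]), ← majority, PMF.pr_pure]
    have hm : ∀ l, 0 ≤ majority D k F l ∧ majority D k F l ≤ 1 := fun l =>
      ⟨PMF.pr_nonneg _ _, PMF.pr_le_one _ _⟩
    have hsum : ∀ l, 0 ≤ ∑ j ∈ Finset.Ico l l₀, majority D k F j := fun l =>
      Finset.sum_nonneg fun j _ => (hm j).1
    have hB0 := PMF.pr_nonneg (acountLoop D k F fuel (l + 1)) fun a => ¬good a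
    have hB1 := PMF.pr_le_one (acountLoop D k F fuel (l + 1)) fun a => ¬good a
    obtain ⟨hml0, hml1⟩ := hm l
    have hs := hsum l
    rcases h1.lt_or_eq with h1 | rfl
    · have hih := ih (l + 1) h1 (by omega)
      by_cases h0 : l₀ ≤ l
      · rw [if_neg (not_not.2 (hgood l h0 h1.le))]
        rw [Finset.Ico_eq_empty (by omega), Finset.sum_empty] at hih ⊢
        nlinarith
      · rw [Finset.sum_eq_sum_Ico_succ_bot (by omega)]
        split_ifs <;> nlinarith
    · rw [if_neg (not_not.2 (hgood l hl le_rfl))]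
      nlinarith

/-- With `L = ⌈log₂ n⌉`, a premature vote has probability at most `256 ^ (-L)`, and there are at
most `n ≤ 2 ^ L` levels below `l₀`, for a total of at most `1 / 128`. The vote at `l₁` succeeds with
probability at least `93 / 256`, and the difference exceeds `1 / 4`. -/
theorem quarter_le_pr_acountLoop {good : ℕ → Prop} {l₀ l₁ : ℕ} (hn : 2 ≤ n) (hl : l₀ ≤ l₁)
    (hl1 : 1 ≤ l₁) (hln : l₁ ≤ n + 1) (hgood : ∀ l, l₀ ≤ l → l ≤ l₁ → good (2 ^ (l - 1)))
    (hbad : ∀ l, 1 ≤ l → l < l₀ → (acountTrial D k F l).pr (fun a => a = true) ≤ 1 / 15)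
    (hhalf : 1 / 2 ≤ (acountTrial D k F l₁).pr fun a => a = true) :
    1 / 4 ≤ (acountLoop D k F (n + 1) 1).pr good := by
  set L := Nat.clog 2 n with hL
  have hL1 : 1 ≤ L := Nat.clog_pos (by norm_num) hn
  have hmaj : ∀ l, majority D k F l = binTail ((acountTrial D k F l).pr fun a => a = true) (8 * L)
      (4 * L + 1) := fun l => by rw [← pr_iid_count]; rfl
  have h1 : 93 / 256 ≤ majority D k F l₁ := by
    rw [hmaj]
    refine le_trans ?_ (binTail_mono (by norm_num) hhalf (PMF.pr_le_one _ _) _ _)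
    have := binTail_half_majority (4 * L) (by omega)
    rwa [show 2 * (4 * L) = 8 * L by ring] at this
  have h2 : ∀ l ∈ Finset.Ico 1 l₀, majority D k F l ≤ 1 / 256 ^ L := by
    intro l hl
    rw [Finset.mem_Ico] at hl
    have h0 := PMF.pr_nonneg (acountTrial D k F l) fun a => a = true
    have h3 := binTail_le h0 (PMF.pr_le_one _ _) (8 * L) (4 * L)
    have h4 : (1 + 15 * (acountTrial D k F l).pr fun a => a = true) ^ (8 * L) ≤ 2 ^ (8 * L) :=
      pow_le_pow_left₀ (by positivity) (by linarith [hbad l hl.1 hl.2]) _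
    have h5 := binTail_succ_le h0 (PMF.pr_le_one _ _) (8 * L) (4 * L)
    rw [hmaj, le_div_iff₀ (by positivity)]
    have h6 : (16 : ℝ) ^ (4 * L) = 256 ^ L * 256 ^ L := by
      rw [← mul_pow, pow_mul]; norm_num
    have h7 : (2 : ℝ) ^ (8 * L) = 256 ^ L := by rw [pow_mul]; norm_num
    rw [h6] at h3
    rw [h7] at h4
    have h8 : (0 : ℝ) < 256 ^ L := by positivity
    have h9 := h3.trans h4
    nlinarith
  have h3 : ∑ j ∈ Finset.Ico 1 l₀, majority D k F j ≤ 1 / 128 := by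
    refine (Finset.sum_le_sum h2).trans ?_
    rw [Finset.sum_const, Nat.card_Ico, nsmul_eq_mul, mul_one_div, div_le_div_iff₀ (by positivity)
      (by norm_num)]
    have h4 : n ≤ 2 ^ L := Nat.le_pow_clog (by norm_num) n
    have h5 : l₀ - 1 ≤ 2 ^ L := by omega
    have h6 : 128 * 2 ^ L ≤ 256 ^ L := by
      calc 128 * 2 ^ L ≤ 128 ^ L * 2 ^ L := by gcongr; exact Nat.le_self_pow (by omega) _
        _ = 256 ^ L := by rw [← mul_pow]; norm_num
    have h7 : (l₀ - 1) * 128 ≤ 256 ^ L := by nlinarith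
    rw [one_mul]
    exact_mod_cast h7
  have h4 := pr_acountLoop_le D k F hl hgood (n + 1) 1 hl1 (by omega)
  rw [PMF.pr_not] at h4
  linarith

end Loop

/-! ## Random parity constraints -/

section Rows

variable {σ V : Type} (D : PMF σ) (pa : σ → V → Bool)

/-- The parity constraint given by a row is satisfied. -/
def RowSat (r : σ × Bool) (x : V) : Prop := pa r.1 x = r.2

theorem pr_rowSat (x : V) : (rowLaw D).pr (fun r => RowSat pa r x) = 1 / 2 := by
  have : ∀ S, (fairCoin.map fun b => (S, b)).ex (fun r => ind (RowSat pa r x)) = 2⁻¹ := by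
    intro S
    rw [PMF.ex_map, ex_fairCoin]
    simp only [RowSat]
    cases pa S x <;> simp [ind]
  rw [PMF.pr_eq, rowLaw, PMF.ex_bind]
  simp only [this, PMF.ex_const]
  simp

theorem pr_rowSat_and (x y : V) : (rowLaw D).pr (fun r => RowSat pa r x ∧ RowSat pa r y) =
    D.pr (fun S => pa S x = pa S y) / 2 := by
  have : ∀ S, (fairCoin.map fun b => (S, b)).ex (fun r => ind (RowSat pa r x ∧ RowSat pa r y)) =
      2⁻¹ * ind (pa S x = pa S y) := by
    intro S
    rw [PMF.ex_map, ex_fairCoin]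
    simp only [RowSat]
    cases pa S x <;> cases pa S y <;> simp [ind]
  rw [PMF.pr_eq, rowLaw, PMF.ex_bind]
  simp only [this, PMF.ex_mul_left]
  rw [ENNReal.toReal_mul, ← PMF.pr_eq]
  simp
  ring

/-- Whatever the sets are, each right-hand side agrees with the parity of `x` with probability 1/2.
So the event that `x` solves the system is independent of the sets. -/
theorem ex_iid_rowLaw (x : V) (l : ℕ) (f : List σ → ℝ≥0∞) :
    (iid (rowLaw D) l).ex (fun rows => f (rows.map Prod.fst) * ind (∀ r ∈ rows, RowSat pa r x)) =
      2⁻¹ ^ l * (iid D l).ex f := by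
  induction l generalizing f with
  | zero => simp [iid, PMF.ex_pure, ind]
  | succ l ih =>
    rw [ex_iid_succ, ex_iid_succ, rowLaw, PMF.ex_bind, ← PMF.ex_mul_left]
    refine D.ex_congr fun S _ => ?_
    rw [PMF.ex_map, ex_fairCoin]
    have : ∀ b, (iid (rowLaw D) l).ex (fun rows => f (((S, b) :: rows).map Prod.fst) *
        ind (∀ r ∈ (S, b) :: rows, RowSat pa r x)) =
        ind (pa S x = b) * (2⁻¹ ^ l * (iid D l).ex fun as => f (S :: as)) := by
      intro b
      rw [← ih, ← PMF.ex_mul_left]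
      refine PMF.ex_congr _ fun rows _ => ?_
      rw [List.forall_mem_cons, ind_and, List.map_cons, RowSat]
      ring
    rw [← rowLaw, this, this, ← add_mul, pow_succ]
    cases pa S x <;> simp [ind] <;> ring

end Rows

/-! ## Parities of sums -/

theorem par_xor {n : ℕ} (js : List (Fin n)) (x y : Fin n → Bool) :
    par js (fun j => x j ^^ y j) = (par js x ^^ par js y) := by
  induction js using List.reverseRecOn with
  | nil => rfl
  | append_singleton js j ih =>
    simp only [par, List.foldl_concat] at ih ⊢
    rw [ih]
    generalize List.foldl (fun b j => b ^^ x j) false js = a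
    generalize List.foldl (fun b j => b ^^ y j) false js = b
    cases a <;> cases b <;> cases x j <;> cases y j <;> rfl

theorem parF_eq_par {n : ℕ} (S : Finset (Fin n)) (x : Fin n → Bool) : parF S x = par S.toList x := by
  rw [Finset.par_toList S S.toList S.nodup_toList S.toList_toFinset, parF]

theorem parF_xor {n : ℕ} (S : Finset (Fin n)) (x y : Fin n → Bool) :
    parF S (fun j => x j ^^ y j) = (parF S x ^^ parF S y) := by
  simp only [parF_eq_par, par_xor]

/-- The sign of the parity of `z` on `S`. -/
theorem prod_sign {n : ℕ} (S : Finset (Fin n)) (z : Fin n → Bool) :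
    ∏ j ∈ S, (if z j = true then (-1 : ℝ) else 1) = if parF S z = true then -1 else 1 := by
  rw [Finset.prod_ite, Finset.prod_const, Finset.prod_const_one, mul_one, parF]
  rcases Nat.even_or_odd (S.filter fun j => z j = true).card with h | h
  · rw [h.neg_one_pow, if_neg]
    rw [decide_eq_true_eq, Nat.even_iff.1 h]
    omega
  · rw [h.neg_one_pow, if_pos]
    rw [decide_eq_true_eq, Nat.odd_iff.1 h]

/-! ### Probabilities of parities from expected signs -/

namespace PMF

variable {α : Type} [Fintype α] (μ : PMF α)

open Classical in
theorem pr_eq_sum (E : α → Prop) : μ.pr E = ∑ a, if E a then (μ a).toReal else 0 := by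
  rw [pr_eq, ex, tsum_fintype, ENNReal.toReal_sum]
  · refine Finset.sum_congr rfl fun a _ => ?_
    by_cases h : E a <;> simp [ind, h]
  · intro a _
    exact ENNReal.mul_ne_top (μ.apply_ne_top a) (ne_top_of_le_ne_top ENNReal.one_ne_top
      (ind_le_one _))

theorem sum_toReal : ∑ a, (μ a).toReal = 1 := by
  classical
  have h := μ.pr_eq_sum fun _ => True
  rw [μ.pr_eq_one fun _ _ => trivial] at h
  simpa using h.symm

/-- The probability that a sign is `1`, by its expectation. -/
theorem pr_of_sign (P : α → Bool) {β : ℝ}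
    (h : ∑ a, (μ a).toReal * (if P a = true then (-1 : ℝ) else 1) = β) :
    μ.pr (fun a => P a = false) = (1 + β) / 2 := by
  classical
  have h' : (1 + β) / 2 = ∑ a, ((μ a).toReal + (μ a).toReal * if P a = true then (-1 : ℝ) else 1) / 2 := by
    rw [← Finset.sum_div, Finset.sum_add_distrib, μ.sum_toReal, h]
  rw [pr_eq_sum, h']
  refine Finset.sum_congr rfl fun a _ => ?_
  cases P a <;> simp

end PMF

/-! ## Sums over assignments -/

/-- The Hamming weight. -/
def weight {n : ℕ} (z : Fin n → Bool) : ℕ := (Finset.univ.filter fun j => z j = true).card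

theorem weight_le {n : ℕ} (z : Fin n → Bool) : weight z ≤ n := by
  simpa [weight] using Finset.card_le_univ (Finset.univ.filter fun j => z j = true)

theorem prod_weight {n : ℕ} (z : Fin n → Bool) (a b : ℝ) :
    ∏ j, (if z j = true then a else b) = a ^ weight z * b ^ (n - weight z) := by
  rw [Finset.prod_ite, Finset.prod_const, Finset.prod_const, weight, Finset.filter_not,
    Finset.card_sdiff_of_subset (Finset.filter_subset _ _), Finset.card_univ, Fintype.card_fin]

theorem sum_prod_weight (n : ℕ) (a b : ℝ) :
    ∑ z : Fin n → Bool, a ^ weight z * b ^ (n - weight z) = (a + b) ^ n := by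
  simp only [← prod_weight]
  have := Finset.prod_univ_sum (fun _ : Fin n => (Finset.univ : Finset Bool))
    (fun _ v => if v = true then a else b)
  simp only [Fintype.sum_bool, if_true, Finset.prod_const, Finset.card_univ,
    Fintype.card_fin, Fintype.piFinset_univ, Bool.false_eq_true, if_false] at this
  exact this.symm

-- A vector of the ball contributes at least `t ^ D` to the generating function `∑ t ^ weight = (1 +
-- t) ^ n`, because `t ≤ 1`.
open Classical in
theorem card_ball_le (n : ℕ) {t D : ℝ} (ht : 0 < t) (ht1 : t ≤ 1) :
    ((Finset.univ.filter fun z : Fin n → Bool => (weight z : ℝ) < D).card : ℝ) * t ^ D ≤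
      (1 + t) ^ n := by
  have h := sum_prod_weight n t 1
  rw [add_comm 1 t, ← h, ← nsmul_eq_mul, ← Finset.sum_const]
  refine (Finset.sum_le_sum fun z hz => ?_).trans
    (Finset.sum_le_sum_of_subset_of_nonneg (Finset.filter_subset _ _) fun z _ _ => by positivity)
  rw [Finset.mem_filter] at hz
  rw [one_pow, mul_one, ← Real.rpow_natCast]
  exact Real.rpow_le_rpow_of_exponent_ge ht ht1 hz.2.le

/-! ## The trials of ACOUNT -/

/-- The set of satisfying assignments. -/
def CNF.sols {n : ℕ} (F : CNF n) : Finset (Fin n → Bool) :=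
  Finset.univ.filter fun x => F.eval x = true

theorem CNF.card_sols {n : ℕ} (F : CNF n) : F.sols.card = F.numSols := rfl

/-- Concentration of the number of solutions of random parity constraints. -/
theorem pr_survivors_deviation_le_of_xor {n : ℕ} {σ : Type} (D : PMF σ) {pa : σ → (Fin n → Bool) → Bool}
    (hpa : ∀ S x y, pa S (fun j => x j ^^ y j) = (pa S x ^^ pa S y)) (F : CNF n)
    (N : (Fin n → Bool) → Prop) [DecidablePred N] {γ : ℝ} {B : ℕ}
    (hγ : 0 ≤ γ) (hfar : ∀ z, ¬N z → D.pr (fun S => pa S z = false) ≤ (1 + γ) / 2)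
    (hnear : (Finset.univ.filter N).card ≤ B) (hF : 0 < F.numSols) (l : ℕ) {t : ℝ} (ht : 0 ≤ t) :
    (iid (rowLaw D) l).pr (fun rows => t * ((F.numSols : ℝ) / 2 ^ l) ≤
      |(survivors (RowSat pa) F.sols rows : ℝ) - (F.numSols : ℝ) / 2 ^ l|) * t ^ 2 ≤
      (1 + γ) ^ l - 1 + 2 ^ l * B / F.numSols := by
  classical
  -- Parities are additive, so only the difference of two solutions matters. Since `y ↦ x ⊕ y` is
  -- injective, `B` exceptional differences leave at most `B` near partners of `x`.
  refine pr_survivors_deviation_le (RowSat pa) F.sols (rowLaw D)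
    (fun x _ => pr_rowSat D pa x) (fun x y => N fun j => x j ^^ y j) hγ (B := B) ?_ ?_ hF l ht
  · intro x _ y _ hxy
    have h := hfar _ hxy
    simp only [hpa] at h
    rw [pr_rowSat_and]
    have : D.pr (fun S => pa S x = pa S y) = D.pr fun S => (pa S x ^^ pa S y) = false :=
      D.pr_congr fun S _ => by cases pa S x <;> cases pa S y <;> simp
    rw [this]
    linarith
  · intro x _
    refine le_trans ?_ hnear
    refine Finset.card_le_card_of_injOn (fun y j => x j ^^ y j) ?_ ?_
    · intro y hy
      simp only [Finset.coe_filter, Set.mem_ofPred_eq] at hy ⊢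
      exact ⟨Finset.mem_univ _, hy.2⟩
    · intro y _ y' _ h
      funext j
      have := congrFun h j
      simpa using this

section Trial

variable {n : ℕ} (D : PMF (Finset (Fin n))) (k : ℕ) (F : CNF n)

theorem isSat_append_hashCNF (rows : List (Finset (Fin n) × Bool)) :
    (F ++ CNF.hashCNF rows).isSat = true ↔ 0 < survivors (RowSat parF) F.sols rows := by
  rw [CNF.isSat, decide_eq_true_iff, survivors_pos]
  simp only [CNF.eval_append, CNF.eval_hashCNF, Finset.mem_filter, CNF.sols,
    Finset.mem_univ, true_and, Bool.and_eq_true, List.all_eq_true, beq_iff_eq, RowSat]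

theorem pr_acountTrial (l : ℕ) : (acountTrial D k F l).pr (fun a => a = true) =
    (iid (rowLaw D) l).pr fun rows =>
      (∀ r ∈ rows, r.1.card ≤ k) ∧ ¬0 < survivors (RowSat parF) F.sols rows := by
  rw [acountTrial, PMF.pr_map]
  refine PMF.pr_congr _ fun rows _ => ?_
  rw [← isSat_append_hashCNF]
  split_ifs with h
  · simp only [Bool.not_eq_true', and_iff_right h, Bool.not_eq_true]
  · simp only [h, false_and]

/-- Recorded unsatisfiability means that no solution survives, which is a deviation by the whole
mean: Chebyshev's inequality with `t = 1`. -/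
theorem pr_acountTrial_le (N : (Fin n → Bool) → Prop) [DecidablePred N] {γ : ℝ} {B : ℕ}
    (hγ : 0 ≤ γ) (hfar : ∀ z, ¬N z → D.pr (fun S => parF S z = false) ≤ (1 + γ) / 2)
    (hnear : (Finset.univ.filter N).card ≤ B) (hF : 0 < F.numSols) (l : ℕ) :
    (acountTrial D k F l).pr (fun a => a = true) ≤ (1 + γ) ^ l - 1 + 2 ^ l * B / F.numSols := by
  have h := pr_survivors_deviation_le_of_xor D parF_xor F N hγ hfar hnear hF l zero_le_one
  rw [one_pow, mul_one] at h
  refine le_trans ?_ h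
  rw [pr_acountTrial]
  refine PMF.pr_mono _ fun rows hrows => ?_
  have h0 : survivors (RowSat parF) F.sols rows = 0 := by omega
  rw [h0, Nat.cast_zero, zero_sub, abs_neg, one_mul]
  exact le_abs_self _

/-- Unsatisfiability goes unrecorded only if some set is too large or some solution survives. -/
theorem le_pr_acountTrial (l : ℕ) :
    1 - (iid (rowLaw D) l).pr (fun rows => 0 < survivors (RowSat parF) F.sols rows) -
      l * D.pr (fun S => k < S.card) ≤ (acountTrial D k F l).pr fun a => a = true := by
  rw [pr_acountTrial]
  have h1 := pr_iid_exists_le (rowLaw D) (fun r => k < r.1.card) l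
  have h2 : (rowLaw D).pr (fun r => k < r.1.card) = D.pr fun S => k < S.card := by
    rw [PMF.pr_eq, PMF.pr_eq, rowLaw, PMF.ex_bind]
    simp only [PMF.ex_map, PMF.ex_const]
  rw [h2] at h1
  have h3 := (iid (rowLaw D) l).pr_or_le (fun rows => ∃ r ∈ rows, k < r.1.card)
    (fun rows => 0 < survivors (RowSat parF) F.sols rows)
  have h4 := (iid (rowLaw D) l).pr_not fun rows =>
      (∀ r ∈ rows, r.1.card ≤ k) ∧ ¬0 < survivors (RowSat parF) F.sols rows
  have h5 : ((iid (rowLaw D) l).pr fun rows =>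
      ¬((∀ r ∈ rows, r.1.card ≤ k) ∧ ¬0 < survivors (RowSat parF) F.sols rows)) ≤
      (iid (rowLaw D) l).pr fun rows => (∃ r ∈ rows, k < r.1.card) ∨
        0 < survivors (RowSat parF) F.sols rows := by
    refine PMF.pr_mono _ fun rows h => ?_
    rw [not_and_or, not_not] at h
    refine h.imp_left fun h => ?_
    push Not at h
    exact h
  linarith

end Trial

/-! ## Systems with more equations than variables -/

section Overdetermined

/-- Pigeonhole principle: two of the `2 ^ n` assignments share one of the `2 ^ m` vectors of
parities, and their difference lies in the kernel. -/
theorem exists_ne_zero_of_parF {n m : ℕ} (h : m < n) (Ss : List (Finset (Fin n))) (hS : Ss.length = m) :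
    ∃ z : Fin n → Bool, (∃ j, z j = true) ∧ ∀ S ∈ Ss, parF S z = false := by
  obtain ⟨x, y, hxy, h⟩ := Fintype.exists_ne_map_eq_of_card_lt
    (fun (x : Fin n → Bool) (i : Fin m) => parF (Ss.get (i.cast hS.symm)) x) (by
      simp only [Fintype.card_fun, Fintype.card_bool, Fintype.card_fin]
      exact Nat.pow_lt_pow_right (by norm_num) h)
  refine ⟨fun j => x j ^^ y j, ?_, fun S hS' => ?_⟩
  · by_contra! h0
    exact hxy (funext fun j => by simpa using h0 j)
  · obtain ⟨i, rfl⟩ := List.mem_iff_get.1 hS'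
    rw [parF_xor]
    have := congrFun h (i.cast hS)
    simp only [Fin.cast_cast, Fin.cast_eq_self] at this
    rw [this, Bool.xor_self]

/-- A random system of `n + 1` sparse equations in `n` variables is unsolvable with probability
bounded away from `1/2`. -/
theorem pr_survivors_overdetermined {n : ℕ} (hn : 1 ≤ n) (D : PMF (Finset (Fin n)))
    (hD : ∀ z, 1 / 2 ≤ D.pr fun S => parF S z = false) (A : Finset (Fin n → Bool)) :
    (iid (rowLaw D) (n + 1)).pr (fun rows => 0 < survivors (RowSat parF) A rows) ≤ 7 / 16 := by
  classical
  obtain ⟨m, rfl⟩ : ∃ m, n = m + 1 := ⟨n - 1, by omega⟩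
  have hex : ∀ Ss : List (Finset (Fin (m + 1))), ∃ z : Fin (m + 1) → Bool, Ss.length = m →
      (∃ j, z j = true) ∧ ∀ S ∈ Ss, parF S z = false := by
    intro Ss
    by_cases h : Ss.length = m
    · obtain ⟨z, hz⟩ := exists_ne_zero_of_parF (Nat.lt_succ_self m) Ss h
      exact ⟨z, fun _ => hz⟩
    · exact ⟨fun _ => false, fun h' => absurd h' h⟩
  choose Z hZ using hex
  set K : List (Finset (Fin (m + 1))) → Prop := fun Ss => ∀ S ∈ Ss, parF S (Z (Ss.drop 2)) = false
  -- `Z` is a nonzero kernel vector chosen as a function of the last `m` sets only. Given these,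
  -- each of the first two parities vanishes on it independently with probability at least 1/2.
  have hK : 1 / 4 ≤ (iid D (m + 2)).pr K := by
    have h1 : ENNReal.ofReal (1 / 4) ≤ (iid D (m + 2)).ex fun Ss => ind (K Ss) := by
      rw [ex_iid_succ]
      simp only [ex_iid_succ]
      have h2 : ∀ a b, ((iid D m).ex fun as => ind (K (a :: b :: as))) =
          (iid D m).ex fun as => ind (parF a (Z as) = false) * ind (parF b (Z as) = false) := by
        intro a b
        refine PMF.ex_congr _ fun as has => ?_
        rw [← ind_and]
        congr 1
        have h := (hZ as (length_of_mem_support_iid has)).2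
        refine propext ⟨fun h => ?_, fun h' => ?_⟩
        · exact ⟨h a (by simp), h b (by simp)⟩
        · intro S hS
          rcases List.mem_cons.1 hS with rfl | hS
          · exact h'.1
          · rcases List.mem_cons.1 hS with rfl | hS
            · exact h'.2
            · exact h S hS
      simp only [h2]
      simp only [PMF.ex_comm D (iid D m), PMF.ex_mul_left, PMF.ex_mul_right]
      rw [← (iid D m).ex_const (ENNReal.ofReal (1 / 4))]
      refine PMF.ex_mono _ fun as => ?_
      rw [← PMF.ofReal_pr, ← ENNReal.ofReal_mul (PMF.pr_nonneg _ _)]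
      refine ENNReal.ofReal_le_ofReal ?_
      have := hD (Z as)
      nlinarith
    rw [← PMF.ofReal_pr, ENNReal.ofReal_le_ofReal_iff (PMF.pr_nonneg _ _)] at h1
    exact h1
  -- The expected number of solutions in the whole cube is `2 ^ (m + 1) / 2 ^ (m + 2)`, whatever the
  -- sets are.
  have hY : ∀ f : List (Finset (Fin (m + 1))) → ℝ≥0∞, (iid (rowLaw D) (m + 2)).ex (fun rows =>
      f (rows.map Prod.fst) * (survivors (RowSat parF) Finset.univ rows : ℝ≥0∞)) =
      2⁻¹ * (iid D (m + 2)).ex f := by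
    intro f
    simp only [coe_survivors, Finset.mul_sum]
    rw [PMF.ex_sum]
    simp only [ex_iid_rowLaw]
    rw [Finset.sum_const, nsmul_eq_mul, ← mul_assoc]
    congr 1
    simp only [Finset.card_univ, Fintype.card_fun, Fintype.card_bool, Fintype.card_fin]
    push_cast
    rw [pow_succ (2⁻¹ : ℝ≥0∞), ← mul_assoc, ← mul_pow,
      ENNReal.mul_inv_cancel (by norm_num) (by norm_num), one_pow, one_mul]
  -- Under `K` the solutions are closed under adding a nonzero vector, so if there is one there are
  -- two, and the count may be halved; otherwise a single solution suffices. Taking expectations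
  -- gives `1/2 * (1/2 + 3/4 * 1/2) = 7/16`.
  have hpt : ∀ rows ∈ (iid (rowLaw D) (m + 2)).support,
      ind (0 < survivors (RowSat parF) A rows) ≤
      2⁻¹ * (1 * (survivors (RowSat parF) Finset.univ rows : ℝ≥0∞) +
        ind (¬K (rows.map Prod.fst)) * (survivors (RowSat parF) Finset.univ rows : ℝ≥0∞)) := by
    intro rows hrows
    have hlen : ((rows.map Prod.fst).drop 2).length = m := by
      rw [List.length_drop, List.length_map, length_of_mem_support_iid hrows]
      omega
    by_cases hA : 0 < survivors (RowSat parF) A rows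
    swap
    · rw [ind_false hA]; exact zero_le
    rw [ind_true hA, one_mul]
    obtain ⟨x, -, hx'⟩ := (survivors_pos _ _).1 hA
    have h2 : ∀ c : ℝ≥0∞, 2 ≤ c → 1 ≤ 2⁻¹ * c := by
      intro c hc
      calc (1 : ℝ≥0∞) = 2⁻¹ * 2 := (ENNReal.inv_mul_cancel (by norm_num) (by norm_num)).symm
        _ ≤ _ := by gcongr
    by_cases h : K (rows.map Prod.fst)
    · rw [ind_false (not_not.2 h), zero_mul, add_zero]
      apply h2
      obtain ⟨⟨j, hj⟩, -⟩ := hZ _ hlen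
      set z := Z ((rows.map Prod.fst).drop 2)
      have : 2 ≤ survivors (RowSat parF) Finset.univ rows := by
        refine two_le_survivors _ _ (x := x) (y := fun j => x j ^^ z j) ?_ (Finset.mem_univ _)
          (Finset.mem_univ _) hx' fun r hr => ?_
        · intro h0
          have := congrFun h0 j
          rw [hj] at this
          simp at this
        · have h1 := hx' r hr
          have h3 := h r.1 (List.mem_map_of_mem hr)
          rw [RowSat] at h1 ⊢
          rw [parF_xor, h1, h3, Bool.xor_false]
      exact_mod_cast this
    · rw [ind_true h, one_mul]
      apply h2
      have : 1 ≤ survivors (RowSat parF) Finset.univ rows :=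
        (survivors_pos _ _).2 ⟨x, Finset.mem_univ _, hx'⟩
      have : (1 : ℝ≥0∞) ≤ survivors (RowSat parF) Finset.univ rows := by exact_mod_cast this
      calc (2 : ℝ≥0∞) = 1 + 1 := by norm_num
        _ ≤ _ := add_le_add this this
  rw [PMF.pr_le_iff _ (by norm_num)]
  refine (PMF.ex_mono_support _ hpt).trans ?_
  rw [PMF.ex_mul_left, PMF.ex_add, hY fun _ => 1, hY fun Ss => ind (¬K Ss), PMF.ex_const,
    ← PMF.ofReal_pr, PMF.pr_not]
  have h3 : (2⁻¹ : ℝ≥0∞) = ENNReal.ofReal (1 / 2) := by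
    rw [one_div, ENNReal.ofReal_inv_of_pos (by norm_num)]; simp
  have h4 := PMF.pr_le_one (iid D (m + 2)) K
  rw [h3, mul_one, ← ENNReal.ofReal_mul (by norm_num), ← ENNReal.ofReal_add (by norm_num)
    (by linarith), ← ENNReal.ofReal_mul (by norm_num)]
  refine ENNReal.ofReal_le_ofReal ?_
  linarith

end Overdetermined

/-! ## Bernoulli subsets -/

section Bernoulli

variable {n : ℕ} {p : ℝ≥0} (hp : p ≤ 1)

theorem sum_bernoulliSubset (ε : Fin n → ℝ) :
    ∑ S, (bernoulliSubset n p hp S).toReal * ∏ j ∈ S, ε j = ∏ j, (ε j * p + (1 - p)) := by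
  rw [Finset.prod_add, Finset.powerset_univ]
  refine Finset.sum_congr rfl fun S _ => ?_
  rw [bernoulliSubset, PMF.ofFintype_apply, ENNReal.toReal_mul, ENNReal.toReal_pow,
    ENNReal.toReal_pow, ENNReal.coe_toReal, ENNReal.coe_toReal, NNReal.coe_sub hp, Finset.prod_const,
    Finset.prod_mul_distrib, Finset.prod_const, Finset.card_sdiff_of_subset (Finset.subset_univ S),
    Finset.card_univ, Fintype.card_fin, NNReal.coe_one]
  ring

theorem pr_bernoulliSubset_parF (z : Fin n → Bool) :
    (bernoulliSubset n p hp).pr (fun S => parF S z = false) = (1 + (1 - 2 * p) ^ weight z) / 2 := by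
  refine PMF.pr_of_sign _ (fun S => parF S z) ?_
  simp only [← prod_sign]
  rw [sum_bernoulliSubset]
  have : ∀ j, (if z j = true then (-1 : ℝ) else 1) * p + (1 - p) =
      if z j = true then (1 - 2 * (p : ℝ)) else 1 := by
    intro j
    split_ifs <;> ring
  simp only [this]
  rw [prod_weight, one_pow, mul_one]

/-- Markov's inequality for `2 ^ |S|`, which has expectation `(1 + p) ^ n`. -/
theorem pr_bernoulliSubset_card (k : ℕ) :
    (bernoulliSubset n p hp).pr (fun S => k < S.card) ≤ (1 + p) ^ n / 2 ^ (k + 1) := by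
  classical
  have h := sum_bernoulliSubset (n := n) hp fun _ => 2
  rw [Finset.prod_const, Finset.card_univ, Fintype.card_fin] at h
  rw [PMF.pr_eq_sum, le_div_iff₀ (by positivity), show (1 + (p : ℝ)) = 2 * p + (1 - p) by ring, ← h,
    Finset.sum_mul]
  refine Finset.sum_le_sum fun S _ => ?_
  rw [Finset.prod_const]
  split_ifs with hS
  · gcongr
    · norm_num
    · exact hS
  · rw [zero_mul]; positivity

end Bernoulli

/-! ## The approximation guarantee of ACOUNT -/

theorem CNF.numSols_le {n : ℕ} (F : CNF n) : F.numSols ≤ 2 ^ n := by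
  rw [CNF.numSols]
  refine (Finset.card_le_univ _).trans_eq ?_
  simp

/-- With `e = ⌊log₂ s⌋`, all outputs up to `2 ^ (e + 2) ≤ 4 s` are small enough and `2 ^ (e + 3)`
exceeds `4 s`; so `l₁ = min (e + 3) (n + 1)` is the last level needed. `l₀` is the first level whose
output is large enough, and below it `2 ^ l ≤ c s / 2`. -/
theorem acountLoop_approx {n : ℕ} (D : PMF (Finset (Fin n))) (k : ℕ) (F : CNF n) (hn : 2 ≤ n)
    (hF : 0 < F.numSols) {c : ℝ} (hc : c ≤ 1)
    (hbad : ∀ l, l ≤ n + 1 → (2 : ℝ) ^ l ≤ c * F.numSols / 2 →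
      (acountTrial D k F l).pr (fun a => a = true) ≤ 1 / 15)
    (hhalf : ∀ l, l ≤ n + 1 → 4 * (F.numSols : ℝ) ≤ 2 ^ l ∨ l = n + 1 →
      1 / 2 ≤ (acountTrial D k F l).pr fun a => a = true) :
    1 / 4 ≤ (acountLoop D k F (n + 1) 1).pr fun a =>
      1 / 4 * c * (F.numSols : ℝ) ≤ (a : ℝ) ∧ (a : ℝ) ≤ 4 * (F.numSols : ℝ) := by
  classical
  set s := F.numSols with hs
  set e := Nat.log 2 s with he
  have h1 : 2 ^ e ≤ s := Nat.pow_log_le_self 2 hF.ne'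
  have h2 : s < 2 ^ (e + 1) := Nat.lt_pow_succ_log_self (by norm_num) s
  have h3 : s ≤ 2 ^ n := F.numSols_le
  set l₁ := min (e + 3) (n + 1) with hl₁
  have hcs : c * s ≤ s := mul_le_of_le_one_left (by positivity) hc
  have hl₁' : 1 ≤ l₁ ∧ 1 / 4 * c * (s : ℝ) ≤ 2 ^ (l₁ - 1) := by
    refine ⟨by omega, ?_⟩
    have : s ≤ 2 ^ (l₁ - 1) := by
      rcases min_cases (e + 3) (n + 1) with h | h
      · rw [hl₁, h.1]
        exact h2.le.trans (Nat.pow_le_pow_right (by norm_num) (by omega))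
      · rw [hl₁, h.1]
        exact h3.trans (Nat.pow_le_pow_right (by norm_num) (by omega))
    have : (s : ℝ) ≤ 2 ^ (l₁ - 1) := by exact_mod_cast this
    have : (0 : ℝ) ≤ s := by positivity
    nlinarith
  have hex : ∃ l, 1 ≤ l ∧ 1 / 4 * c * (s : ℝ) ≤ 2 ^ (l - 1) := ⟨l₁, hl₁'⟩
  refine quarter_le_pr_acountLoop D k F (l₀ := Nat.find hex) (l₁ := l₁) hn (Nat.find_min' hex hl₁')
    hl₁'.1 (min_le_right _ _) ?_ ?_ ?_
  · intro l hl hl'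
    constructor
    · refine (Nat.find_spec hex).2.trans ?_
      push_cast
      exact pow_le_pow_right₀ (by norm_num) (by omega)
    · have : 2 ^ (l - 1) ≤ 4 * s := by
        calc 2 ^ (l - 1) ≤ 2 ^ (e + 2) := Nat.pow_le_pow_right (by norm_num) (by omega)
          _ = 4 * 2 ^ e := by ring
          _ ≤ 4 * s := by omega
      exact_mod_cast this
  · intro l hl hl'
    have := Nat.find_min hex hl'
    rw [not_and, not_le] at this
    have h4 := this hl
    have h5 := Nat.find_min' hex hl₁'
    refine hbad l (by omega) ?_
    obtain ⟨m, rfl⟩ : ∃ m, l = m + 1 := ⟨l - 1, by omega⟩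
    rw [Nat.add_sub_cancel] at h4
    rw [pow_succ]
    linarith
  · refine hhalf l₁ (min_le_right _ _) ?_
    rcases min_cases (e + 3) (n + 1) with h | h
    · left
      rw [hl₁, h.1]
      have : 4 * s ≤ 2 ^ (e + 3) := by
        have : 2 ^ (e + 3) = 4 * 2 ^ (e + 1) := by ring
        omega
      exact_mod_cast this
    · right
      rw [hl₁, h.1]

/-! ### Numerical estimates for sparse rows -/

theorem one_add_pow_le_exp {x : ℝ} (hx : 0 ≤ x) (n : ℕ) : (1 + x) ^ n ≤ Real.exp (n * x) := by
  calc (1 + x) ^ n ≤ Real.exp x ^ n := by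
        gcongr; rw [add_comm]; exact Real.add_one_le_exp x
    _ = _ := by rw [← Real.exp_nat_mul]

/-- The failure probability of a union of few nearly independent events. -/
theorem one_add_pow_sub_one_le {γ N : ℝ} {l : ℕ} (hγ : 0 ≤ γ) (hl : (l : ℝ) ≤ N) (h : N * γ ≤ 1 / 30) :
    (1 + γ) ^ l - 1 ≤ 1 / 29 := by
  have h1 : (1 + γ) ^ l ≤ Real.exp (N * γ) :=
    (one_add_pow_le_exp hγ l).trans (Real.exp_le_exp.2 (by gcongr))
  have h2 : 1 - N * γ ≤ Real.exp (-(N * γ)) := Real.one_sub_le_exp_neg _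
  have h3 : Real.exp (N * γ) * Real.exp (-(N * γ)) = 1 := by rw [← Real.exp_add]; simp
  have h4 := Real.exp_pos (N * γ)
  nlinarith

theorem two_rpow_eq_exp (x : ℝ) : (2 : ℝ) ^ x = Real.exp (x * Real.log 2) := by
  rw [Real.rpow_def_of_pos (by norm_num), mul_comm]

/-- Bootstrapping: `log (16 n) ≥ 4` gives `n ≥ 16`, hence `log (16 n) ≥ 8` and `n ≥ 32`, hence `log
(16 n) ≥ 9`. -/
theorem le_of_four_mul_logb_le {n : ℕ} (hn : 0 < n) (h : 4 * Real.logb 2 (16 * (n : ℝ)) ≤ n) :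
    32 ≤ n ∧ 9 ≤ Real.logb 2 (16 * (n : ℝ)) := by
  have hlogb : ∀ (m x : ℕ), 2 ^ m ≤ x → (m : ℝ) ≤ Real.logb 2 x := by
    intro m x hx
    have h2 : (0 : ℝ) < x := by
      have : 0 < x := lt_of_lt_of_le (by positivity) hx
      exact_mod_cast this
    rw [Real.le_logb_iff_rpow_le (by norm_num) h2, Real.rpow_natCast]
    exact_mod_cast hx
  have hcast : (16 : ℝ) * n = ((16 * n : ℕ) : ℝ) := by push_cast; rfl
  rw [hcast] at h ⊢
  have hn16 : 16 ≤ n := by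
    have h1 := hlogb 4 (16 * n) (by omega)
    have : (16 : ℝ) ≤ n := by push_cast at h1 h; linarith
    exact_mod_cast this
  have hn32 : 32 ≤ n := by
    have h1 := hlogb 8 (16 * n) (by omega)
    have : (32 : ℝ) ≤ n := by push_cast at h1 h; linarith
    exact_mod_cast this
  refine ⟨hn32, ?_⟩
  have h1 := hlogb 9 (16 * n) (by omega)
  exact_mod_cast h1

theorem logb_mul_log_two (x : ℝ) : Real.logb 2 x * Real.log 2 = Real.log x := by
  rw [Real.logb, div_mul_cancel₀ _ (Real.log_pos (by norm_num)).ne']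

/-- The binary logarithm `Λ` of `16 n` exceeds the natural one by `(1 - log 2) Λ ≥ 2`. This gains a
factor `exp (-2) ≤ 1/4` over `1 / (16 n)`. -/
theorem exp_neg_logb_le {n : ℝ} (hn : 32 ≤ n) (hΛ : 9 ≤ Real.logb 2 (16 * n)) :
    (n + 1) * Real.exp (-Real.logb 2 (16 * n)) ≤ 1 / 30 := by
  have hln2 := Real.log_two_gt_d9
  have hln2' := Real.log_two_lt_d9
  have hΛu := logb_mul_log_two (16 * n)
  set Λ := Real.logb 2 (16 * n)
  have hn0 : 0 < n := by linarith
  have h1 : Real.exp (-Λ) ≤ Real.exp (-Real.log (16 * n)) * Real.exp (-2) := by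
    rw [← Real.exp_add]
    refine Real.exp_le_exp.2 ?_
    nlinarith
  have h2 : Real.exp (-2) ≤ 1 / 4 := by
    rw [Real.exp_neg, ← one_div]
    refine one_div_le_one_div_of_le (by norm_num) ?_
    have := Real.add_one_le_exp (1 : ℝ)
    rw [show (2 : ℝ) = 1 + 1 by norm_num, Real.exp_add]
    nlinarith
  have h3 : Real.exp (-Λ) ≤ 1 / (16 * n) * (1 / 4) := by
    refine h1.trans ?_
    rw [Real.exp_neg (Real.log (16 * n)), Real.exp_log (by positivity), one_div]
    gcongr
  calc (n + 1) * Real.exp (-Λ) ≤ (n + 1) * (1 / (16 * n) * (1 / 4)) := by gcongr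
    _ = (n + 1) / (64 * n) := by field_simp; norm_num
    _ ≤ 1 / 30 := by rw [div_le_div_iff₀ (by positivity) (by norm_num)]; linarith

theorem acountBias_eq (n k : ℕ) : (acountBias n k : ℝ) = ((k : ℝ) + 1) / (2 * n) := by
  simp [acountBias]

/-- The tail bound has exponent `(k + 1) (log 2 - 1/2) ≥ (4 log 2 - 2) Λ`, with `Λ` the binary
logarithm of `16 n`. As `3 log 2 > 2`, this exceeds `Λ log 2 = log (16 n)`, by more than `1/20`,
which pays for `n + 1` in place of `n`. -/
theorem pr_acountBias_card_le {n k : ℕ} (h : k + 1 ≤ n) (hn : (32 : ℝ) ≤ n)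
    (hΛ : 9 ≤ Real.logb 2 (16 * (n : ℝ))) (hk : 4 * Real.logb 2 (16 * (n : ℝ)) ≤ (k : ℝ) + 1) :
    ((n : ℝ) + 1) * (bernoulliSubset n (acountBias n k) (acountBias_le_one h)).pr
      (fun S => k < S.card) ≤ 1 / 16 := by
  set D := bernoulliSubset n (acountBias n k) (acountBias_le_one h)
  have hln2 := Real.log_two_gt_d9
  have hln2' := Real.log_two_lt_d9
  have hΛu := logb_mul_log_two (16 * n)
  set Λ := Real.logb 2 (16 * (n : ℝ))
  have hn0 : (0 : ℝ) < n := by linarith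
  have h1 := pr_bernoulliSubset_card (n := n) (acountBias_le_one h) k
  have h2 : (1 + (acountBias n k : ℝ)) ^ n ≤ Real.exp (((k : ℝ) + 1) / 2) := by
    refine (one_add_pow_le_exp NNReal.zero_le_coe n).trans_eq ?_
    rw [acountBias_eq]
    congr 1
    field_simp
  have h3 : (2 : ℝ) ^ (k + 1) = Real.exp (((k : ℝ) + 1) * Real.log 2) := by
    rw [← two_rpow_eq_exp, ← Real.rpow_natCast]
    push_cast
    rfl
  have h4 : D.pr (fun S => k < S.card) ≤ Real.exp (-Real.log (16 * n)) * Real.exp (-(1 / 20)) := by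
    refine h1.trans ?_
    rw [h3, div_le_iff₀ (Real.exp_pos _), ← Real.exp_add, ← Real.exp_add]
    refine h2.trans (Real.exp_le_exp.2 ?_)
    have : 0 ≤ ((k : ℝ) + 1 - 4 * Λ) * (Real.log 2 - 1 / 2) :=
      mul_nonneg (by linarith) (by linarith)
    nlinarith
  have h5 : Real.exp (-(1 / 20)) ≤ 20 / 21 := by
    rw [Real.exp_neg, inv_le_comm₀ (Real.exp_pos _) (by norm_num)]
    have := Real.add_one_le_exp (1 / 20 : ℝ)
    linarith
  rw [Real.exp_neg (Real.log (16 * n)), Real.exp_log (by positivity), ← one_div] at h4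
  calc ((n : ℝ) + 1) * D.pr (fun S => k < S.card) ≤ (n + 1) * (1 / (16 * n) * (20 / 21)) := by
        have : D.pr (fun S => k < S.card) ≤ 1 / (16 * n) * (20 / 21) := h4.trans (by gcongr)
        gcongr
    _ = (20 * (n + 1)) / (21 * 16 * n) := by field_simp
    _ ≤ 1 / 16 := by rw [div_le_div_iff₀ (by positivity) (by norm_num)]; linarith

open Classical in
theorem card_ball_le_exp (n : ℕ) {t D : ℝ} (ht : 0 < t) (ht1 : t ≤ 1) :
    ((Finset.univ.filter fun z : Fin n → Bool => (weight z : ℝ) < D).card : ℝ) ≤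
      Real.exp (n * t + D * Real.log (1 / t)) := by
  have hball := card_ball_le n (D := D) ht ht1
  set B := (Finset.univ.filter fun z : Fin n → Bool => (weight z : ℝ) < D).card
  have h2 : t ^ D * Real.exp (D * Real.log (1 / t)) = 1 := by
    rw [Real.rpow_def_of_pos ht, ← Real.exp_add, one_div, Real.log_inv]
    simp [mul_comm]
  rw [Real.exp_add]
  calc (B : ℝ) = B * t ^ D * Real.exp (D * Real.log (1 / t)) := by rw [mul_assoc, h2, mul_one]
    _ ≤ _ := by
      gcongr
      exact hball.trans (one_add_pow_le_exp ht.le n)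

/-- The crude bound `log₂ y ≤ 2 y` at `y = 512 κ` gives `4 κ log₂ y ≤ y ^ 2 / 64`, and `log 64 > 1`.
The spare 1 absorbs the linear term of the entropy estimate for the ball in `acount_guarantee`. -/
theorem one_le_logb_of_mul {κ : ℝ} (hκ : 0 < κ) (hw : 1 ≤ κ * Real.logb 2 (512 * κ)) :
    1 ≤ Real.logb 2 (512 * κ) ∧
      Real.log (4 * (κ * Real.logb 2 (512 * κ))) ≤ 2 * Real.log (512 * κ) - 1 := by
  have hln2 := Real.log_two_gt_d9
  have hylog := logb_mul_log_two (512 * κ)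
  have hy0 : 0 < 512 * κ := by positivity
  have hlogy := Real.log_le_sub_one_of_pos hy0
  set ly := Real.logb 2 (512 * κ) with hly
  have hly0 : 0 < ly := by
    by_contra! hle
    nlinarith
  have hly1 : 1 ≤ ly := by
    by_contra! hlt
    have h1 : 512 * κ < 2 := by
      rw [hly, Real.logb_lt_iff_lt_rpow (by norm_num) hy0, Real.rpow_one] at hlt
      exact hlt
    nlinarith
  refine ⟨hly1, ?_⟩
  have hlyy : ly ≤ 2 * (512 * κ) := by nlinarith
  have h4 : 4 * (κ * ly) ≤ (512 * κ) ^ 2 * (1 / 2 ^ 6) := by nlinarith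
  have h5 := Real.log_le_log (by positivity) h4
  rw [Real.log_mul (x := (512 * κ) ^ 2) (by positivity) (by norm_num), Real.log_pow, one_div, Real.log_inv,
    Real.log_pow] at h5
  push_cast at h5
  linarith

theorem acount_guarantee (n k : ℕ) (h : k + 1 ≤ n)
    (hk : 4 * Real.logb 2 (16 * (n : ℝ)) ≤ (k : ℝ) + 1) (κ : ℝ) (hκ : 0 < κ)
    (hkκ : (k : ℝ) + 1 = κ * Real.logb 2 (512 * κ) * (4 * Real.logb 2 (16 * (n : ℝ))))
    (F : CNF n) (hF : F.isSat = true) :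
    1 / 4 ≤ (acount k h F).pr fun a =>
      1 / 4 * (2 : ℝ) ^ (-((n : ℝ) / κ)) * (F.numSols : ℝ) ≤ (a : ℝ) ∧
      (a : ℝ) ≤ 4 * (F.numSols : ℝ) := by
  have hkn : ((k : ℝ) + 1) ≤ n := by exact_mod_cast h
  obtain ⟨hn32, hΛ⟩ := le_of_four_mul_logb_le (by omega) (hk.trans hkn)
  have hn32' : (32 : ℝ) ≤ n := by exact_mod_cast hn32
  have hγn := exp_neg_logb_le hn32' hΛ
  have hsize := pr_acountBias_card_le h hn32' hΛ hk
  have hln2 := Real.log_two_gt_d9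
  set Λ := Real.logb 2 (16 * (n : ℝ)) with hΛdef
  have hw1 : 1 ≤ κ * Real.logb 2 (512 * κ) := by
    have h1 : 1 * (4 * Λ) ≤ κ * Real.logb 2 (512 * κ) * (4 * Λ) := by linarith
    exact le_of_mul_le_mul_right h1 (by linarith)
  obtain ⟨hly1, hlog4⟩ := one_le_logb_of_mul hκ hw1
  have hlylog := logb_mul_log_two (512 * κ)
  set ly := Real.logb 2 (512 * κ) with hly
  have hn0 : (0 : ℝ) < n := by linarith
  have hη : 1 - 2 * (acountBias n k : ℝ) = 1 - ((k : ℝ) + 1) / n := by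
    rw [acountBias_eq]; field_simp
  have hη0 : 0 ≤ 1 - ((k : ℝ) + 1) / n := by
    rw [sub_nonneg, div_le_one hn0]; exact hkn
  -- Chosen so that differences of weight at least `t n` have expected sign at most `exp (-(k + 1)
  -- t) = exp (-Λ)`.
  set t := 1 / (4 * (κ * ly)) with ht
  have ht0 : 0 < t := by positivity
  have ht1 : t ≤ 1 := by rw [ht, div_le_one (by positivity)]; linarith
  have htk : ((k : ℝ) + 1) * t = Λ := by rw [ht, hkκ]; field_simp
  set D := bernoulliSubset n (acountBias n k) (acountBias_le_one h) with hD
  have hnκ : 36 ≤ n / κ := by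
    rw [le_div_iff₀ hκ]
    have h1 : κ * 1 * (4 * 9) ≤ κ * ly * (4 * Λ) := by gcongr
    linarith
  rw [CNF.isSat_iff] at hF
  have hs0 : (0 : ℝ) < F.numSols := by exact_mod_cast hF
  set γ := Real.exp (-Λ) with hγ
  have hsize' : ∀ l, l ≤ n + 1 → (l : ℝ) * D.pr (fun S => k < S.card) ≤ 1 / 16 := by
    intro l hl
    have h0 := D.pr_nonneg fun S => k < S.card
    have : (l : ℝ) ≤ n + 1 := by exact_mod_cast hl
    exact (mul_le_mul_of_nonneg_right this h0).trans hsize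
  refine acountLoop_approx D k F (by omega) hF ?_ ?_ ?_
  · exact Real.rpow_le_one_of_one_le_of_nonpos (by norm_num) (by linarith)
  · intro l hl hbad
    classical
    have hball := card_ball_le_exp n (D := t * n) ht0 ht1
    set B := (Finset.univ.filter fun z : Fin n → Bool => (weight z : ℝ) < t * n).card with hB
    -- The exponent `n t (1 + log (1 / t))` is at most `2 n t log (512 κ)`, which by the choice of
    -- `t` is half of `(n / κ) log 2`. So the ball has at most the square root of the factor `2 ^ (n
    -- / κ)` that the guarantee concedes.
    have hBle : (B : ℝ) ≤ Real.exp (n / κ / 2 * Real.log 2) := by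
      refine hball.trans (Real.exp_le_exp.2 ?_)
      have h8 : n / κ / 2 * Real.log 2 = t * n * (2 * Real.log (512 * κ)) := by
        rw [← hlylog, ht]; field_simp; norm_num
      rw [h8, ht, one_div_one_div, ← ht]
      have := mul_le_mul_of_nonneg_left hlog4 (mul_pos ht0 hn0).le
      linarith
    refine (pr_acountTrial_le D k F (fun z => (weight z : ℝ) < t * n) (γ := γ) (B := B)
      (Real.exp_pos _).le ?_ ?_ hF l).trans ?_
    · intro z hz
      rw [not_lt] at hz
      rw [hD, pr_bernoulliSubset_parF, hη]
      have : (1 - ((k : ℝ) + 1) / n) ^ weight z ≤ γ := by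
        calc (1 - ((k : ℝ) + 1) / n) ^ weight z ≤ Real.exp (-(((k : ℝ) + 1) / n)) ^ weight z := by
              gcongr; exact Real.one_sub_le_exp_neg _
          _ = Real.exp (weight z * -(((k : ℝ) + 1) / n)) := by rw [← Real.exp_nat_mul]
          _ ≤ γ := by
              refine Real.exp_le_exp.2 ?_
              rw [mul_neg, neg_le_neg_iff, ← htk]
              calc ((k : ℝ) + 1) * t = t * n * (((k : ℝ) + 1) / n) := by field_simp
                _ ≤ _ := by gcongr
      linarith
    · rfl
    · have h1 := one_add_pow_sub_one_le (l := l) (N := (n : ℝ) + 1) (Real.exp_pos (-Λ)).le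
        (by exact_mod_cast hl) hγn
      have h2 : (2 : ℝ) ^ l * B / F.numSols ≤ 1 / 60 := by
        rw [div_le_iff₀ hs0]
        have h3 : (2 : ℝ) ^ (-((n : ℝ) / κ)) * B ≤ 1 / 30 := by
          rw [two_rpow_eq_exp]
          have h4 : Real.exp (-((n : ℝ) / κ) * Real.log 2) * Real.exp (n / κ / 2 * Real.log 2) ≤
              1 / 30 := by
            rw [← Real.exp_add]
            have h5 : Real.exp (-((n : ℝ) / κ) * Real.log 2 + n / κ / 2 * Real.log 2) ≤
                Real.exp (-((5 : ℕ) * Real.log 2)) := by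
              refine Real.exp_le_exp.2 ?_
              push_cast
              have := mul_le_mul_of_nonneg_right hnκ (Real.log_pos one_lt_two).le
              linarith
            refine h5.trans ?_
            rw [Real.exp_neg, Real.exp_nat_mul, Real.exp_log (by norm_num)]
            norm_num
          refine le_trans ?_ h4
          gcongr
        calc (2 : ℝ) ^ l * B ≤ (2 : ℝ) ^ (-((n : ℝ) / κ)) * F.numSols / 2 * B := by gcongr
          _ = ((2 : ℝ) ^ (-((n : ℝ) / κ)) * B) * (F.numSols / 2) := by ring
          _ ≤ 1 / 30 * (F.numSols / 2) := by gcongr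
          _ = _ := by ring
      linarith
  · intro l hl hcase
    have h1 := le_pr_acountTrial D k F l
    have h2 := hsize' l hl
    rcases hcase with hcase | rfl
    · have h3 := pr_survivors_pos_le (RowSat parF) F.sols (rowLaw D)
        (fun x _ => pr_rowSat D parF x) l
      rw [CNF.card_sols] at h3
      have h4 : (F.numSols : ℝ) / 2 ^ l ≤ 1 / 4 := by
        rw [div_le_iff₀ (by positivity)]; linarith
      linarith
    -- At `l = n + 1` a solution survives with probability at most `7/16` and a set is too large
    -- with probability at most `1/16`; exactly 1/2 is left.
    · have h3 := pr_survivors_overdetermined (by omega) D (fun z => by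
        rw [hD, pr_bernoulliSubset_parF, hη]
        have := pow_nonneg hη0 (weight z)
        linarith) F.sols
      linarith

/-! ## Elementary symmetric functions of signs -/

section Signs

variable {ι : Type} (χ : ι → ℝ)

/-- The elementary symmetric functions. -/
noncomputable def symSum (s : Finset ι) (k : ℕ) : ℝ := ∑ S ∈ s.powersetCard k, ∏ j ∈ S, χ j

theorem symSum_zero (s : Finset ι) : symSum χ s 0 = 1 := by simp [symSum]

theorem symSum_one (s : Finset ι) : symSum χ s 1 = ∑ j ∈ s, χ j := by
  simp [symSum, Finset.powersetCard_one]

variable [DecidableEq ι]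

theorem symSum_insert {s : Finset ι} {i : ι} (hi : i ∉ s) (k : ℕ) :
    symSum χ (insert i s) (k + 1) = symSum χ s (k + 1) + χ i * symSum χ s k := by
  rw [symSum, Finset.powersetCard_succ_insert hi, Finset.sum_union]
  · rw [Finset.sum_image, ← symSum, symSum, symSum, Finset.mul_sum]
    · congr 1
      refine Finset.sum_congr rfl fun S hS => ?_
      exact Finset.prod_insert fun h => hi ((Finset.mem_powersetCard.1 hS).1 h)
    · intro S hS T hT h
      have hS' : i ∉ S := fun h => hi ((Finset.mem_powersetCard.1 hS).1 h)
      have hT' : i ∉ T := fun h => hi ((Finset.mem_powersetCard.1 hT).1 h)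
      rw [← Finset.erase_insert hS', ← Finset.erase_insert hT']
      exact congrArg (fun S => Finset.erase S i) h
  · rw [Finset.disjoint_left]
    intro S hS hS'
    obtain ⟨T, -, rfl⟩ := Finset.mem_image.1 hS'
    exact hi ((Finset.mem_powersetCard.1 hS).1 (Finset.mem_insert_self i T))

/-- The Newton identities for signs. -/
theorem symSum_signs (hχ : ∀ j, χ j ^ 2 = 1) (s : Finset ι) (k : ℕ) :
    (k + 2) * symSum χ s (k + 2) =
      (∑ j ∈ s, χ j) * symSum χ s (k + 1) - ((s.card : ℝ) - k) * symSum χ s k := by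
  induction s using Finset.induction_on generalizing k with
  | empty =>
    have : ∀ k, symSum χ (∅ : Finset ι) (k + 1) = 0 := by
      intro k
      rw [symSum, Finset.powersetCard_eq_empty.2 (by simp), Finset.sum_empty]
    rw [this, this, Finset.sum_empty, Finset.card_empty]
    cases k with
    | zero => simp
    | succ k => rw [this]; simp
  | insert i s hi ih =>
    rw [symSum_insert χ hi, symSum_insert χ hi, Finset.sum_insert hi, Finset.card_insert_of_notMem hi]
    have h1 := ih k
    have hi2 := hχ i
    cases k with
    | zero =>
      rw [symSum_zero, symSum_zero, symSum_one] at *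
      push_cast at h1 ⊢
      linear_combination h1 - hi2
    | succ k =>
      rw [symSum_insert χ hi]
      have h2 := ih k
      push_cast at h1 h2 ⊢
      linear_combination h1 + χ i * h2 - symSum χ s (k + 1) * hi2

/-- In the Newton identity both terms on the right are at most `X ^ (k + 2)`, the second because
`s.card - k ≤ X ^ 2`; the factor `k + 2 ≥ 2` on the left compensates for their sum. -/
theorem abs_symSum_le (hχ : ∀ j, χ j ^ 2 = 1) (s : Finset ι) {X : ℝ}
    (hX : |∑ j ∈ s, χ j| ≤ X) (hX2 : (s.card : ℝ) ≤ X ^ 2) (k : ℕ) (hk : k ≤ s.card) :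
    |symSum χ s k| ≤ X ^ k := by
  have hX0 : 0 ≤ X := (abs_nonneg _).trans hX
  induction k using Nat.strong_induction_on with
  | _ k ih =>
    match k with
    | 0 => simp [symSum_zero]
    | 1 => simpa [symSum_one] using hX
    | k + 2 =>
      have h1 := ih k (by omega) (by omega)
      have h2 := ih (k + 1) (by omega) (by omega)
      have h3 := symSum_signs χ hχ s k
      have hk' : (0 : ℝ) ≤ (s.card : ℝ) - k := by
        have : (k : ℝ) ≤ s.card := by exact_mod_cast (by omega : k ≤ s.card)
        linarith
      have h4 : |((k : ℝ) + 2) * symSum χ s (k + 2)| ≤ X * X ^ (k + 1) + X ^ 2 * X ^ k := by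
        rw [h3]
        refine (abs_sub _ _).trans (add_le_add ?_ ?_)
        · rw [abs_mul]; gcongr
        · rw [abs_mul, abs_of_nonneg hk']
          gcongr
          have : (0 : ℝ) ≤ k := by positivity
          linarith
      rw [abs_mul, abs_of_nonneg (by positivity)] at h4
      have h5 : X * X ^ (k + 1) + X ^ 2 * X ^ k = 2 * X ^ (k + 2) := by ring
      rw [h5] at h4
      have h6 : (2 : ℝ) * X ^ (k + 2) ≤ (k + 2) * X ^ (k + 2) := by
        gcongr
        have : (0 : ℝ) ≤ k := by positivity
        linarith
      exact le_of_mul_le_mul_left (h4.trans h6) (by positivity)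

end Signs

/-! ## Uniformly random subsets of a fixed size -/

section Uniform

variable {n k : ℕ} (h : k ≤ n)

theorem pr_uniformSubset_card : (uniformSubset n k h).pr (fun S => k < S.card) = 0 := by
  have h1 : (uniformSubset n k h).pr (fun S => ¬k < S.card) = 1 := by
    refine PMF.pr_eq_one _ fun S hS => ?_
    rw [uniformSubset, PMF.support_uniformOfFinset, Finset.mem_coe, Finset.mem_powersetCard] at hS
    omega
  rw [PMF.pr_not] at h1
  linarith

theorem sum_sign {n : ℕ} (z : Fin n → Bool) :
    ∑ j, (if z j = true then (-1 : ℝ) else 1) = n - 2 * weight z := by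
  have h1 : ∀ j, (if z j = true then (-1 : ℝ) else 1) = 1 - 2 * if z j = true then 1 else 0 := by
    intro j; split_ifs <;> norm_num
  simp only [h1]
  rw [Finset.sum_sub_distrib, ← Finset.mul_sum, Finset.sum_boole, weight]
  simp

/-- The expected sign is the `k`-th elementary symmetric function of the signs of `z`, divided by
`n.choose k`; the signs add up to `n - 2 * weight z`. -/
theorem pr_uniformSubset_parF (z : Fin n → Bool) {X : ℝ} (hX : |(n : ℝ) - 2 * weight z| ≤ X)
    (hX2 : (n : ℝ) ≤ X ^ 2) :
    (uniformSubset n k h).pr (fun S => parF S z = false) ≤ (1 + X ^ k / n.choose k) / 2 := by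
  rw [PMF.pr_of_sign (uniformSubset n k h) (fun S => parF S z) rfl]
  gcongr
  simp only [← prod_sign]
  have h1 : ∑ S, (uniformSubset n k h S).toReal * ∏ j ∈ S, (if z j = true then (-1 : ℝ) else 1) =
      symSum (fun j => if z j = true then (-1 : ℝ) else 1) Finset.univ k / n.choose k := by
    rw [symSum, Finset.sum_div, ← Finset.sum_subset (Finset.subset_univ
      (Finset.powersetCard k (Finset.univ : Finset (Fin n))))]
    · refine Finset.sum_congr rfl fun S hS => ?_
      rw [uniformSubset, PMF.uniformOfFinset_apply_of_mem _ hS, Finset.card_powersetCard,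
        Finset.card_univ, Fintype.card_fin, ENNReal.toReal_inv, ENNReal.toReal_natCast]
      ring
    · intro S _ hS
      rw [uniformSubset, PMF.uniformOfFinset_apply_of_notMem _ hS]
      simp
  rw [h1]
  gcongr
  refine (le_abs_self _).trans (abs_symSum_le _ ?_ _ ?_ ?_ k ?_)
  · intro j; split_ifs <;> norm_num
  · rw [sum_sign]; exact hX
  · simpa using hX2
  · simpa using h

-- Chernoff bound: the sum of `exp (x (n - 2 weight))` over the cube is `(2 cosh x) ^ n ≤ 2 ^ n exp
-- (n x ^ 2 / 2)`. Adding the sums for `x` and `-x` covers both directions, and `x = X / n` is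
-- optimal.
open Classical in
theorem card_unbalanced_le {n : ℕ} (hn : 0 < n) {X : ℝ} (hX : 0 ≤ X) :
    ((Finset.univ.filter fun z : Fin n → Bool => X ≤ |(n : ℝ) - 2 * weight z|).card : ℝ) ≤
      2 ^ (n + 1) * Real.exp (-(X ^ 2 / (2 * n))) := by
  set B := Finset.univ.filter fun z : Fin n → Bool => X ≤ |(n : ℝ) - 2 * weight z|
  set x := X / n with hx
  have hn0 : (0 : ℝ) < n := by exact_mod_cast hn
  have hx0 : 0 ≤ x := by positivity
  have hterm : ∀ (y : ℝ) (z : Fin n → Bool), Real.exp (-y) ^ weight z * Real.exp y ^ (n - weight z) =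
      Real.exp (y * (n - 2 * weight z)) := by
    intro y z
    rw [← Real.exp_nat_mul, ← Real.exp_nat_mul, ← Real.exp_add, Nat.cast_sub (weight_le z)]
    congr 1
    ring
  have h1 := sum_prod_weight n (Real.exp (-x)) (Real.exp x)
  have h2 := sum_prod_weight n (Real.exp (- -x)) (Real.exp (-x))
  simp only [hterm] at h1 h2
  have h3 : (B.card : ℝ) * Real.exp (x * X) ≤ (Real.exp (-x) + Real.exp x) ^ n +
      (Real.exp (- -x) + Real.exp (-x)) ^ n := by
    rw [← h1, ← h2, ← Finset.sum_add_distrib, ← nsmul_eq_mul, ← Finset.sum_const]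
    refine (Finset.sum_le_sum fun z hz => ?_).trans
      (Finset.sum_le_sum_of_subset_of_nonneg (Finset.filter_subset _ _) fun z _ _ => by positivity)
    have hz : X ≤ |(n : ℝ) - 2 * weight z| := (Finset.mem_filter.1 hz).2
    have e1 := Real.exp_pos (x * (n - 2 * weight z))
    have e2 := Real.exp_pos (-x * (n - 2 * weight z))
    rcases le_abs.1 hz with hz | hz
    · have : Real.exp (x * X) ≤ Real.exp (x * (n - 2 * weight z)) := Real.exp_le_exp.2 (by gcongr)
      linarith
    · have : Real.exp (x * X) ≤ Real.exp (-x * (n - 2 * weight z)) := by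
        refine Real.exp_le_exp.2 ?_
        rw [neg_mul, ← mul_neg]
        gcongr
      linarith
  have h4 : (Real.exp (-x) + Real.exp x) ^ n + (Real.exp (- -x) + Real.exp (-x)) ^ n ≤
      2 ^ (n + 1) * Real.exp (n * (x ^ 2 / 2)) := by
    have h5 : Real.exp x + Real.exp (-x) = 2 * Real.cosh x := by rw [Real.cosh_eq]; ring
    rw [neg_neg, add_comm (Real.exp (-x)), h5, mul_pow, ← two_mul, ← mul_assoc, ← pow_succ',
      Real.exp_nat_mul]
    gcongr
    exact Real.cosh_le_exp_half_sq x
  have h6 : Real.exp (x * X) * Real.exp (-(x * X)) = 1 := by rw [← Real.exp_add]; simp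
  calc (B.card : ℝ) = B.card * Real.exp (x * X) * Real.exp (-(x * X)) := by
        rw [mul_assoc, h6, mul_one]
    _ ≤ 2 ^ (n + 1) * Real.exp (n * (x ^ 2 / 2)) * Real.exp (-(x * X)) := by
        exact mul_le_mul_of_nonneg_right (h3.trans h4) (Real.exp_pos _).le
    _ = _ := by
        rw [mul_assoc, ← Real.exp_add, hx]
        congr 2
        field_simp
        ring

end Uniform

/-! ## The approximation guarantee of ACOUNT-CONSTANT -/

open Filter Topology in
theorem eventually_sparse (k : ℕ) (hk : 5 ≤ k) : ∀ᶠ n : ℕ in atTop,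
    Real.logb 2 n * (n : ℝ) ^ (-(2 / (k : ℝ))) ≤ 1 / 10 ∧ 20 ≤ (n : ℝ) ^ (1 - 2 / (k : ℝ)) ∧
      (k.factorial * 2 ^ k : ℝ) * (n : ℝ) ^ (-(2 / (k : ℝ))) ≤ 1 / 30 ∧ 2 * k ≤ n := by
  have hk0 : (5 : ℝ) ≤ k := by exact_mod_cast hk
  have hpos : 0 < 2 / (k : ℝ) := by positivity
  have hcast := tendsto_natCast_atTop_atTop (R := ℝ)
  have h1 : Tendsto (fun n : ℕ => Real.logb 2 n * (n : ℝ) ^ (-(2 / (k : ℝ)))) atTop (𝓝 0) := by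
    have h := ((isLittleO_log_rpow_atTop hpos).tendsto_div_nhds_zero.div_const (Real.log 2)).comp hcast
    rw [zero_div] at h
    refine h.congr fun n => ?_
    rw [Function.comp_apply, Real.rpow_neg (by positivity), Real.logb]
    ring
  have h2 : Tendsto (fun n : ℕ => (n : ℝ) ^ (1 - 2 / (k : ℝ))) atTop atTop := by
    refine (tendsto_rpow_atTop ?_).comp hcast
    rw [sub_pos, div_lt_one (by linarith)]
    linarith
  have h3 : Tendsto (fun n : ℕ => (k.factorial * 2 ^ k : ℝ) * (n : ℝ) ^ (-(2 / (k : ℝ)))) atTop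
      (𝓝 0) := by
    have := ((tendsto_rpow_neg_atTop hpos).comp hcast).const_mul (k.factorial * 2 ^ k : ℝ)
    rwa [mul_zero] at this
  filter_upwards [h1.eventually_le_const (by norm_num : (0 : ℝ) < 1 / 10),
    h2.eventually_ge_atTop 20, h3.eventually_le_const (by norm_num : (0 : ℝ) < 1 / 30),
    eventually_ge_atTop (2 * k)] with n a b c d
  exact ⟨a, b, c, d⟩

theorem acountConstant_guarantee (k : ℕ) (hk : 5 ≤ k) : ∃ n₀ : ℕ, ∀ (n : ℕ) (h : k ≤ n), n₀ ≤ n →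
    ∀ F : CNF n, F.isSat = true →
      1 / 4 ≤ (acountConstant k h F).pr fun a =>
        1 / 4 * (2 : ℝ) ^ (-(n : ℝ) + Real.logb 2 (n : ℝ) / (k : ℝ) *
          (n : ℝ) ^ (1 - 4 / (k : ℝ))) * (F.numSols : ℝ) ≤ (a : ℝ) ∧
        (a : ℝ) ≤ 4 * (F.numSols : ℝ) := by
  obtain ⟨n₀, hn₀⟩ := Filter.eventually_atTop.1 (eventually_sparse k hk)
  refine ⟨n₀, fun n h hn F hF => ?_⟩
  obtain ⟨h1, h2, h3, h4⟩ := hn₀ n hn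
  have hk0 : (5 : ℝ) ≤ k := by exact_mod_cast hk
  have hn0 : (0 : ℝ) < n := by
    have : 0 < n := by omega
    exact_mod_cast this
  have hn1 : (1 : ℝ) ≤ n := by exact_mod_cast (by omega : 1 ≤ n)
  set Q := (n : ℝ) ^ (1 - 2 / (k : ℝ)) with hQ
  set R := Real.logb 2 (n : ℝ) / (k : ℝ) * (n : ℝ) ^ (1 - 4 / (k : ℝ)) with hR
  set q := (n : ℝ) ^ (-(2 / (k : ℝ))) with hq
  have hQq : Q = n * q := by
    rw [hQ, hq, sub_eq_add_neg, Real.rpow_add hn0, Real.rpow_one]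
  have hq0 : 0 < q := Real.rpow_pos_of_pos hn0 _
  have hq1 : q ≤ 1 := Real.rpow_le_one_of_one_le_of_nonpos hn1 (by
    rw [neg_nonpos]; positivity)
  have hRQ : R = Q * (Real.logb 2 n * q) / k := by
    rw [hR, hQ, hq, show (1 - 4 / (k : ℝ)) = (1 - 2 / (k : ℝ)) + -(2 / (k : ℝ)) by ring,
      Real.rpow_add hn0]
    ring
  have hQ0 : 0 < Q := by linarith
  have hR0 : R ≤ Q / 50 := by
    rw [hRQ, div_le_iff₀ (by linarith)]
    have : Q * (Real.logb 2 n * q) ≤ Q * (1 / 10) := by gcongr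
    nlinarith
  have hQn : Q ≤ n := by rw [hQq]; exact mul_le_of_le_one_right hn0.le hq1
  -- This threshold makes the bias `X ^ k / n.choose k` of order `1 / n`, while the fraction of
  -- unbalanced vectors is at most `2 exp (-Q / 2)` with `Q = n ^ (1 - 2 / k)`.
  set X := (n : ℝ) ^ (1 - 1 / (k : ℝ)) with hX
  have hX2 : X ^ 2 = n * Q := by
    rw [hX, hQ, ← Real.rpow_natCast, ← Real.rpow_mul hn0.le]
    nth_rewrite 2 [← Real.rpow_one (n : ℝ)]
    rw [← Real.rpow_add hn0]
    congr 1
    push_cast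
    ring
  have hXk : X ^ k = (n : ℝ) ^ k / n := by
    have : (k : ℝ) ≠ 0 := by linarith
    rw [hX, ← Real.rpow_natCast, ← Real.rpow_mul hn0.le, ← Real.rpow_natCast]
    nth_rewrite 3 [← Real.rpow_one (n : ℝ)]
    rw [← Real.rpow_sub hn0]
    congr 1
    field_simp
  set γ := (k.factorial * 2 ^ k : ℝ) / n with hγ
  have hγ0 : 0 ≤ γ := by positivity
  have hbias : X ^ k / n.choose k ≤ γ := by
    have h5 : ((n : ℝ) / 2) ^ k / k.factorial ≤ n.choose k := by
      refine le_trans ?_ (Nat.pow_le_choose k n)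
      gcongr
      rw [div_le_iff₀ (by norm_num)]
      exact_mod_cast (by omega : n ≤ (n + 1 - k) * 2)
    have h6 : (0 : ℝ) < n.choose k := by exact_mod_cast Nat.choose_pos h
    rw [div_le_iff₀ h6, hXk, hγ]
    calc (n : ℝ) ^ k / n = (k.factorial * 2 ^ k : ℝ) / n * (((n : ℝ) / 2) ^ k / k.factorial) := by
          rw [div_pow]
          field_simp
      _ ≤ _ := by gcongr
  have hRγ : R * γ ≤ 1 / 30 := by
    calc R * γ ≤ Q * γ := by gcongr; linarith
      _ = (k.factorial * 2 ^ k : ℝ) * q := by rw [hQq, hγ]; field_simp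
      _ ≤ _ := h3
  rw [CNF.isSat_iff] at hF
  have hs0 : (0 : ℝ) < F.numSols := by exact_mod_cast hF
  have hs2 : (F.numSols : ℝ) ≤ 2 ^ n := by exact_mod_cast F.numSols_le
  refine acountLoop_approx (uniformSubset n k h) k F (by omega) hF ?_ ?_ ?_
  · refine Real.rpow_le_one_of_one_le_of_nonpos (by norm_num) ?_
    linarith
  · intro l hl hbad
    classical
    have hball := card_unbalanced_le (n := n) (by omega) (X := X) (by positivity)
    set B := (Finset.univ.filter fun z : Fin n → Bool => X ≤ |(n : ℝ) - 2 * weight z|).card with hB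
    set c := (2 : ℝ) ^ (-(n : ℝ) + R) with hc
    have hc0 : 0 < c := by positivity
    have hc2 : c * 2 ^ n = 2 ^ R := by
      rw [hc, ← Real.rpow_natCast, ← Real.rpow_add (by norm_num)]
      congr 1
      ring
    refine (pr_acountTrial_le (uniformSubset n k h) k F (fun z => X ≤ |(n : ℝ) - 2 * weight z|)
      (B := B) hγ0 ?_ le_rfl hF l).trans ?_
    · intro z hz
      rw [not_le] at hz
      refine (pr_uniformSubset_parF h z hz.le ?_).trans (by gcongr)
      rw [hX2]
      exact le_mul_of_one_le_right hn0.le (by linarith)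
    -- Since `s ≤ 2 ^ n`, the levels in question satisfy `2 ^ l ≤ 2 ^ R`. So only `R γ` has to be
    -- small; `n γ` is the constant `k! 2 ^ k` and would not do.
    · have hlR : (l : ℝ) ≤ R := by
        have : (2 : ℝ) ^ (l : ℝ) ≤ 2 ^ R := by
          rw [Real.rpow_natCast, ← hc2]
          refine hbad.trans ?_
          have : c * F.numSols ≤ c * 2 ^ n := by gcongr
          have : 0 < c * F.numSols := by positivity
          linarith
        exact (Real.rpow_le_rpow_left_iff (by norm_num)).1 this
      have e1 := one_add_pow_sub_one_le hγ0 hlR hRγ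
      have e2 : (2 : ℝ) ^ l * B / F.numSols ≤ 1 / 60 := by
        rw [div_le_iff₀ hs0]
        have e3 : (2 : ℝ) ^ R ≤ Real.exp R := by
          rw [two_rpow_eq_exp]
          refine Real.exp_le_exp.2 ?_
          have hR1 : 0 ≤ R := by
            have := Real.logb_nonneg (b := 2) (by norm_num) hn1
            positivity
          have := Real.log_two_lt_d9
          nlinarith
        have e4 : c * B ≤ 1 / 30 := by
          calc c * B ≤ c * (2 ^ (n + 1) * Real.exp (-(X ^ 2 / (2 * n)))) := by gcongr
            _ = 2 * (2 ^ R * Real.exp (-(X ^ 2 / (2 * n)))) := by rw [← hc2]; ring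
            _ ≤ 2 * (Real.exp R * Real.exp (-(X ^ 2 / (2 * n)))) := by gcongr
            _ = 2 * Real.exp (R - Q / 2) := by
                rw [← Real.exp_add, hX2]
                congr 2
                field_simp
                ring
            _ ≤ 2 * Real.exp (-((6 : ℕ) * Real.log 2)) := by
                gcongr
                have := Real.log_two_lt_d9
                push_cast
                linarith
            _ ≤ 1 / 30 := by
                rw [Real.exp_neg, Real.exp_nat_mul, Real.exp_log (by norm_num)]
                norm_num
        calc (2 : ℝ) ^ l * B ≤ c * F.numSols / 2 * B := by gcongr
          _ = c * B * (F.numSols / 2) := by ring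
          _ ≤ 1 / 30 * (F.numSols / 2) := by gcongr
          _ = _ := by ring
      linarith
  · intro l hl hcase
    have e1 := le_pr_acountTrial (uniformSubset n k h) k F l
    rw [pr_uniformSubset_card, mul_zero, sub_zero] at e1
    have e2 := pr_survivors_pos_le (RowSat parF) F.sols (rowLaw (uniformSubset n k h))
        (fun x _ => pr_rowSat _ parF x) l
    rw [CNF.card_sols] at e2
    -- No set is too large here, so even at `l = n + 1` the first moment suffices.
    have e3 : (F.numSols : ℝ) / 2 ^ l ≤ 1 / 2 := by
      rw [div_le_iff₀ (by positivity)]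
      rcases hcase with hcase | rfl
      · linarith
      · rw [pow_succ]; linarith
    linarith

/-! ## The bias of sparse rows -/

theorem par_append {n : ℕ} (js ks : List (Fin n)) (x : Fin n → Bool) :
    par (js ++ ks) x = (par js x ^^ par ks x) := by
  induction ks using List.reverseRecOn with
  | nil => simp [par]
  | append_singleton ks k ih =>
    rw [← List.append_assoc]
    simp only [par, List.foldl_concat] at ih ⊢
    rw [ih, Bool.xor_assoc]

theorem pr_fairCoin (v : Bool) : fairCoin.pr (fun c => c = v) = 1 / 2 := by
  rw [PMF.pr_eq, ex_fairCoin]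
  cases v <;> simp [ind]

section Bias

variable {n : ℕ} (z : Fin n → Bool)

/-- The first coin chooses between the two halves of the first `2 ^ (b + 1)` positions. Positions
beyond the end of the list yield the empty pick, of parity 0, so the denominator is `2 ^ b` even for
an incomplete block. -/
theorem pr_pickLaw (b : ℕ) (L : List (Fin n)) :
    (pickLaw b L).pr (fun p => par p z = true) = ((L.take (2 ^ b)).countP z : ℝ) / 2 ^ b := by
  induction b generalizing L with
  | zero =>
    rw [pickLaw, PMF.pr_pure]
    cases L with
    | nil => simp [par]
    | cons j L =>
      have : (j :: L).take 1 = [j] := rfl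
      rw [pow_zero, this]
      cases h : z j <;> simp [par, h]
  | succ b ih =>
    rw [pickLaw, PMF.pr_bind_of_two (P := fun c => c = true)
      (A := (((L.drop (2 ^ b)).take (2 ^ b)).countP z : ℝ) / 2 ^ b)
      (B := ((L.take (2 ^ b)).countP z : ℝ) / 2 ^ b), pr_fairCoin, pow_succ 2 b, mul_two,
      List.take_add, List.countP_append]
    · push_cast
      rw [pow_succ]
      field_simp
      ring
    · rintro c - rfl
      exact ih _
    · intro c _ hc
      rw [if_neg hc]
      exact ih _

theorem pr_blockStep (b : ℕ) (s : List (Fin n) × List (Fin n)) :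
    (blockStep b s ()).pr (fun s' => par s'.1 z = par s.1 z) =
      1 - ((s.2.take (2 ^ b)).countP z : ℝ) / 2 ^ b / 2 := by
  rw [blockStep, PMF.pr_bind_of_two (P := fun p => par p z = true) (A := 1 / 2) (B := 1), pr_pickLaw]
  · ring
  · intro p _ hp
    rw [PMF.pr_map, ← pr_fairCoin false]
    refine PMF.pr_congr _ fun c _ => ?_
    cases c
    · simp
    · simp [par_append, hp]
  · intro p _ hp
    rw [PMF.pr_map]
    refine PMF.pr_eq_one _ fun c _ => ?_
    cases c
    · simp
    · simp [par_append, hp]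

/-- The blocks act independently: if `q` is the density of ones of `z` in a block, the parity flips
there with probability `q / 2`, and the expected sign is multiplied by `1 - q`. These factors lie in
`[0, 1]` and are at most `exp (-q)`. That `β` does not depend on the accumulator is what carries the
induction. -/
theorem exists_bias (b w : ℕ) (L : List (Fin n)) (hL : L.length ≤ w * 2 ^ b) :
    ∃ β : ℝ, 0 ≤ β ∧ β ≤ Real.exp (-((L.countP z : ℝ) / 2 ^ b)) ∧ ∀ acc : List (Fin n),
      (foldPMF (blockStep b) (List.replicate w ()) (acc, L)).pr (fun s => par s.1 z = par acc z) =
        (1 + β) / 2 := by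
  induction w generalizing L with
  | zero =>
    obtain rfl : L = [] := List.eq_nil_of_length_eq_zero (by omega)
    refine ⟨1, zero_le_one, by simp, fun acc => ?_⟩
    rw [List.replicate_zero, foldPMF, PMF.pr_pure, if_pos rfl]
    norm_num
  | succ w ih =>
    obtain ⟨β, h0, h1, hβ⟩ := ih (L.drop (2 ^ b)) (by
      rw [List.length_drop]
      have : (w + 1) * 2 ^ b = w * 2 ^ b + 2 ^ b := by ring
      omega)
    set q : ℝ := ((L.take (2 ^ b)).countP z : ℝ) / 2 ^ b with hq
    have hq1 : q ≤ 1 := by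
      rw [hq, div_le_one (by positivity)]
      exact_mod_cast (List.countP_le_length).trans (List.length_take_le _ _)
    have hsplit : ((L.countP z : ℕ) : ℝ) = (L.take (2 ^ b)).countP z + (L.drop (2 ^ b)).countP z := by
      rw [← Nat.cast_add, ← List.countP_append, List.take_append_drop]
    refine ⟨(1 - q) * β, mul_nonneg (by linarith) h0, ?_, fun acc => ?_⟩
    · rw [hsplit, add_div, neg_add, Real.exp_add]
      exact mul_le_mul (Real.one_sub_le_exp_neg _) h1 h0 (Real.exp_pos _).le
    · have hdrop : ∀ s ∈ (blockStep b (acc, L) ()).support, s = (s.1, L.drop (2 ^ b)) := by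
        intro s hs
        obtain ⟨p, hp, hs⟩ := (PMF.mem_support_bind_iff _ _ _).1 hs
        obtain ⟨c, -, rfl⟩ := (PMF.mem_support_map_iff _ _ _).1 hs
        rfl
      have hstep := pr_blockStep z b (acc, L)
      rw [List.replicate_succ, foldPMF, PMF.pr_bind_of_two (P := fun s => par s.1 z = par acc z)
        (A := (1 + β) / 2) (B := 1 - (1 + β) / 2), hstep]
      · rw [← hq]; ring
      · intro s hs h
        rw [hdrop s hs, ← hβ s.1, ← h]
      · intro s hs h
        rw [hdrop s hs, ← hβ s.1, ← PMF.pr_not]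
        refine PMF.pr_congr _ fun s' _ => ?_
        generalize par s'.1 z = u at *
        generalize par s.1 z = v at *
        generalize par acc z = v' at *
        revert h
        cases u <;> cases v <;> cases v' <;> simp

theorem countP_finRange : ((List.finRange n).reverse.countP z) = weight z := by
  rw [List.countP_reverse, weight, ← List.toFinset_finRange, List.countP_eq_length_filter,
    ← List.toFinset_card_of_nodup ((List.nodup_finRange n).filter _), List.toFinset_filter]

theorem pr_blockLaw (b w : ℕ) (h : n ≤ 2 ^ b * w) :
    (blockLaw b w (List.finRange n).reverse).pr (fun js => par js z = false) ≤
      (1 + Real.exp (-((weight z : ℝ) / 2 ^ b))) / 2 := by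
  obtain ⟨β, -, h1, hβ⟩ := exists_bias z b w (List.finRange n).reverse (by
    rw [List.length_reverse, List.length_finRange]; linarith)
  rw [countP_finRange] at h1
  rw [blockLaw, PMF.pr_map]
  have := hβ []
  simp only [par, List.foldl_nil] at this ⊢
  rw [this]
  gcongr

end Bias

/-! ## Counting with random constraints -/

theorem sols_addRow {n : ℕ} (r : List (Fin n) × Bool) (G : CNF n) (rows : List (List (Fin n) × Bool)) :
    survivors (RowSat par) (CNF.addRow r.1 r.2 G).sols rows =
      survivors (RowSat par) G.sols (r :: rows) := by
  rw [survivors, survivors]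
  congr 1
  ext x
  simp only [CNF.sols, Finset.mem_filter, Finset.mem_univ, true_and, CNF.eval_addRow,
    Bool.and_eq_true, beq_iff_eq, List.forall_mem_cons, RowSat]
  tauto

theorem survivors_nil {ρ V : Type} (sat : ρ → V → Prop) (A : Finset V) : survivors sat A [] = A.card := by
  rw [survivors]
  congr 1
  simp

/-- The output of the counting program, if at most `M` solutions are left after `j` constraints. -/
theorem exists_countResult_eq {n : ℕ} (M : ℕ) (rows : List (List (Fin n) × Bool)) (l : ℕ) (G : CNF n)
    (j : ℕ) (hj : j < rows.length) (h : survivors (RowSat par) G.sols (rows.take j) ≤ M) :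
    ∃ i ≤ j, countResult M rows l G = 2 ^ (l + i) * survivors (RowSat par) G.sols (rows.take i) := by
  induction rows generalizing l G j with
  | nil => simp at hj
  | cons r rows ih =>
    rw [countResult]
    by_cases hM : G.numSols ≤ M
    · refine ⟨0, Nat.zero_le _, ?_⟩
      rw [if_pos hM, List.take_zero, survivors_nil, CNF.card_sols, add_zero]
    · rw [if_neg hM]
      cases j with
      | zero => rw [List.take_zero, survivors_nil, CNF.card_sols] at h; omega
      | succ j =>
        rw [List.take_succ_cons, ← sols_addRow] at h
        obtain ⟨i, hi, he⟩ := ih (l + 1) _ j (by simpa using hj) h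
        refine ⟨i + 1, by omega, ?_⟩
        rw [he, List.take_succ_cons, ← sols_addRow, add_assoc, add_comm 1 i]

theorem countResult_of_numSols_le {n M : ℕ} {rows : List (List (Fin n) × Bool)} {F : CNF n}
    (hs : F.numSols ≤ M) (hlen : n < rows.length) : countResult M rows 0 F = F.numSols := by
  cases rows with
  | nil => simp at hlen
  | cons r rows => rw [countResult, if_pos hs, pow_zero, one_mul]

/-- The output of the counting program, if the numbers of survivors are close to their expectations. -/
theorem countResult_approx {n : ℕ} (M : ℕ) (hM : 2 ≤ M) (rows : List (List (Fin n) × Bool)) (F : CNF n)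
    (hlen : n < rows.length) {ε : ℝ} (hε0 : 0 ≤ ε) (hε1 : ε ≤ 1)
    (h : ∀ l ≤ n, (M : ℝ) / 4 ≤ F.numSols / 2 ^ l →
      |(survivors (RowSat par) F.sols (rows.take l) : ℝ) - F.numSols / 2 ^ l| <
        ε * (F.numSols / 2 ^ l)) :
    (1 - ε) * F.numSols ≤ (countResult M rows 0 F : ℝ) ∧
      (countResult M rows 0 F : ℝ) ≤ (1 + ε) * F.numSols := by
  have hM' : (2 : ℝ) ≤ M := by exact_mod_cast hM
  by_cases hs : F.numSols ≤ M
  · have h0 : (0 : ℝ) ≤ F.numSols := by positivity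
    rw [countResult_of_numSols_le hs hlen]
    constructor <;> nlinarith
  have hs' : (M : ℝ) < F.numSols := by exact_mod_cast not_le.1 hs
  have hex : ∃ l, (F.numSols : ℝ) / 2 ^ l ≤ M / 2 := by
    refine ⟨n, ?_⟩
    rw [div_le_iff₀ (by positivity)]
    have h1 : (F.numSols : ℝ) ≤ 2 ^ n := by exact_mod_cast F.numSols_le
    have h2 : (0 : ℝ) < 2 ^ n := by positivity
    nlinarith
  classical
  -- At the first level `j` with mean at most `M / 2` the mean is still at least `M / 4`, so all
  -- counts up to level `j` are accurate. As `ε ≤ 1`, at most `M` solutions are left at `j`, and the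
  -- program stops at some `i ≤ j` with an accurate count.
  set j := Nat.find hex with hj
  have hjn : j ≤ n := by
    refine Nat.find_min' hex ?_
    rw [div_le_iff₀ (by positivity)]
    have h1 : (F.numSols : ℝ) ≤ 2 ^ n := by exact_mod_cast F.numSols_le
    have h2 : (0 : ℝ) < 2 ^ n := by positivity
    nlinarith
  have hj1 : (F.numSols : ℝ) / 2 ^ j ≤ M / 2 := Nat.find_spec hex
  have hlarge : ∀ l ≤ j, (M : ℝ) / 4 ≤ F.numSols / 2 ^ l := by
    intro l hl
    cases l with
    | zero => rw [pow_zero, div_one]; linarith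
    | succ l =>
      have h1 := not_le.1 (Nat.find_min hex (m := l) (by omega))
      rw [pow_succ, ← div_div]
      linarith
  have hj2 : survivors (RowSat par) F.sols (rows.take j) ≤ M := by
    have h1 := (abs_lt.1 (h j hjn (hlarge j le_rfl))).2
    have h2 : (0 : ℝ) ≤ F.numSols / 2 ^ j := by positivity
    have h3 : (survivors (RowSat par) F.sols (rows.take j) : ℝ) ≤ M := by nlinarith
    exact_mod_cast h3
  obtain ⟨i, hi, he⟩ := exists_countResult_eq M rows 0 F j (by omega) hj2
  have h1 := abs_lt.1 (h i (by omega) (hlarge i hi))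
  have h2 : (0 : ℝ) < 2 ^ i := by positivity
  rw [he]
  push_cast
  rw [zero_add]
  have h3 : (F.numSols : ℝ) = 2 ^ i * (F.numSols / 2 ^ i) := by field_simp
  set m := (F.numSols : ℝ) / 2 ^ i
  set X := (survivors (RowSat par) F.sols (rows.take i) : ℝ)
  rw [h3]
  constructor
  · have : (1 - ε) * m ≤ X := by linarith [h1.1]
    calc (1 - ε) * (2 ^ i * m) = 2 ^ i * ((1 - ε) * m) := by ring
      _ ≤ _ := by gcongr
  · have : X ≤ (1 + ε) * m := by linarith [h1.2]
    calc 2 ^ i * X ≤ 2 ^ i * ((1 + ε) * m) := by gcongr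
      _ = _ := by ring

/-! ## The error probability of the counting program -/

/-- The exponent of the failure probability of the counting program. -/
noncomputable def countExponent (b : ℕ) : ℝ := 1 / (8 * (2 ^ b) ^ 2 * (b + 3))

theorem countExponent_pos (b : ℕ) : 0 < countExponent b := by
  rw [countExponent]; positivity

theorem countExponent_mul_le (b : ℕ) : 2 * countExponent b ≤ Real.log 2 / (2 * 2 ^ b) := by
  have hln2 := Real.log_two_gt_d9
  have hb : (1 : ℝ) ≤ 2 ^ b := one_le_pow₀ one_le_two
  rw [countExponent, mul_one_div, div_le_div_iff₀ (by positivity) (by positivity)]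
  have h1 : (2 : ℝ) ^ b * 1 * (0 + 3) ≤ 2 ^ b * 2 ^ b * (b + 3) := by gcongr; positivity
  have h2 : (0 : ℝ) < 2 ^ b * 2 ^ b * (b + 3) := by positivity
  nlinarith

/-- Put `r = 2 ^ b`. Differences of weight at least `D = n / (4 r (b + 3))` have bias at most `exp
(-2 a n)`, where `a` is the exponent. The lighter ones number at most `exp (n log 2 / (2 r))`, the
square root of `2 ^ (n / r) ≤ 2 ^ w`, so the large mean outweighs them. Both terms of the relative
variance are thus of order `exp (-2 a n)`, up to a factor linear in `n`. -/
theorem pr_survivors_blockLaw (n b w m₀ : ℕ) (hw : n ≤ 2 ^ b * w) (F : CNF n) (hF : 0 < F.numSols)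
    (hγ : n * Real.exp (-(2 * countExponent b * n)) ≤ 1) (l : ℕ) (hl : l ≤ n)
    (hlarge : (2 : ℝ) ^ (w + m₀) / 4 ≤ F.numSols / 2 ^ l) :
    (iid (rowLaw (blockLaw b w (List.finRange n).reverse)) l).pr (fun rows =>
      (2 : ℝ) ^ (-(countExponent b / 2 * n)) * ((F.numSols : ℝ) / 2 ^ l) ≤
        |(survivors (RowSat par) F.sols rows : ℝ) - (F.numSols : ℝ) / 2 ^ l|) ≤
      (4 + 2 * n) * Real.exp (-(countExponent b * n)) := by
  classical
  set a := countExponent b with ha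
  have ha0 : 0 < a := countExponent_pos b
  have ha2 := countExponent_mul_le b
  rw [← ha] at ha2
  have hln2 := Real.log_two_gt_d9
  have hln2' := Real.log_two_lt_d9
  set r : ℝ := 2 ^ b with hr
  have hr0 : 0 < r := by positivity
  have hb3 : (0 : ℝ) < (b : ℝ) + 3 := by positivity
  set t : ℝ := 1 / (8 * r) with ht
  have ht1 : t ≤ 1 := by
    rw [ht, div_le_one (by positivity)]
    have : (1 : ℝ) ≤ r := one_le_pow₀ one_le_two
    linarith
  have hlogt : Real.log (1 / t) = (b + 3) * Real.log 2 := by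
    rw [ht, one_div_one_div, hr, show (8 : ℝ) * 2 ^ b = 2 ^ (b + 3) by ring, Real.log_pow]
    push_cast; ring
  set D : ℝ := 1 / (4 * r * (b + 3)) * n with hD
  set B := (Finset.univ.filter fun z : Fin n → Bool => (weight z : ℝ) < D).card with hB
  have hBle : (B : ℝ) ≤ Real.exp (n * Real.log 2 / (2 * r)) := by
    refine (card_ball_le_exp n (D := D) (t := t) (by positivity) ht1).trans (Real.exp_le_exp.2 ?_)
    have h1 : D * Real.log (1 / t) = n * (Real.log 2 / (4 * r)) := by
      rw [hlogt, hD]; field_simp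
    have h2 : t ≤ Real.log 2 / (4 * r) := by
      rw [ht, div_le_div_iff₀ (by positivity) (by positivity)]; nlinarith
    rw [h1]
    calc n * t + n * (Real.log 2 / (4 * r)) ≤
        n * (Real.log 2 / (4 * r)) + n * (Real.log 2 / (4 * r)) := by gcongr
      _ = _ := by field_simp; ring
  set γ := Real.exp (-(2 * a * n)) with hγdef
  have hfar : ∀ z : Fin n → Bool, ¬(weight z : ℝ) < D →
      (blockLaw b w (List.finRange n).reverse).pr (fun js => par js z = false) ≤ (1 + γ) / 2 := by
    intro z hz
    refine (pr_blockLaw z b w hw).trans ?_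
    gcongr
    rw [hγdef]
    refine Real.exp_le_exp.2 (neg_le_neg ?_)
    rw [not_lt] at hz
    calc 2 * a * n = D / 2 ^ b := by rw [ha, countExponent, hD, hr]; field_simp; ring
      _ ≤ _ := by gcongr
  have key := pr_survivors_deviation_le_of_xor (blockLaw b w (List.finRange n).reverse) par_xor F
    (fun z => (weight z : ℝ) < D) (B := B) (Real.exp_pos _).le hfar le_rfl hF l
    (Real.rpow_nonneg zero_le_two (-(a / 2 * n)))
  set p := (iid (rowLaw (blockLaw b w (List.finRange n).reverse)) l).pr fun rows =>
      (2 : ℝ) ^ (-(a / 2 * n)) * ((F.numSols : ℝ) / 2 ^ l) ≤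
        |(survivors (RowSat par) F.sols rows : ℝ) - (F.numSols : ℝ) / 2 ^ l|
  have hp : 0 ≤ p := PMF.pr_nonneg _ _
  have hs0 : (0 : ℝ) < F.numSols := by exact_mod_cast hF
  have e1 : (1 + γ) ^ l - 1 ≤ 2 * n * Real.exp (-(2 * a * n)) := by
    have h0 : 0 ≤ n * γ := by positivity
    have h1 : (1 + γ) ^ l ≤ Real.exp (n * γ) :=
      (one_add_pow_le_exp (Real.exp_pos _).le l).trans (Real.exp_le_exp.2 (by gcongr))
    have h2 := Real.abs_exp_sub_one_le (x := n * γ) (by rwa [abs_of_nonneg h0])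
    rw [abs_of_nonneg h0] at h2
    have h3 := (abs_le.1 h2).2
    linarith
  have e2 : (2 : ℝ) ^ l * B / F.numSols ≤ 4 * Real.exp (-(2 * a * n)) := by
    have h1 : (2 : ℝ) ^ l / F.numSols ≤ 4 / 2 ^ (w + m₀) := by
      rw [div_le_div_iff₀ hs0 (by positivity)]
      rw [div_le_div_iff₀ (by norm_num) (by positivity)] at hlarge
      linarith
    have h2 : Real.exp (n * Real.log 2 / r) ≤ 2 ^ (w + m₀) := by
      have h3 : (n : ℝ) / r ≤ w := by
        rw [div_le_iff₀ hr0]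
        have : (n : ℝ) ≤ 2 ^ b * w := by exact_mod_cast hw
        linarith
      calc Real.exp (n * Real.log 2 / r) ≤ Real.exp (w * Real.log 2) := by
            refine Real.exp_le_exp.2 ?_
            rw [mul_div_right_comm]
            gcongr
        _ = 2 ^ w := by rw [Real.exp_nat_mul, Real.exp_log (by norm_num)]
        _ ≤ _ := pow_le_pow_right₀ one_le_two (by omega)
    calc (2 : ℝ) ^ l * B / F.numSols = (2 : ℝ) ^ l / F.numSols * B := by ring
      _ ≤ 4 / Real.exp (n * Real.log 2 / r) * Real.exp (n * Real.log 2 / (2 * r)) := by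
          refine mul_le_mul (h1.trans ?_) hBle (by positivity) (by positivity)
          gcongr
      _ = 4 * Real.exp (-(n * (Real.log 2 / (2 * r)))) := by
          rw [div_mul_eq_mul_div, mul_div_assoc, ← Real.exp_sub]
          congr 2
          field_simp
          ring
      _ ≤ 4 * Real.exp (-(2 * a * n)) := by
          rw [mul_comm (2 * a)]
          gcongr
  -- Relative accuracy `2 ^ (-a n / 2)` costs a factor `2 ^ (a n) ≤ exp (a n)` in Chebyshev's
  -- inequality, half of the available exponent.
  have e3 : ((2 : ℝ) ^ (-(a / 2 * n))) ^ 2 * Real.exp (a * n) ≥ 1 := by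
    rw [two_rpow_eq_exp, ← Real.exp_nat_mul, ← Real.exp_add, ge_iff_le, Real.one_le_exp_iff]
    push_cast
    have : 0 ≤ a * n := by positivity
    nlinarith
  calc p = p * 1 := (mul_one p).symm
    _ ≤ p * (((2 : ℝ) ^ (-(a / 2 * n))) ^ 2 * Real.exp (a * n)) := by gcongr
    _ = p * ((2 : ℝ) ^ (-(a / 2 * n))) ^ 2 * Real.exp (a * n) := by ring
    _ ≤ ((4 + 2 * n) * Real.exp (-(2 * a * n))) * Real.exp (a * n) := by
        refine mul_le_mul_of_nonneg_right ?_ (Real.exp_pos _).le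
        linarith
    _ = _ := by
        rw [mul_assoc, ← Real.exp_add]
        congr 2
        ring

/-- The guarantee of the counting program. -/
theorem le_pr_countResult (n b w m₀ d : ℕ) (hw : n ≤ 2 ^ b * w) (hm₀ : 1 ≤ m₀) (F : CNF n)
    (H : m₀ < n → ((n : ℝ) + 1) * (4 + 2 * n) * n ^ d * Real.exp (-(countExponent b * n)) ≤ 1) :
    1 - 1 / (n : ℝ) ^ d ≤
      (iid (rowLaw (blockLaw b w (List.finRange n).reverse)) (n + 1)).pr fun rows =>
        (1 - (2 : ℝ) ^ (-(countExponent b / 2 * n))) * F.numSols ≤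
          (countResult (2 ^ (w + m₀)) rows 0 F : ℝ) ∧
        (countResult (2 ^ (w + m₀)) rows 0 F : ℝ) ≤
          (1 + (2 : ℝ) ^ (-(countExponent b / 2 * n))) * F.numSols := by
  set R := rowLaw (blockLaw b w (List.finRange n).reverse) with hR
  set a := countExponent b with ha
  have ha0 : 0 < a := countExponent_pos b
  set ε := (2 : ℝ) ^ (-(a / 2 * n)) with hε
  have hε0 : 0 < ε := by positivity
  have hε1 : ε ≤ 1 := by
    refine Real.rpow_le_one_of_one_le_of_nonpos one_le_two ?_
    rw [neg_nonpos]
    positivity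
  have hd0 : 0 ≤ 1 / (n : ℝ) ^ d := by positivity
  by_cases hs : F.numSols ≤ 2 ^ (w + m₀)
  · rw [PMF.pr_eq_one]
    · linarith
    · intro rows hrows
      rw [countResult_of_numSols_le hs (by rw [length_of_mem_support_iid hrows]; omega)]
      have : (0 : ℝ) ≤ F.numSols := by positivity
      constructor <;> nlinarith
  -- For `n ≤ m₀` all `2 ^ n` assignments fit below the threshold and the count is exact; so the
  -- asymptotic hypothesis `H` is needed only beyond `m₀`.
  · have hn : m₀ < n := by
      by_contra h
      refine hs (F.numSols_le.trans (Nat.pow_le_pow_right (by norm_num) (by omega)))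
    have hn1 : (1 : ℝ) ≤ n := by exact_mod_cast (by omega : 1 ≤ n)
    have hH := H hn
    have hF : 0 < F.numSols := by
      have : 0 < 2 ^ (w + m₀) := by positivity
      omega
    have hnd : (1 : ℝ) ≤ n ^ d := one_le_pow₀ hn1
    have hexp := Real.exp_pos (-(a * n))
    have hγ : n * Real.exp (-(2 * a * n)) ≤ 1 := by
      have h1 : Real.exp (-(2 * a * n)) ≤ Real.exp (-(a * n)) := by
        refine Real.exp_le_exp.2 (neg_le_neg ?_)
        have : 0 ≤ a * n := by positivity
        linarith
      have h2 : (n : ℝ) * 1 * 1 ≤ ((n : ℝ) + 1) * (4 + 2 * n) * n ^ d := by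
        gcongr
        · linarith
        · linarith
      calc n * Real.exp (-(2 * a * n)) ≤ (n * 1 * 1) * Real.exp (-(a * n)) := by
            rw [mul_one, mul_one]; gcongr
        _ ≤ _ := by gcongr
        _ ≤ 1 := hH
    set bad := fun (l : ℕ) (rows : List (List (Fin n) × Bool)) =>
      (2 : ℝ) ^ (w + m₀) / 4 ≤ F.numSols / 2 ^ l ∧ ε * ((F.numSols : ℝ) / 2 ^ l) ≤
        |(survivors (RowSat par) F.sols (rows.take l) : ℝ) - (F.numSols : ℝ) / 2 ^ l| with hbad
    have hbadle : ∀ l ∈ Finset.range (n + 1), (iid R (n + 1)).pr (bad l) ≤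
        (4 + 2 * n) * Real.exp (-(a * n)) := by
      intro l hl
      rw [Finset.mem_range] at hl
      by_cases hlarge : (2 : ℝ) ^ (w + m₀) / 4 ≤ F.numSols / 2 ^ l
      · refine le_trans ?_ (pr_survivors_blockLaw n b w m₀ hw F hF hγ l (by omega) hlarge)
        rw [← iid_map_take (rowLaw _) (show l ≤ n + 1 by omega), PMF.pr_map]
        exact PMF.pr_mono _ fun rows h => h.2
      · have : (iid R (n + 1)).pr (bad l) = 0 := by
          have h1 := (iid R (n + 1)).pr_eq_one (E := fun rows => ¬bad l rows) fun rows _ h => hlarge h.1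
          rw [PMF.pr_not] at h1
          linarith
        rw [this]
        positivity
    have hunion := ((iid R (n + 1)).pr_exists_le (Finset.range (n + 1)) bad).trans
      (Finset.sum_le_sum hbadle)
    rw [Finset.sum_const, Finset.card_range, nsmul_eq_mul] at hunion
    have hle : 1 - (iid R (n + 1)).pr (fun rows => ∃ l ∈ Finset.range (n + 1), bad l rows) ≤
        (iid R (n + 1)).pr fun rows =>
        (1 - ε) * F.numSols ≤ (countResult (2 ^ (w + m₀)) rows 0 F : ℝ) ∧
        (countResult (2 ^ (w + m₀)) rows 0 F : ℝ) ≤ (1 + ε) * F.numSols := by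
      rw [← PMF.pr_not]
      refine PMF.pr_mono_support _ fun rows hrows h => ?_
      push Not at h
      refine countResult_approx _ ?_ rows F (by rw [length_of_mem_support_iid hrows]; omega) hε0.le hε1
        fun l hl hlarge => ?_
      · exact Nat.le_self_pow (by omega) 2
      · by_contra h'
        exact h l (Finset.mem_range.2 (by omega)) ⟨by push_cast at hlarge; exact hlarge, not_lt.1 h'⟩
    refine le_trans ?_ hle
    have : ((n : ℝ) + 1) * ((4 + 2 * n) * Real.exp (-(a * n))) ≤ 1 / n ^ d := by
      rw [le_div_iff₀ (by positivity)]
      calc _ = ((n : ℝ) + 1) * (4 + 2 * n) * n ^ d * Real.exp (-(a * n)) := by ring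
        _ ≤ 1 := hH
    push_cast at hunion
    linarith

/-- The exponential beats every polynomial. The constant `m₀` thereby absorbs the dependence on the
required failure probability `n ^ (-d)`, so the error exponent need not depend on `d`. -/
theorem exists_threshold (b d : ℕ) : ∃ m₀ : ℕ, 1 ≤ m₀ ∧ ∀ n : ℕ, m₀ < n →
    ((n : ℝ) + 1) * (4 + 2 * n) * n ^ d * Real.exp (-(countExponent b * n)) ≤ 1 := by
  have h1 := (isLittleO_pow_exp_pos_mul_atTop (d + 2) (countExponent_pos b)).bound
    (show (0 : ℝ) < 1 / 12 by norm_num)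
  obtain ⟨m₀, hm₀⟩ := Filter.eventually_atTop.1 (tendsto_natCast_atTop_atTop.eventually h1)
  refine ⟨m₀ + 1, by omega, fun n hn => ?_⟩
  have h2 := hm₀ n (by omega)
  have hn1 : (1 : ℝ) ≤ n := by exact_mod_cast (by omega : 1 ≤ n)
  rw [Real.norm_of_nonneg (by positivity), Real.norm_of_nonneg (Real.exp_pos _).le] at h2
  rw [Real.exp_neg, ← div_eq_mul_inv, div_le_one (Real.exp_pos _)]
  calc ((n : ℝ) + 1) * (4 + 2 * n) * n ^ d ≤ (n + n) * (4 * n + 2 * n) * n ^ d := by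
        gcongr; linarith
    _ = 12 * n ^ (d + 2) := by ring
    _ ≤ _ := by linarith

/-! ## The running time of the counting program -/

theorem Cmd.Computes.mono {P : Type} {I : Interp P} {c : Cmd P} {v : Val} {T T' : ℝ} {μ : PMF Val}
    (h : c.Computes I v T μ) (hT : T ≤ T') : c.Computes I v T' μ := by
  obtain ⟨N, h1, h2⟩ := h
  exact ⟨N, fun s hs => ⟨(h1 s hs).1, (h1 s hs).2.trans hT⟩, h2⟩

/-- `v` stands for formula size times `2 ^ w`, `p` for the constant `2 ^ m₀`, and `Y` for the cost
of a SAT call. Every summand is at most a constant times `v ^ 2 * Y`; the factor `v ^ 2` covers both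
the `n M` calls and the quadratic cost of counting the list. -/
theorem countBodyTime_le {prog : Cmd Empty} {T : ℝ} {n b w M : ℕ} {v Y p : ℝ}
    (hn : (n : ℝ) + 1 ≤ v) (hw : (w : ℝ) + 1 ≤ v) (hu : ((w : ℝ) + 1) * 2 ^ w ≤ v ^ 2) (hp : 1 ≤ p)
    (hM : (M : ℝ) ≤ p * v) (hY : 1 ≤ Y) (hT : (callTime prog T : ℝ) ≤ Y) :
    (countBodyTime prog T n b w M : ℝ) ≤
      (600 * p ^ 2 + 4 * 2 ^ b + 15 * b + 2000) * (v ^ 2 * Y) := by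
  have hn0 : (0 : ℝ) ≤ n := by positivity
  have hw0 : (0 : ℝ) ≤ w := by positivity
  have hv : 1 ≤ v := by linarith
  have hv2 : v ≤ v ^ 2 := by nlinarith
  have hA : v ^ 2 ≤ v ^ 2 * Y := le_mul_of_one_le_right (by positivity) hY
  have hYA : Y ≤ v ^ 2 * Y := le_mul_of_one_le_left (by positivity) (by linarith)
  have hc0 : (0 : ℝ) ≤ callTime prog T := by positivity
  have hpp : p ≤ p ^ 2 := by nlinarith
  set A := v ^ 2 * Y with hAdef
  have hA0 : 0 < A := by positivity
  have h1 : (n : ℝ) * (M * (2 * callTime prog T + 170) + 100) ≤ 272 * p ^ 2 * A := by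
    calc (n : ℝ) * (M * (2 * callTime prog T + 170) + 100) ≤
        v * (p * v * (2 * Y + 170 * Y) + 100 * (p * v * Y)) := by
          have : 1 * 1 * 1 ≤ p * v * Y := by gcongr
          gcongr
          · linarith
          · linarith
          · linarith
      _ = 272 * p * A := by rw [hAdef]; ring
      _ ≤ _ := by gcongr
  have h2 : (M : ℝ) * (100 * M + 130) ≤ 230 * p ^ 2 * A := by
    have h3 : 1 * 1 ≤ p * v := by gcongr
    calc (M : ℝ) * (100 * M + 130) ≤ p * v * (100 * (p * v) + 130 * (p * v)) := by
          gcongr; linarith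
      _ = 230 * p ^ 2 * v ^ 2 := by ring
      _ ≤ _ := by gcongr
  have h3 : (w : ℝ) * (4 * 2 ^ b + 15 * b + 80) ≤ (4 * 2 ^ b + 15 * b + 80) * A := by
    rw [mul_comm]
    gcongr
    linarith
  have h4 : A ≤ p ^ 2 * A := le_mul_of_one_le_left hA0.le (by linarith)
  rw [countBodyTime]
  push_cast
  nlinarith

theorem approxCountTime_le {prog : Cmd Empty} {T : ℝ} {n b m₀ w : ℕ} {v Y p : ℝ}
    (hn : (n : ℝ) + 1 ≤ v) (hw : (w : ℝ) + 1 ≤ v) (hu : ((w : ℝ) + 1) * 2 ^ w ≤ v ^ 2) (hp : 1 ≤ p)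
    (hM : (2 : ℝ) ^ (w + m₀) ≤ p * v) (hY : 1 ≤ Y) (hT : (callTime prog T : ℝ) ≤ Y) :
    (approxCountTime prog T n b m₀ w : ℝ) + 2 ≤
      (600 * p ^ 2 + 4 * 2 ^ b + 125 * b + 84 * p * (m₀ + 1) + 3000) * (v ^ 3 * Y) := by
  have hbody := countBodyTime_le (b := b) (M := 2 ^ (w + m₀)) hn hw hu hp (by exact_mod_cast hM) hY hT
  have hn0 : (0 : ℝ) ≤ n := by positivity
  have hw0 : (0 : ℝ) ≤ w := by positivity
  have hv : 1 ≤ v := by linarith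
  have hv3 : v ≤ v ^ 3 := le_self_pow₀ hv (by norm_num)
  have hv2 : v ^ 2 ≤ v ^ 3 := pow_le_pow_right₀ hv (by norm_num)
  have hA : v ^ 3 ≤ v ^ 3 * Y := le_mul_of_one_le_right (by positivity) hY
  set A := v ^ 3 * Y with hAdef
  set K : ℝ := 600 * p ^ 2 + 4 * 2 ^ b + 15 * b + 2000 with hK
  have h1 : ((n : ℝ) + 1) * ((countBodyTime prog T n b w (2 ^ (w + m₀)) : ℝ) + 7) ≤ K * A + 7 * A := by
    calc ((n : ℝ) + 1) * ((countBodyTime prog T n b w (2 ^ (w + m₀)) : ℝ) + 7) ≤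
        v * (K * (v ^ 2 * Y) + 7) := by gcongr
      _ = K * A + 7 * v := by rw [hAdef]; ring
      _ ≤ _ := by gcongr; linarith
  have h2 : ((w : ℝ) + m₀) * (40 * 2 ^ (w + m₀) + 40) ≤ 80 * p * (m₀ + 1) * A := by
    have h3 : 1 * 1 ≤ p * v := by gcongr
    calc ((w : ℝ) + m₀) * (40 * 2 ^ (w + m₀) + 40) ≤
        (v * 1 + m₀ * v) * (40 * (p * v) + 40 * (p * v)) := by
          gcongr
          · linarith
          · exact le_mul_of_one_le_right (by positivity) hv
          · linarith
      _ = 80 * p * (m₀ + 1) * v ^ 2 := by ring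
      _ ≤ _ := by gcongr; linarith
  have h3 : (b : ℝ) * (40 * n + 70) ≤ 110 * b * A := by
    calc (b : ℝ) * (40 * n + 70) ≤ b * (110 * A) := by gcongr; linarith
      _ = _ := by ring
  have h4 : (m₀ : ℝ) ≤ p * (m₀ + 1) * A := by
    calc (m₀ : ℝ) = 1 * m₀ * 1 := by ring
      _ ≤ p * (m₀ + 1) * A := by gcongr <;> linarith
  rw [approxCountTime]
  push_cast
  nlinarith

/-! ### Choice of the block length and assembly of the complexity bound -/

theorem CNF.le_size {n : ℕ} (F : CNF n) : n ≤ F.size := by rw [CNF.size]; omega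

/-- The block size exponent for which the factor in the running time is at most `2 ^ (δ * n)`. -/
noncomputable def blockExponent (E : ℕ) (δ : ℝ) : ℕ := Nat.clog 2 ⌈E / δ⌉₊

theorem le_two_pow_blockExponent (E : ℕ) (δ : ℝ) : E / δ ≤ (2 : ℝ) ^ blockExponent E δ := by
  refine (Nat.le_ceil _).trans ?_
  exact_mod_cast Nat.le_pow_clog one_lt_two _

/-- Rounding up to an integer and then to a power of two loses at most a factor 2 each, since `E / δ
≥ 1`. -/
theorem two_pow_blockExponent_le {E : ℕ} (hE : 1 ≤ E) {δ : ℝ} (h0 : 0 < δ) (h1 : δ ≤ 1) :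
    (2 : ℝ) ^ blockExponent E δ ≤ 4 * E / δ := by
  have hE' : (1 : ℝ) ≤ E := by exact_mod_cast hE
  have hEδ : 1 ≤ E / δ := by rw [le_div_iff₀ h0]; linarith
  have hceil : ((⌈(E : ℝ) / δ⌉₊ : ℕ) : ℝ) < E / δ + 1 := Nat.ceil_lt_add_one (by positivity)
  rw [blockExponent]
  rcases Nat.lt_or_ge 1 ⌈(E : ℝ) / δ⌉₊ with h | h
  · have h2 := Nat.pow_pred_clog_lt_self one_lt_two h
    have h3 : 0 < Nat.clog 2 ⌈(E : ℝ) / δ⌉₊ := Nat.clog_pos one_lt_two h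
    have h4 : (2 : ℝ) ^ (Nat.clog 2 ⌈(E : ℝ) / δ⌉₊).pred < ⌈(E : ℝ) / δ⌉₊ := by exact_mod_cast h2
    have h5 : (2 : ℝ) ^ Nat.clog 2 ⌈(E : ℝ) / δ⌉₊ = 2 * 2 ^ (Nat.clog 2 ⌈(E : ℝ) / δ⌉₊).pred := by
      rw [← pow_succ', Nat.pred_eq_sub_one, Nat.sub_add_cancel h3]
    rw [h5, mul_div_assoc]
    linarith
  · rw [Nat.clog_of_right_le_one h, pow_zero, mul_div_assoc]
    linarith

/-- As `δ` tends to 0, `2 ^ b` is at most a multiple of `1 / δ` and `b + 3` at most a multiple of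
`log (1 / δ)`, so the reciprocal of the exponent is of order at most `log (1 / δ) / δ ^ 2`. -/
theorem isBigO_countExponent {E : ℕ} (hE : 1 ≤ E) :
    (fun δ : ℝ => δ ^ 2 / Real.logb 2 (1 / δ)) =O[nhdsWithin 0 (Set.Ioi 0)]
      fun δ => countExponent (blockExponent E δ) / 2 := by
  refine Asymptotics.IsBigO.of_bound (256 * (E : ℝ) ^ 2 * (4 * E + 4)) ?_
  filter_upwards [Ioo_mem_nhdsGT (show (0 : ℝ) < 1 / 2 by norm_num)] with δ hδ
  obtain ⟨h0, h1⟩ := hδ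
  have hE' : (1 : ℝ) ≤ E := by exact_mod_cast hE
  have hlog1 : 1 ≤ Real.logb 2 (1 / δ) := by
    rw [Real.le_logb_iff_rpow_le one_lt_two (by positivity), Real.rpow_one, le_div_iff₀ h0]
    linarith
  set b := blockExponent E δ with hb
  have hr := two_pow_blockExponent_le hE h0 (by linarith : δ ≤ 1)
  rw [← hb] at hr
  have hb1 : (b : ℝ) ≤ 4 * E + Real.logb 2 (1 / δ) := by
    have h2 := Real.logb_le_logb_of_le one_lt_two (by positivity) hr
    rw [← Real.rpow_natCast, Real.logb_rpow (by norm_num) (by norm_num), div_eq_mul_one_div,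
      Real.logb_mul (by positivity) (by positivity)] at h2
    have h3 : Real.logb 2 (4 * E) ≤ 4 * E := by
      rw [Real.logb_le_iff_le_rpow one_lt_two (by positivity)]
      have : ((4 * E : ℕ) : ℝ) ≤ (2 : ℝ) ^ (4 * E : ℕ) := by exact_mod_cast Nat.lt_two_pow_self.le
      rw [← Real.rpow_natCast] at this
      push_cast at this
      exact this
    linarith
  rw [Real.norm_of_nonneg (by positivity), Real.norm_of_nonneg (by
    have := countExponent_pos b; positivity), countExponent]
  set L := Real.logb 2 (1 / δ)
  have hb3 : (b : ℝ) + 3 ≤ (4 * E + 4) * L := by nlinarith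
  rw [div_div, mul_one_div, div_le_div_iff₀ (by linarith) (by positivity)]
  calc δ ^ 2 * (8 * (2 ^ b) ^ 2 * (b + 3) * 2) ≤
      δ ^ 2 * (8 * (4 * E / δ) ^ 2 * ((4 * E + 4) * L) * 2) := by gcongr
    _ = _ := by field_simp; ring

/-- The complexity of approximate counting. -/
theorem approxCount_complexity (c : ℝ) (hc : 0 < c) (hSAT : SATInTime c) :
    ∃ α : ℝ → ℝ, (∀ δ : ℝ, 0 < δ → 0 < α δ) ∧
      (fun δ : ℝ => δ ^ 2 / Real.logb 2 (1 / δ)) =O[nhdsWithin 0 (Set.Ioi 0)] α ∧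
      ∀ δ : ℝ, 0 < δ → ∀ d : ℕ, ∃ (prog : Cmd Unit) (C e : ℕ), ∀ (n : ℕ) (F : CNF n),
        ∃ μ : PMF Val,
          prog.Computes coinInterp (Val.ofCNF F)
            ((C : ℝ) * ((F.size : ℝ) + 1) ^ e * (2 : ℝ) ^ ((c + δ) * (n : ℝ))) μ ∧
          1 - 1 / (n : ℝ) ^ d ≤ μ.pr fun v =>
            (1 - (2 : ℝ) ^ (-(α δ * (n : ℝ)))) * (F.numSols : ℝ) ≤ (v.binToNat : ℝ) ∧
            (v.binToNat : ℝ) ≤ (1 + (2 : ℝ) ^ (-(α δ * (n : ℝ)))) * (F.numSols : ℝ) := by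
  obtain ⟨prog, C, e, hprog⟩ := hSAT
  -- The total power of `v`: a SAT call on size at most `4 v ^ 2` contributes `v ^ (2 e)`, and the
  -- rest of the program `v ^ 3`.
  set E := 2 * e + 3 with hE
  refine ⟨fun δ => countExponent (blockExponent E δ) / 2, fun δ _ => half_pos (countExponent_pos _),
    isBigO_countExponent (by omega), fun δ hδ d => ?_⟩
  set b := blockExponent E δ with hb
  obtain ⟨m₀, hm₀, hthr⟩ := exists_threshold b d
  obtain ⟨K, hK⟩ : ∃ K : ℕ, K = 600 * (2 ^ m₀) ^ 2 + 4 * 2 ^ b + 125 * b +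
      84 * 2 ^ m₀ * (m₀ + 1) + 3000 := ⟨_, rfl⟩
  obtain ⟨K', hK'⟩ : ∃ K' : ℕ, K' = C * 4 ^ e + 2 * prog.maxVar + 1 := ⟨_, rfl⟩
  refine ⟨(Expr.approxCount prog b m₀).toCmd, K * K' * 2 ^ E, E, fun n F => ?_⟩
  set w := halvings b n with hw
  set Z := F.size + (n + 1) * (2 ^ w * (w + 1)) + 2 * n with hZ
  set X : ℝ := (2 : ℝ) ^ (c * n) with hX
  set T : ℝ := (C : ℝ) * ((Z : ℝ) + 1) ^ e * X with hT
  have hX1 : 1 ≤ X := Real.one_le_rpow one_le_two (by positivity)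
  have hdec : DecidesSAT prog n Z T := by
    intro G hG
    obtain ⟨v, h1, h2⟩ := hprog n G
    refine ⟨v, h1.mono ?_, h2⟩
    have : (G.size : ℝ) ≤ Z := by exact_mod_cast hG
    rw [hT]
    gcongr
  have hsem := Sem.approxCount b m₀ F hdec le_rfl
  rw [← hw] at hsem
  set S : ℝ := (F.size : ℝ) + 1 with hS
  set u : ℝ := (2 : ℝ) ^ w with hu
  set v : ℝ := S * u with hv
  have hnS : (n : ℝ) + 1 ≤ S := by
    have : (n : ℝ) ≤ F.size := by exact_mod_cast F.le_size
    linarith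
  have hn0 : (0 : ℝ) ≤ n := by positivity
  have hS1 : 1 ≤ S := by linarith
  have hu1 : 1 ≤ u := one_le_pow₀ one_le_two
  have hwu : (w : ℝ) + 1 ≤ u := by
    have : w + 1 ≤ 2 ^ w := Nat.lt_two_pow_self
    rw [hu]
    exact_mod_cast this
  have huv : u ≤ v := le_mul_of_one_le_left (by linarith) hS1
  have hSv : S ≤ v := le_mul_of_one_le_right (by linarith) hu1
  have hv1 : 1 ≤ v := by linarith
  set Y : ℝ := K' * (v ^ (2 * e) * X) with hY
  have hB1 : 1 * 1 ≤ v ^ (2 * e) * X := by gcongr; exact one_le_pow₀ hv1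
  have hZv : (Z : ℝ) + 1 ≤ 4 * v ^ 2 := by
    have h1 : ((n : ℝ) + 1) * (u * (w + 1)) ≤ v ^ 2 := by
      calc ((n : ℝ) + 1) * (u * (w + 1)) ≤ S * (u * u) := by gcongr
        _ ≤ S * (u * u) * S := le_mul_of_one_le_right (by positivity) hS1
        _ = _ := by rw [hv]; ring
    have h2 : v ≤ v ^ 2 := by nlinarith
    rw [hZ]
    push_cast
    rw [← hu]
    linarith
  have hcall : (callTime prog T : ℝ) ≤ Y := by
    have h1 : T ≤ C * 4 ^ e * (v ^ (2 * e) * X) := by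
      calc T ≤ C * (4 * v ^ 2) ^ e * X := by rw [hT]; gcongr
        _ = _ := by rw [mul_pow, ← pow_mul]; ring
    have h2 : ((⌊T⌋₊ : ℕ) : ℝ) ≤ T := Nat.floor_le (by positivity)
    rw [callTime, hY, hK']
    push_cast
    have h3 : (prog.maxVar : ℝ) * 1 ≤ prog.maxVar * (v ^ (2 * e) * X) := by gcongr; linarith
    linarith
  have hY1 : 1 ≤ Y := by
    have : (1 : ℝ) ≤ K' := by exact_mod_cast (by omega : 1 ≤ K')
    calc (1 : ℝ) = 1 * (1 * 1) := by norm_num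
      _ ≤ Y := by rw [hY]; gcongr
  have htime := approxCountTime_le (prog := prog) (T := T) (b := b) (m₀ := m₀) (p := 2 ^ m₀)
    (hnS.trans hSv) (hwu.trans huv)
    (by rw [sq]; exact mul_le_mul (hwu.trans huv) huv (by positivity) (by positivity))
    (one_le_pow₀ one_le_two) (by rw [pow_add, mul_comm]; gcongr) hY1 hcall
  -- The number of blocks is at most `n / 2 ^ b + 1`, and `E / 2 ^ b ≤ δ` by the choice of `b`;
  -- hence `w E ≤ E + δ n`.
  have huE : u ^ E ≤ 2 ^ E * (2 : ℝ) ^ (δ * n) := by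
    have h1 : 2 ^ b * w + 1 ≤ n + 2 ^ b := two_pow_mul_halvings_le b n
    have h2 : (2 : ℝ) ^ b * w ≤ n + 2 ^ b := by exact_mod_cast (by omega : 2 ^ b * w ≤ n + 2 ^ b)
    have h3 := le_two_pow_blockExponent E δ
    rw [← hb, div_le_iff₀ hδ] at h3
    have h4 : (w : ℝ) * E ≤ E + δ * n := by
      have hr : (0 : ℝ) < 2 ^ b := by positivity
      refine le_of_mul_le_mul_left ?_ hr
      calc (2 : ℝ) ^ b * (w * E) = 2 ^ b * w * E := by ring
        _ ≤ (n + 2 ^ b) * E := by gcongr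
        _ = 2 ^ b * E + n * E := by ring
        _ ≤ 2 ^ b * E + n * (2 ^ b * δ) := by gcongr
        _ = _ := by ring
    calc u ^ E = (2 : ℝ) ^ ((w : ℝ) * E) := by
          rw [hu, ← pow_mul, ← Real.rpow_natCast]; push_cast; rfl
      _ ≤ (2 : ℝ) ^ (E + δ * n) := Real.rpow_le_rpow_of_exponent_le one_le_two h4
      _ = _ := by rw [Real.rpow_add (by norm_num), Real.rpow_natCast]
  refine ⟨_, Sem.computes hsem (htime.trans ?_), ?_⟩
  · have hpow : v ^ 3 * v ^ (2 * e) = S ^ E * u ^ E := by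
      rw [← mul_pow, ← hv, hE, ← pow_add, add_comm]
    calc _ = (K : ℝ) * K' * (S ^ E * u ^ E) * X := by
          rw [hY, hK]; push_cast; rw [← hpow]; ring
      _ ≤ (K : ℝ) * K' * (S ^ E * (2 ^ E * (2 : ℝ) ^ (δ * n))) * X := by gcongr
      _ = _ := by
          rw [add_mul, Real.rpow_add (by norm_num), ← hX]
          push_cast
          ring
  · rw [PMF.map_comp, PMF.pr_map]
    simp only [Function.comp_apply, binToNat_countOutput]
    have h1 := foldPMF_countStep (rowLaw (blockLaw b w (List.finRange n).reverse)) (2 ^ (w + m₀))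
      Nat.one_le_two_pow (n + 1) 0 F
    have h2 := le_pr_countResult n b w m₀ d (le_two_pow_mul_halvings b n) hm₀ F (hthr n)
    rw [← PMF.pr_map _ (fun rows => countResult (2 ^ (w + m₀)) rows 0 F) (fun a : ℕ =>
      (1 - (2 : ℝ) ^ (-(countExponent b / 2 * n))) * F.numSols ≤ (a : ℝ) ∧
      (a : ℝ) ≤ (1 + (2 : ℝ) ^ (-(countExponent b / 2 * n))) * F.numSols), ← h1, PMF.pr_map] at h2
    exact h2

theorem theorem1 :
    -- complexity of approximate counting
    (∀ c : ℝ, 0 < c → SATInTime c →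
      ∃ α : ℝ → ℝ, (∀ δ : ℝ, 0 < δ → 0 < α δ) ∧
        (fun δ : ℝ => δ ^ 2 / Real.logb 2 (1 / δ)) =O[nhdsWithin 0 (Set.Ioi 0)] α ∧
        ∀ δ : ℝ, 0 < δ → ∀ d : ℕ, ∃ (prog : Cmd Unit) (C e : ℕ), ∀ (n : ℕ) (F : CNF n),
          ∃ μ : PMF Val,
            prog.Computes coinInterp (Val.ofCNF F)
              ((C : ℝ) * ((F.size : ℝ) + 1) ^ e * (2 : ℝ) ^ ((c + δ) * (n : ℝ))) μ ∧
            1 - 1 / (n : ℝ) ^ d ≤ μ.pr fun v =>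
              (1 - (2 : ℝ) ^ (-(α δ * (n : ℝ)))) * (F.numSols : ℝ) ≤ (v.binToNat : ℝ) ∧
              (v.binToNat : ℝ) ≤ (1 + (2 : ℝ) ^ (-(α δ * (n : ℝ)))) * (F.numSols : ℝ)) ∧
    -- running time of ACOUNT
    (∃ (prog : Cmd AcountPrim) (C : ℕ), ∀ (n k : ℕ) (h : k + 1 ≤ n),
      4 * Real.logb 2 (16 * (n : ℝ)) ≤ (k : ℝ) + 1 → ∀ F : CNF n,
        ∃ μ : PMF Val,
          prog.Computes (acountInterp (acountBias n k) (acountBias_le_one h))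
            (Val.node (Val.ofNat k) (Val.ofCNF F))
            ((C : ℝ) * ((n : ℝ) * Real.logb 2 (n : ℝ) *
              ((n : ℝ) ^ 2 + (2 : ℝ) ^ k * (k : ℝ) * (n : ℝ) + (F.size : ℝ)))) μ ∧
          μ.map Val.binToNat = acount k h F) ∧
    -- approximation guarantee of ACOUNT
    (∀ (n k : ℕ) (h : k + 1 ≤ n), 4 * Real.logb 2 (16 * (n : ℝ)) ≤ (k : ℝ) + 1 →
      ∀ κ : ℝ, 0 < κ →
        (k : ℝ) + 1 = κ * Real.logb 2 (512 * κ) * (4 * Real.logb 2 (16 * (n : ℝ))) →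
        ∀ F : CNF n, F.isSat = true →
          1 / 4 ≤ (acount k h F).pr fun a =>
            1 / 4 * (2 : ℝ) ^ (-((n : ℝ) / κ)) * (F.numSols : ℝ) ≤ (a : ℝ) ∧
            (a : ℝ) ≤ 4 * (F.numSols : ℝ)) ∧
    -- approximation guarantee of ACOUNT-CONSTANT
    (∀ k : ℕ, 5 ≤ k → ∃ n₀ : ℕ, ∀ (n : ℕ) (h : k ≤ n), n₀ ≤ n →
      ∀ F : CNF n, F.isSat = true →
        1 / 4 ≤ (acountConstant k h F).pr fun a =>
          1 / 4 * (2 : ℝ) ^ (-(n : ℝ) + Real.logb 2 (n : ℝ) / (k : ℝ) *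
            (n : ℝ) ^ (1 - 4 / (k : ℝ))) * (F.numSols : ℝ) ≤ (a : ℝ) ∧
          (a : ℝ) ≤ 4 * (F.numSols : ℝ)) := by
  refine ⟨approxCount_complexity, acount_runningTime, ?_, fun k hk => acountConstant_guarantee k hk⟩
  intro n k h hk κ hκ hkκ F hF
  exact acount_guarantee n k h hk κ hκ hkκ F hF
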